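/- **Theorem 4.1.** Let $d\in\{2,3\}$, let $\Omega\subset\mathbb R^d$ be a bounded polygonal ($d=2$) or polyhedral ($d=3$) domain with Lipschitz boundary $\partial\Omega=\Gamma_D\cup\Gamma_N$ (with $\Gamma_D\cap\Gamma_N$ of surface measure zero), and let $\mathcal T_h$ be a finite partition of $\Omega$ into polygons or polyhedra $T$ of diameter $h_T$, with set $\mathcal E_h$ of (flat) edges or faces, such that each boundary face lies in $\Gamma_D$ or in $\Gamma_N$; $\mathbf n$ denotes the outward unit normal on $\partial T$. Let the symmetric matrix field $a$ and the vector field $\mathbf b$ be piecewise constant with respect to $\mathcal T_h$, with $\xi^Ta(x)\xi\ge\alpha|\xi|^2$ for some constant $\alpha>0$, all $x\in\Omega$ and all $\xi\in\mathbb R^d$. Put $\mathcal L w=\nabla\cdot(a\nabla w)$. *Regularity assumption.* Let $W=\{w\in H^1(\Omega): a\nabla w\in H(\mathrm{div};\Omega),\ w|_{\Gamma_D}=0,\ a\nabla w\cdot\mathbf n|_{\Gamma_N}=0\}$. For some $\epsilon\in[0,\tfrac12)$ there is a constant $C$ such that for every $\psi\in L^2(\Omega)$ the dual problem: find $\lambda\in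 W$ with $$(v,\nabla\cdot(a\nabla\lambda)+\mathbf b\cdot\nabla\lambda)=(\psi,v)\qquad\text{for all } v\in H^{\epsilon}(\Omega),$$ has a solution, and every solution lies in $H^{2-\epsilon}(\Omega)$ and satisfies $\|\lambda\|_{2-\epsilon}\le C\|\psi\|_{-\epsilon}$, where $\|\psi\|_{-\epsilon}$ is the norm of $v\mapsto(\psi,v)$ in the dual of $H^\epsilon(\Omega)$. *The scheme.* Let $k\ge2$ and $s\ge0$ be integers and $\gamma\ge0$. Let $M_h$ be the space of functions on $\Omega$ that are polynomials of degree at most $s$ on each $T$. Let $W_h$ be the space of triples $w=\{w_0,w_b,w_n\}$ with $w_0|_T\in P_k(T)$ for each $T$, $w_b|_e\in P_k(e)$ for each $e\in\mathcal E_h$ (one value for both neighbours of $e$), and $w_n|_e\in P_{k-1}(e)$ for each $T$ and each face $e\subset\partial T$, where the two values of $w_n$ on an interior face, seen from its two neighbours, add up to zero ($w_n$ stands for $a\nabla w\cdot\mathbf n$). Let $W_h^0=\{w\in W_h: w_b=0\text{ on }\Gamma_D,\ w_n=0\text{ on }\Gamma_N\}$. On each $T$, let $\nabla_ww\in[P_{k-1}(T)]^d$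 and $\mathcal L_ww\in P_s(T)$ be the polynomials with $$(\nabla_ww,\boldsymbol\psi)_T=-(w_0,\nabla\cdot\boldsymbol\psi)_T+\langle w_b,\boldsymbol\psi\cdot\mathbf n\rangle_{\partial T}\quad\text{for all }\boldsymbol\psi\in[P_{k-1}(T)]^d,$$ $$(\mathcal L_ww,p)_T=(w_0,\mathcal Lp)_T-\langle w_b,a\nabla p\cdot\mathbf n\rangle_{\partial T}+\langle w_n,p\rangle_{\partial T}\quad\text{for all }p\in P_s(T).$$ With $|a|_T=\sup_{x\in T}\big(\sum_{i,j}a_{ij}(x)^2\big)^{1/2}$, and with the coefficients on $\partial T$ taken from inside $T$, put $$\begin{aligned}s(\lambda,w)=\sum_{T\in\mathcal T_h}\Big[&h_T^{-3}\langle(|a|_T+|\mathbf b\cdot\mathbf n|)(\lambda_0-\lambda_b),w_0-w_b\rangle_{\partial T}+h_T^{-1}\langle a\nabla\lambda_0\cdot\mathbf n-\lambda_n,a\nabla w_0\cdot\mathbf n-w_n\rangle_{\partial T}\\&+\gamma(\mathcal L\lambda_0+\mathbf b\cdot\nabla\lambda_0,\mathcal Lw_0+\mathbf b\cdot\nabla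 w_0)_T\Big],\end{aligned}$$ $$b(u,w)=\sum_{T\in\mathcal T_h}(u,\mathcal L_ww+\mathbf b\cdot\nabla_ww)_T .$$ Given integrable $f$ on $\Omega$, $g_1$ on $\Gamma_D$ and $g_2$ on $\Gamma_N$, the primal-dual weak Galerkin scheme is: find $(u_h,\lambda_h)\in M_h\times W_h^0$ such that $$s(\lambda_h,w)+b(u_h,w)=-(f,w_0)+\langle g_2,w_b\rangle_{\Gamma_N}+\langle g_1,w_n\rangle_{\Gamma_D}\quad\text{for all }w\in W_h^0,\qquad b(v,\lambda_h)=0\quad\text{for all }v\in M_h.$$ *Conclusion.* For every $k\ge2$: if $\gamma>0$, then the scheme has exactly one solution $(u_h,\lambda_h)$ for $s=k-2$ and for $s=k-1$; if $\gamma=0$, then it has exactly one solution for $s=k-1$. -/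

import Mathlib

open MeasureTheory Filter Topology Set
open scoped ENNReal NNReal ContDiff

namespace PDWG

noncomputable section

/-- `ℝ^d` with the Euclidean norm. -/
abbrev Eu (d : ℕ) : Type := EuclideanSpace ℝ (Fin d)

/-- Surface measure on subsets of `ℝ^d`: the `(d-1)`-dimensional Hausdorff measure, normalized so
that it is arc length for `d = 2` and area for `d = 3`. -/
def surf (d : ℕ) : Measure (Eu d) := Measure.euclideanHausdorffMeasure (d - 1)

/-! ### Classical differential operators (used on smooth functions and polynomials) -/

/-- Partial derivative `∂_i f (x)`. -/
def pd {d : ℕ} (i : Fin d) (f : Eu d → ℝ) (x : Eu d) : ℝ :=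
  fderiv ℝ f x (EuclideanSpace.single i 1)

/-- Divergence of a vector field. -/
def dvg {d : ℕ} (F : Eu d → Eu d) (x : Eu d) : ℝ :=
  ∑ i, pd i (fun y => F y i) x

/-- Matrix times vector. -/
def mv {d : ℕ} (A : Matrix (Fin d) (Fin d) ℝ) (v : Eu d) : Eu d :=
  WithLp.toLp 2 (A.mulVec v.ofLp)

/-- The diffusive operator `𝓛 w = ∇ · (a ∇ w)`. -/
def diffOp {d : ℕ} (a : Eu d → Matrix (Fin d) (Fin d) ℝ) (w : Eu d → ℝ) : Eu d → ℝ :=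
  dvg (fun y => mv (a y) (gradient w y))

/-! ### Sobolev spaces -/

/-- `g` is the weak partial derivative `∂_i w` on the open set `Ω`. -/
def HasWeakPartial {d : ℕ} (Ω : Set (Eu d)) (i : Fin d) (w g : Eu d → ℝ) : Prop :=
  ∀ φ : Eu d → ℝ, ContDiff ℝ ∞ φ → HasCompactSupport φ → tsupport φ ⊆ Ω →
    ∫ x in Ω, w x * pd i φ x = - ∫ x in Ω, g x * φ x

/-- `w ∈ H¹(Ω)` with weak gradient `G`. -/
structure HasWeakGrad {d : ℕ} (Ω : Set (Eu d)) (w : Eu d → ℝ) (G : Eu d → Eu d) : Prop where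
  memLp : MemLp w 2 (volume.restrict Ω)
  memLp_grad : MemLp G 2 (volume.restrict Ω)
  partials : ∀ i, HasWeakPartial Ω i w (fun x => G x i)

/-- `F ∈ H(div; Ω)` with weak divergence `g`. -/
structure HasWeakDiv {d : ℕ} (Ω : Set (Eu d)) (F : Eu d → Eu d) (g : Eu d → ℝ) : Prop where
  memLp : MemLp F 2 (volume.restrict Ω)
  memLp_div : MemLp g 2 (volume.restrict Ω)
  div : ∀ φ : Eu d → ℝ, ContDiff ℝ ∞ φ → HasCompactSupport φ → tsupport φ ⊆ Ω →
    ∫ x in Ω, inner ℝ (F x) (gradient φ x) = - ∫ x in Ω, g x * φ x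

/-- `‖w‖²` in `L²(Ω)`, equal to `∞` if `w ∉ L²(Ω)`. -/
def l2Sq {d : ℕ} (Ω : Set (Eu d)) (w : Eu d → ℝ) : ℝ≥0∞ :=
  ⨅ _ : AEStronglyMeasurable w (volume.restrict Ω), ∫⁻ x in Ω, ‖w x‖ₑ ^ 2

/-- Square of the Gagliardo (Sobolev-Slobodeckij) seminorm of order `θ ∈ (0,1)`. -/
def gagliardoSq {d : ℕ} (Ω : Set (Eu d)) (θ : ℝ) (w : Eu d → ℝ) : ℝ≥0∞ :=
  ∫⁻ x in Ω, ∫⁻ y in Ω, ENNReal.ofReal (|w x - w y| ^ 2 / ‖x - y‖ ^ ((d : ℝ) + 2 * θ))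

/-- Square of the norm of `H^{n+θ}(Ω)`, `0 ≤ θ < 1`, equal to `∞` outside that space:
`‖w‖²_θ = ‖w‖² + |w|²_θ` (no second term if `θ = 0`) and
`‖w‖²_{n+1+θ} = ‖w‖² + ∑ i, ‖∂_i w‖²_{n+θ}` with weak derivatives (unique a.e. in `Ω`, so that the
infimum is over at most one a.e. class). -/
def sobolevSq {d : ℕ} (Ω : Set (Eu d)) (θ : ℝ) : ℕ → (Eu d → ℝ) → ℝ≥0∞
  | 0, w => l2Sq Ω w + (if θ = 0 then 0 else gagliardoSq Ω θ w)
  | n + 1, w => ⨅ g : Fin d → Eu d → ℝ, ⨅ _ : ∀ i, HasWeakPartial Ω i w (g i),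
      l2Sq Ω w + ∑ i, sobolevSq Ω θ n (g i)

/-- The norm `‖w‖_{s,Ω}` of `H^s(Ω)`, for real `s ≥ 0`; `w ∈ H^s(Ω)` iff it is finite. -/
def sobolevNorm {d : ℕ} (Ω : Set (Eu d)) (s : ℝ) (w : Eu d → ℝ) : ℝ≥0∞ :=
  (sobolevSq Ω (Int.fract s) ⌊s⌋₊ w) ^ (1 / 2 : ℝ)

/-- The norm `‖ψ‖_{-s,Ω}`, by duality with `H^s(Ω)`, of `ψ ∈ L²(Ω)`. -/
def negSobolevNorm {d : ℕ} (Ω : Set (Eu d)) (s : ℝ) (ψ : Eu d → ℝ) : ℝ≥0∞ :=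
  ⨆ v : Eu d → ℝ, ⨆ _ : sobolevNorm Ω s v ≤ 1, ENNReal.ofReal |∫ x in Ω, ψ x * v x|

/-- `g ∈ L²(∂Ω)` is the trace of `w ∈ H¹(Ω)`: the trace operator is the continuous extension of the
restriction to the boundary of functions that are smooth up to the boundary. -/
def HasTrace {d : ℕ} (Ω : Set (Eu d)) (w g : Eu d → ℝ) : Prop :=
  ∃ G : Eu d → Eu d, HasWeakGrad Ω w G ∧ MemLp g 2 ((surf d).restrict (frontier Ω)) ∧
    ∃ φ : ℕ → Eu d → ℝ, (∀ n, ContDiff ℝ ∞ (φ n)) ∧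
      Tendsto (fun n => eLpNorm (fun x => φ n x - w x) 2 (volume.restrict Ω)) atTop (𝓝 0) ∧
      Tendsto (fun n => eLpNorm (fun x => gradient (φ n) x - G x) 2 (volume.restrict Ω))
        atTop (𝓝 0) ∧
      Tendsto (fun n => eLpNorm (fun x => φ n x - g x) 2 ((surf d).restrict (frontier Ω)))
        atTop (𝓝 0)

/-- `w|_Γ = 0` for `w ∈ H¹(Ω)` and `Γ ⊆ ∂Ω`. -/
def TraceZeroOn {d : ℕ} (Ω Γ : Set (Eu d)) (w : Eu d → ℝ) : Prop :=
  ∃ g, HasTrace Ω w g ∧ ∀ᵐ x ∂(surf d), x ∈ Γ → g x = 0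

/-- For `F ∈ H(div; Ω)` with divergence `g`: `F · n = 0` on `∂Ω \ ΓD`, in the usual sense of
normal traces of `H(div; Ω)`, by duality with the functions in `H¹(Ω)` that vanish on `ΓD`. -/
def NormalTraceZeroOff {d : ℕ} (Ω ΓD : Set (Eu d)) (F : Eu d → Eu d) (g : Eu d → ℝ) : Prop :=
  ∀ (v : Eu d → ℝ) (Gv : Eu d → Eu d), HasWeakGrad Ω v Gv → TraceZeroOn Ω ΓD v →
    ∫ x in Ω, (inner ℝ (F x) (Gv x) + g x * v x) = 0

/-! ### The dual problem -/

/-- `lam ∈ W` solves the dual problem with right-hand side `ψ`: `lam ∈ H¹(Ω)`,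
`a ∇ lam ∈ H(div; Ω)`, `lam = 0` on `Γ_D`, `a ∇ lam · n = 0` on `Γ_N = ∂Ω \ Γ_D`, and
`(v, ∇ · (a ∇ lam) + b · ∇ lam) = (ψ, v)` for all `v ∈ H^ε(Ω)`. -/
def IsDualSolution {d : ℕ} (Ω ΓD : Set (Eu d)) (a : Eu d → Matrix (Fin d) (Fin d) ℝ)
    (b : Eu d → Eu d) (ε : ℝ) (ψ lam : Eu d → ℝ) : Prop :=
  ∃ (G : Eu d → Eu d) (g : Eu d → ℝ),
    HasWeakGrad Ω lam G ∧ HasWeakDiv Ω (fun x => mv (a x) (G x)) g ∧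
    TraceZeroOn Ω ΓD lam ∧ NormalTraceZeroOff Ω ΓD (fun x => mv (a x) (G x)) g ∧
    ∀ v : Eu d → ℝ, sobolevNorm Ω ε v < ⊤ →
      ∫ x in Ω, v x * (g x + inner ℝ (b x) (G x)) = ∫ x in Ω, ψ x * v x

/-- `H^{2-ε}`-regularity of the dual problem: for every `ψ ∈ L²(Ω)` it has a solution in `W`, and
every solution satisfies `‖lam‖_{2-ε} ≤ C ‖ψ‖_{-ε}`. The right-hand side is finite, so that
`lam ∈ H^{2-ε}(Ω)`; for `ψ = 0` it says that `lam = 0` is the only solution. -/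
def DualRegular {d : ℕ} (Ω ΓD : Set (Eu d)) (a : Eu d → Matrix (Fin d) (Fin d) ℝ)
    (b : Eu d → Eu d) (ε : ℝ) : Prop :=
  ∃ C : ℝ≥0, ∀ ψ : Eu d → ℝ, MemLp ψ 2 (volume.restrict Ω) →
    (∃ lam, IsDualSolution Ω ΓD a b ε ψ lam) ∧
    ∀ lam, IsDualSolution Ω ΓD a b ε ψ lam →
      sobolevNorm Ω (2 - ε) lam ≤ C * negSobolevNorm Ω ε ψ

/-! ### Domains and meshes -/

/-- An open bounded connected set of polygonal / polyhedral shape: its boundary lies in finitely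
many hyperplanes, and it has no slits or punctures. -/
structure IsPolyhedralDomain {d : ℕ} (S : Set (Eu d)) : Prop where
  isOpen : IsOpen S
  isConnected : IsConnected S
  isBounded : Bornology.IsBounded S
  interior_closure : interior (closure S) = S
  frontier_subset : ∃ H : Finset (Eu d × ℝ), (∀ h ∈ H, h.1 ≠ 0) ∧
    frontier S ⊆ ⋃ h ∈ H, {x | inner ℝ h.1 x = h.2}

/-- Near each boundary point, `S` is the region above the graph of a Lipschitz function, in some
orthonormal coordinate system with vertical axis `ν`. -/
def HasLipschitzBoundary {d : ℕ} (S : Set (Eu d)) : Prop :=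
  ∀ x₀ ∈ frontier S, ∃ ν : Eu d, ‖ν‖ = 1 ∧ ∃ U : Set (Eu d), IsOpen U ∧ x₀ ∈ U ∧
    ∃ (K : ℝ≥0) (ζ : Eu d → ℝ), LipschitzWith K ζ ∧
      ∀ x ∈ U, x ∈ S ↔ ζ (x - (inner ℝ ν x : ℝ) • ν) < inner ℝ ν x

/-- A finite element partition of `Ω` into polygons / polyhedra `cell T`, with the set of its edges
/ flat faces `face e` (relatively open, pairwise disjoint; hanging nodes are allowed, in which case
the sides of an element are subdivided) and the outward unit normals `normal T e` of the cell `T` on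
its faces `e`. -/
structure PolyMesh {d : ℕ} (Ω : Set (Eu d)) where
  Cell : Type
  Face : Type
  fintypeCell : Fintype Cell
  fintypeFace : Fintype Face
  cell : Cell → Set (Eu d)
  face : Face → Set (Eu d)
  normal : Cell → Face → Eu d
  cell_polyhedral : ∀ T, IsPolyhedralDomain (cell T)
  cell_subset : ∀ T, cell T ⊆ Ω
  cell_disjoint : ∀ T T', T ≠ T' → Disjoint (cell T) (cell T')
  cover : Ω ⊆ ⋃ T, closure (cell T)
  /-- Each face is a nonempty connected relatively open subset of a hyperplane. -/
  face_flat : ∀ e, ∃ (m : Eu d) (c : ℝ) (U : Set (Eu d)), m ≠ 0 ∧ IsOpen U ∧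
    face e = U ∩ {x | inner ℝ m x = c}
  face_connected : ∀ e, IsConnected (face e)
  face_disjoint : ∀ e e', e ≠ e' → Disjoint (face e) (face e')
  /-- Each face is interior or a boundary face. -/
  face_position : ∀ e, face e ⊆ Ω ∨ face e ⊆ frontier Ω
  face_cell : ∀ T e, face e ⊆ frontier (cell T) ∨ Disjoint (face e) (frontier (cell T))
  face_mem : ∀ e, ∃ T, face e ⊆ frontier (cell T)
  /-- The faces make up the boundary of each cell, up to a set of surface measure zero. -/
  frontier_cover : ∀ T, surf d (frontier (cell T) \ ⋃ e, face e) = 0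
  normal_norm : ∀ T e, face e ⊆ frontier (cell T) → ‖normal T e‖ = 1
  normal_perp : ∀ T e, face e ⊆ frontier (cell T) →
    ∃ c : ℝ, face e ⊆ {x | inner ℝ (normal T e) x = c}
  /-- The cell lies on one side of its face, and the normal points to the other side. -/
  normal_outward : ∀ T e, face e ⊆ frontier (cell T) → ∀ x ∈ face e,
    ∀ᶠ t : ℝ in 𝓝[>] 0, x - t • normal T e ∈ cell T ∧ x + t • normal T e ∉ closure (cell T)

attribute [instance] PolyMesh.fintypeCell PolyMesh.fintypeFace

namespace PolyMesh

variable {d : ℕ} {Ω : Set (Eu d)} (M : PolyMesh Ω)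

/-- `e` is a face of the cell `T`. -/
def Inc (T : M.Cell) (e : M.Face) : Prop := M.face e ⊆ frontier (M.cell T)

/-- Meshsize `h_T`. -/
def meshSize (T : M.Cell) : ℝ := Metric.diam (M.cell T)

/-- Trace on the boundary of `T`, taken from inside `T`, of a function on `T` that is continuous up
to the boundary. -/
def tr {α : Type} [TopologicalSpace α] [Nonempty α] (T : M.Cell) (f : Eu d → α) : Eu d → α :=
  extendFrom (M.cell T) f

open Classical in
/-- `∫_{∂T} F`, where `F e` is the integrand on the face `e`. -/
def bdryInt (T : M.Cell) (F : M.Face → Eu d → ℝ) : ℝ :=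
  ∑ e, if M.Inc T e then ∫ x in M.face e, F e x ∂(surf d) else 0

/-- `f` is piecewise constant on the mesh. -/
def IsPiecewiseConstant {α : Type} (f : Eu d → α) : Prop :=
  ∀ T, ∃ c, ∀ x ∈ M.cell T, f x = c

/-- `∂Ω = ΓD ∪ ΓN`, essentially disjoint, each boundary face lying in one of the two parts. -/
structure IsBoundaryPartition (ΓD ΓN : Set (Eu d)) : Prop where
  union : ΓD ∪ ΓN = frontier Ω
  inter : surf d (ΓD ∩ ΓN) = 0
  resolved : ∀ e, M.face e ⊆ frontier Ω → M.face e ⊆ ΓD ∨ M.face e ⊆ ΓN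

end PolyMesh

/-! ### Polynomial spaces -/

/-- Polynomial functions of degree at most `r` on `ℝ^d`. A polynomial on an open nonempty set is
the restriction of exactly one of them, so this also serves as `P_r(T)` for a cell `T`. -/
def polyFun (d r : ℕ) : Submodule ℝ (Eu d → ℝ) :=
  (MvPolynomial.restrictTotalDegree (Fin d) ℝ r).map
    (LinearMap.pi fun x : Eu d => (MvPolynomial.aeval fun i => x i).toLinearMap)

/-- `P_r(S)` as a space of functions on the set `S` (extended by zero outside `S`). -/
def polyOn {d : ℕ} (r : ℕ) (S : Set (Eu d)) : Submodule ℝ (Eu d → ℝ) where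
  carrier := {f | ∃ p ∈ polyFun d r, f = S.indicator p}
  add_mem' := by
    rintro _ _ ⟨p, hp, rfl⟩ ⟨q, hq, rfl⟩
    exact ⟨p + q, Submodule.add_mem _ hp hq, (Set.indicator_add' S p q).symm⟩
  zero_mem' := ⟨0, Submodule.zero_mem _, (Set.indicator_zero (M := ℝ) S).symm⟩
  smul_mem' := by
    rintro c _ ⟨p, hp, rfl⟩
    exact ⟨c • p, Submodule.smul_mem _ c hp, (Set.indicator_const_smul S c p).symm⟩

/-- Vector fields with components in `P_r`. -/
def IsPolyVec {d : ℕ} (r : ℕ) (F : Eu d → Eu d) : Prop :=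
  ∀ i, (fun x => F x i) ∈ polyFun d r

/-! ### Weak functions, discrete weak operators -/

namespace PolyMesh

variable {d : ℕ} {Ω : Set (Eu d)} (M : PolyMesh Ω)

/-- A triple `{v_0, v_b, v_n}` on the mesh: `v_0` on each cell, `v_b` on each face (one value for
both neighbours), and `v_n` on each face of each cell, standing for `a ∇ v · n` with the outward
normal of that cell. -/
abbrev WeakFn : Type :=
  (M.Cell → Eu d → ℝ) × (M.Face → Eu d → ℝ) × (M.Cell → M.Face → Eu d → ℝ)

/-- The weak finite element space `W_h`. On an interior face the two values of `v_n` are those of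
one flux seen with opposite outward normals. -/
def Wh (k : ℕ) : Submodule ℝ M.WeakFn where
  carrier := {w | (∀ T, w.1 T ∈ polyFun d k) ∧ (∀ e, w.2.1 e ∈ polyOn k (M.face e)) ∧
    (∀ T e, M.Inc T e → w.2.2 T e ∈ polyOn (k - 1) (M.face e)) ∧
    (∀ T e, ¬ M.Inc T e → w.2.2 T e = 0) ∧
    ∀ T T' e, T ≠ T' → M.Inc T e → M.Inc T' e → w.2.2 T e + w.2.2 T' e = 0}
  add_mem' := by
    rintro v w ⟨v1, v2, v3, v4, v5⟩ ⟨w1, w2, w3, w4, w5⟩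
    refine ⟨fun T => Submodule.add_mem _ (v1 T) (w1 T), fun e => Submodule.add_mem _ (v2 e) (w2 e),
      fun T e h => Submodule.add_mem _ (v3 T e h) (w3 T e h), fun T e h => ?_,
      fun T T' e h h1 h2 => ?_⟩
    · show v.2.2 T e + w.2.2 T e = 0
      rw [v4 T e h, w4 T e h, add_zero]
    · show (v.2.2 T e + w.2.2 T e) + (v.2.2 T' e + w.2.2 T' e) = 0
      rw [add_add_add_comm, v5 T T' e h h1 h2, w5 T T' e h h1 h2, add_zero]
  zero_mem' := ⟨fun _ => Submodule.zero_mem _, fun _ => Submodule.zero_mem _,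
    fun _ _ _ => Submodule.zero_mem _, fun _ _ _ => rfl, fun _ _ _ _ _ _ => add_zero 0⟩
  smul_mem' := by
    rintro c v ⟨v1, v2, v3, v4, v5⟩
    refine ⟨fun T => Submodule.smul_mem _ c (v1 T), fun e => Submodule.smul_mem _ c (v2 e),
      fun T e h => Submodule.smul_mem _ c (v3 T e h), fun T e h => ?_, fun T T' e h h1 h2 => ?_⟩
    · show c • v.2.2 T e = 0
      rw [v4 T e h, smul_zero]
    · show c • v.2.2 T e + c • v.2.2 T' e = 0
      rw [← smul_add, v5 T T' e h h1 h2, smul_zero]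

/-- The subspace `W_h^0`: `v_b = 0` on `Γ_D` and `v_n = 0` on `Γ_N`. -/
def Wh0 (ΓD ΓN : Set (Eu d)) (k : ℕ) : Submodule ℝ M.WeakFn where
  carrier := {w | w ∈ M.Wh k ∧ (∀ e, M.face e ⊆ ΓD → w.2.1 e = 0) ∧
    ∀ T e, M.face e ⊆ ΓN → w.2.2 T e = 0}
  add_mem' := by
    rintro v w ⟨v1, v2, v3⟩ ⟨w1, w2, w3⟩
    refine ⟨Submodule.add_mem _ v1 w1, fun e h => ?_, fun T e h => ?_⟩
    · show v.2.1 e + w.2.1 e = 0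
      rw [v2 e h, w2 e h, add_zero]
    · show v.2.2 T e + w.2.2 T e = 0
      rw [v3 T e h, w3 T e h, add_zero]
  zero_mem' := ⟨Submodule.zero_mem _, fun _ _ => rfl, fun _ _ _ => rfl⟩
  smul_mem' := by
    rintro c v ⟨v1, v2, v3⟩
    refine ⟨Submodule.smul_mem _ c v1, fun e h => ?_, fun T e h => ?_⟩
    · show c • v.2.1 e = 0
      rw [v2 e h, smul_zero]
    · show c • v.2.2 T e = 0
      rw [v3 T e h, smul_zero]

/-- The space `M_h` of piecewise polynomials of degree at most `s`. -/
def Mh (s : ℕ) : Submodule ℝ (M.Cell → Eu d → ℝ) := Submodule.pi Set.univ fun _ => polyFun d s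

/-- `G` is the discrete weak gradient `∇_{w,r,T} v`. -/
def IsWeakGrad (r : ℕ) (T : M.Cell) (v : M.WeakFn) (G : Eu d → Eu d) : Prop :=
  IsPolyVec r G ∧ ∀ Ψ : Eu d → Eu d, IsPolyVec r Ψ →
    ∫ x in M.cell T, inner ℝ (G x) (Ψ x) =
      - (∫ x in M.cell T, v.1 T x * dvg Ψ x)
      + M.bdryInt T (fun e x => v.2.1 e x * inner ℝ (Ψ x) (M.normal T e))

/-- `q` is the discrete weak action `𝓛_{w,r,T} v` of `𝓛 = ∇ · (a ∇)`. -/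
def IsWeakDiffOp (a : Eu d → Matrix (Fin d) (Fin d) ℝ) (r : ℕ) (T : M.Cell) (v : M.WeakFn)
    (q : Eu d → ℝ) : Prop :=
  q ∈ polyFun d r ∧ ∀ p ∈ polyFun d r,
    ∫ x in M.cell T, q x * p x =
      (∫ x in M.cell T, v.1 T x * diffOp a p x)
      - M.bdryInt T (fun e x => v.2.1 e x *
          inner ℝ (mv (M.tr T a x) (gradient p x)) (M.normal T e))
      + M.bdryInt T (fun e x => v.2.2 T e x * p x)

/-- The polynomial `∇_{w,r,T} v`. It exists and is unique for `v ∈ W_h`, the `L²(T)` inner product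
being positive definite on polynomials. -/
def weakGrad (r : ℕ) (T : M.Cell) (v : M.WeakFn) : Eu d → Eu d :=
  Classical.epsilon (M.IsWeakGrad r T v)

/-- The polynomial `𝓛_{w,r,T} v`; it exists and is unique for `v ∈ W_h` and `a` constant on `T`. -/
def weakDiffOp (a : Eu d → Matrix (Fin d) (Fin d) ℝ) (r : ℕ) (T : M.Cell) (v : M.WeakFn) :
    Eu d → ℝ :=
  Classical.epsilon (M.IsWeakDiffOp a r T v)

/-! ### The scheme -/

/-- `|a|_T`, the supremum over `T` of the Frobenius norm of `a`. -/
def supNorm (a : Eu d → Matrix (Fin d) (Fin d) ℝ) (T : M.Cell) : ℝ :=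
  ⨆ x : M.cell T, Real.sqrt (∑ i, ∑ j, (a x i j) ^ 2)

/-- `a ∇ w_0 · n - w_n` on the face `e` of `T`. -/
def fluxDefect (a : Eu d → Matrix (Fin d) (Fin d) ℝ) (T : M.Cell) (w : M.WeakFn)
    (e : M.Face) (x : Eu d) : ℝ :=
  inner ℝ (mv (M.tr T a x) (gradient (w.1 T) x)) (M.normal T e) - w.2.2 T e x

/-- `𝓛 w_0 + b · ∇ w_0` on `T`. -/
def residual (a : Eu d → Matrix (Fin d) (Fin d) ℝ) (b : Eu d → Eu d) (T : M.Cell)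
    (w : M.WeakFn) (x : Eu d) : ℝ :=
  diffOp a (w.1 T) x + inner ℝ (b x) (gradient (w.1 T) x)

/-- The local stabilizer `s_T(lam, w)`. -/
def stabT (a : Eu d → Matrix (Fin d) (Fin d) ℝ) (b : Eu d → Eu d) (γ : ℝ) (T : M.Cell)
    (lam w : M.WeakFn) : ℝ :=
  (M.meshSize T ^ 3)⁻¹ * M.bdryInt T (fun e x =>
      (M.supNorm a T + |inner ℝ (M.tr T b x) (M.normal T e)|) *
        (lam.1 T x - lam.2.1 e x) * (w.1 T x - w.2.1 e x))
  + (M.meshSize T)⁻¹ * M.bdryInt T (fun e x => M.fluxDefect a T lam e x * M.fluxDefect a T w e x)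
  + γ * ∫ x in M.cell T, M.residual a b T lam x * M.residual a b T w x

/-- The stabilizer `s(lam, w)`. -/
def stab (a : Eu d → Matrix (Fin d) (Fin d) ℝ) (b : Eu d → Eu d) (γ : ℝ)
    (lam w : M.WeakFn) : ℝ :=
  ∑ T, M.stabT a b γ T lam w

/-- `b(u, w) = ∑_T (u, 𝓛_w w + b · ∇_w w)_T`, where `𝓛_w` has degree `s` and `∇_w` has degree
`k - 1`. -/
def bForm (a : Eu d → Matrix (Fin d) (Fin d) ℝ) (b : Eu d → Eu d) (k s : ℕ)
    (u : M.Cell → Eu d → ℝ) (w : M.WeakFn) : ℝ :=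
  ∑ T, ∫ x in M.cell T,
    u T x * (M.weakDiffOp a s T w x + inner ℝ (b x) (M.weakGrad (k - 1) T w x))

open Classical in
/-- `-(f, w_0) + ⟨g₂, w_b⟩_{Γ_N} + ⟨g₁, w_n⟩_{Γ_D}`. -/
def load (ΓD ΓN : Set (Eu d)) (f g₁ g₂ : Eu d → ℝ) (w : M.WeakFn) : ℝ :=
  - (∑ T, ∫ x in M.cell T, f x * w.1 T x)
  + (∑ e, if M.face e ⊆ ΓN then ∫ x in M.face e, g₂ x * w.2.1 e x ∂(surf d) else 0)
  + ∑ T, ∑ e, if M.Inc T e ∧ M.face e ⊆ ΓD then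
      ∫ x in M.face e, g₁ x * w.2.2 T e x ∂(surf d) else 0

/-- `(u_h, lam_h) ∈ M_h × W_h^0` solves the primal-dual weak Galerkin scheme. -/
def IsSolution (ΓD ΓN : Set (Eu d)) (a : Eu d → Matrix (Fin d) (Fin d) ℝ) (b : Eu d → Eu d)
    (γ : ℝ) (k s : ℕ) (f g₁ g₂ : Eu d → ℝ) (p : (M.Cell → Eu d → ℝ) × M.WeakFn) : Prop :=
  p.1 ∈ M.Mh s ∧ p.2 ∈ M.Wh0 ΓD ΓN k ∧
  (∀ w ∈ M.Wh0 ΓD ΓN k,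
    M.stab a b γ p.2 w + M.bForm a b k s p.1 w = M.load ΓD ΓN f g₁ g₂ w) ∧
  ∀ v ∈ M.Mh s, M.bForm a b k s v p.2 = 0

end PolyMesh

end

end PDWG

/-! ### Hyperplanes, surface measure and oblique slicing -/

namespace PDWG

/-! The scheme is a square linear system on the finite-dimensional space `M_h × W_h^0`, so it is
enough that the homogeneous system has only the zero solution (`existsUnique_saddle`,
`existsUnique_isSolution`). Let `(u, v)` solve it.

Testing with `v` and using `b(u, v) = 0` gives `s(v, v) = 0`. Hence `v_b` is the trace of `v_0` and
`v_n` is the normal flux of `v_0` on every face (`of_constStab_self_eq_zero`), so `v_0` is in `H¹`,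
its flux is in `H(div)`, and both satisfy the homogeneous boundary conditions. Its residual
`∇·(a∇v_0) + b·∇v_0` vanishes on each cell: for `γ > 0` it is part of the stabilizer; for `γ = 0`
the form `b(·, v)` is the `L²` product with the residual (`dualForm_of_conforming`), and the
residual has degree `k - 1 = s`, so it can be tested against itself. Thus `v_0` solves the dual
problem with zero data and vanishes by the regularity estimate (`eq_zero_of_conforming`).

Now `b(u, w) = 0` for all `w`. With the discrete operators eliminated (`bForm_eq`), this form pairs
`w_0` with the divergence of the adjoint flux `a∇u - u b`, `w_n` with the jumps of `u`, and `w_b`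
with the jumps of the flux. The degrees in `W_h` leave room to choose `w` as these quantities
themselves (`testFn`), so all of them vanish (`strong_adjoint`): `u` is continuous across faces,
zero on `Γ_D`, and solves the homogeneous adjoint problem. Pairing it with the solution of the dual
problem with data `u`, two Green formulas give `∫ u² = 0` (`eq_zero_of_strong_adjoint`).

Two analytic facts carry this. Gauss' theorem must hold on cells that need not be Lipschitz; it is
obtained by translating the cell and computing what its faces sweep over (`integral_fderiv_cell`).
And a continuous piecewise polynomial must have its boundary values as trace in the sense of
approximation by smooth functions: since `Ω` has Lipschitz boundary, such a function is Lipschitz up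
to the boundary, can be extended, and is then mollified (`traceZeroOn_of_continuous`). -/

/-- The hyperplane `⟨n, x⟩ = c`. -/
def hyp {d : ℕ} (n : Eu d) (c : ℝ) : Set (Eu d) := {x | inner ℝ n x = c}

variable {d : ℕ} {n m : Eu d} {c c' : ℝ}

lemma isClosed_hyp (n : Eu d) (c : ℝ) : IsClosed (hyp n c) :=
  isClosed_eq (by fun_prop) continuous_const

lemma exists_hyp_param (hn : ‖n‖ = 1) (c : ℝ) :
    ∃ f : Eu (d - 1) →ᵃⁱ[ℝ] Eu d, range f = hyp n c := by
  have hn0 : n ≠ 0 := by rintro rfl; simp at hn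
  have hr : Module.finrank ℝ (ℝ ∙ n)ᗮ = d - 1 := by
    have h := (ℝ ∙ n).finrank_add_finrank_orthogonal
    rw [finrank_span_singleton hn0, finrank_euclideanSpace, Fintype.card_fin] at h
    omega
  let g : Eu (d - 1) ≃ₗᵢ[ℝ] (ℝ ∙ n)ᗮ :=
    ((stdOrthonormalBasis ℝ (ℝ ∙ n)ᗮ).reindex (finCongr hr)).repr.symm
  let l : Eu (d - 1) →ₗᵢ[ℝ] Eu d := (ℝ ∙ n)ᗮ.subtypeₗᵢ.comp g.toLinearIsometry
  let f : Eu (d - 1) →ᵃⁱ[ℝ] Eu d :=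
    (AffineIsometryEquiv.vaddConst ℝ (c • n)).toAffineIsometry.comp l.toAffineIsometry
  have hf : ∀ p, f p = (g p : Eu d) + c • n := fun p => rfl
  refine ⟨f, ?_⟩
  have hnn : inner ℝ n n = (1 : ℝ) := by rw [real_inner_self_eq_norm_sq, hn]; norm_num
  ext x
  constructor
  · rintro ⟨p, rfl⟩
    have := Submodule.mem_orthogonal_singleton_iff_inner_right.1 (g p).2
    simp [hyp, hf, inner_add_right, inner_smul_right, this, hn]
  · intro hx
    have hx' : inner ℝ n x = c := hx
    refine ⟨g.symm ⟨x - c • n, ?_⟩, ?_⟩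
    · rw [Submodule.mem_orthogonal_singleton_iff_inner_right, inner_sub_right, inner_smul_right,
        hnn, hx']; simp
    · rw [hf]; simp

/-- Hausdorff measure is invariant under isometries and, in the Euclidean normalization, is Lebesgue
measure on `ℝ^(d-1)`. Questions about surface measure on a hyperplane thus become questions about
Lebesgue measure in a chart. -/
lemma surf_restrict_hyp {f : Eu (d - 1) →ᵃⁱ[ℝ] Eu d} (hf : range f = hyp n c) :
    (surf d).restrict (hyp n c) = (volume : Measure (Eu (d - 1))).map f := by
  rw [surf, ← hf, ← f.isometry.map_euclideanHausdorffMeasure,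
    EuclideanSpace.euclideanHausdorffMeasure_eq_volume]

lemma measurableEmbedding_param (f : Eu (d - 1) →ᵃⁱ[ℝ] Eu d) : MeasurableEmbedding f :=
  f.isometry.isClosedEmbedding.measurableEmbedding

lemma surf_inter_hyp {f : Eu (d - 1) →ᵃⁱ[ℝ] Eu d} (hf : range f = hyp n c) (S : Set (Eu d)) :
    surf d (S ∩ hyp n c) = volume (f ⁻¹' S) := by
  rw [← (measurableEmbedding_param f).map_apply, ← surf_restrict_hyp hf,
    Measure.restrict_apply' (isClosed_hyp n c).measurableSet]

lemma sFinite_surf_hyp (hn : ‖n‖ = 1) (c : ℝ) : SFinite ((surf d).restrict (hyp n c)) := by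
  obtain ⟨f, hf⟩ := exists_hyp_param hn c
  rw [surf_restrict_hyp hf]
  infer_instance

lemma surf_inter_hyp_lt_top (hn : ‖n‖ = 1) {S : Set (Eu d)} (hS : Bornology.IsBounded S) :
    surf d (S ∩ hyp n c) < ⊤ := by
  obtain ⟨f, hf⟩ := exists_hyp_param hn c
  rw [surf_inter_hyp hf]
  exact (f.isometry.antilipschitz.isBounded_preimage hS).measure_lt_top

lemma surf_inter_hyp_pos (hn : ‖n‖ = 1) {U : Set (Eu d)} (hU : IsOpen U)
    (hne : (U ∩ hyp n c).Nonempty) : 0 < surf d (U ∩ hyp n c) := by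
  obtain ⟨f, hf⟩ := exists_hyp_param hn c
  rw [surf_inter_hyp hf]
  obtain ⟨x, hx, hx'⟩ := hne
  rw [← hf] at hx'
  obtain ⟨p, rfl⟩ := hx'
  exact (hU.preimage f.continuous).measure_pos _ ⟨p, hx⟩

/-- In a chart of `hyp n c` the set `hyp m c'` is an affine subspace, proper because of `h`, hence
Lebesgue null. -/
lemma surf_hyp_inter_hyp (hn : ‖n‖ = 1) (h : ¬ hyp n c ⊆ hyp m c') :
    surf d (hyp m c' ∩ hyp n c) = 0 := by
  obtain ⟨f, hf⟩ := exists_hyp_param hn c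
  rw [surf_inter_hyp hf]
  let φ : Eu (d - 1) →ᵃ[ℝ] ℝ :=
    (innerSL ℝ m).toLinearMap.toAffineMap.comp f.toAffineMap
  let s : AffineSubspace ℝ (Eu (d - 1)) := (AffineSubspace.mk' c' ⊥).comap φ
  have hs : f ⁻¹' hyp m c' = s := by
    ext p
    simp [s, φ, hyp, AffineSubspace.mem_mk', sub_eq_zero]
  rw [hs]
  apply Measure.addHaar_affineSubspace
  intro htop
  apply h
  rw [← hf]
  rintro _ ⟨p, rfl⟩
  have : p ∈ (s : Set _) := by rw [htop]; trivial
  rw [← hs] at this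
  exact this

lemma volume_hyp (hm : m ≠ 0) (c : ℝ) : volume (hyp m c) = 0 := by
  let φ : Eu d →ᵃ[ℝ] ℝ := (innerSL ℝ m).toLinearMap.toAffineMap
  let s : AffineSubspace ℝ (Eu d) := (AffineSubspace.mk' c ⊥).comap φ
  have hs : hyp m c = s := by
    ext p
    simp [s, φ, hyp, AffineSubspace.mem_mk', sub_eq_zero]
  rw [hs]
  apply Measure.addHaar_affineSubspace
  intro htop
  -- This point lies at height `c + 1`, so the hyperplane is not the whole space.
  have : ((c + 1) / ‖m‖ ^ 2) • m ∈ (s : Set _) := by rw [htop]; trivial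
  rw [← hs] at this
  have hm' : ‖m‖ ≠ 0 := norm_ne_zero_iff.2 hm
  simp only [hyp, mem_ofPred_eq, inner_smul_right, real_inner_self_eq_norm_sq] at this
  field_simp at this
  linarith

/-- Normalization of a hyperplane. -/
lemma hyp_smul {r : ℝ} (hr : r ≠ 0) : hyp (r • m) (r * c) = hyp m c := by
  ext x; simp [hyp, inner_smul_left, hr]

lemma exists_unit_hyp (hm : m ≠ 0) (c : ℝ) : ∃ n' c'', ‖n'‖ = 1 ∧ hyp m c = hyp (d := d) n' c'' := by
  have hm' : ‖m‖ ≠ 0 := norm_ne_zero_iff.2 hm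
  exact ⟨‖m‖⁻¹ • m, ‖m‖⁻¹ * c, by rw [norm_smul, norm_inv, norm_norm, inv_mul_cancel₀ hm'],
    (hyp_smul (inv_ne_zero hm')).symm⟩

lemma volume_eq_lintegral_surf (hn : ‖n‖ = 1) {A : Set (Eu d)} (hA : MeasurableSet A) :
    volume A = ∫⁻ r : ℝ, surf d (A ∩ hyp n r) := by
  have hn0 : n ≠ 0 := by rintro rfl; simp at hn
  have hnn : inner ℝ n n = (1 : ℝ) := by rw [real_inner_self_eq_norm_sq, hn]; norm_num
  have h := EuclideanGeometry.euclideanHausdorffMeasure_eq_lintegral (0 : Eu d) hn0 hA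
  rw [InnerProductSpace.euclideanHausdorffMeasure_eq_volume] at h
  rw [h]
  have : ‖n‖ₑ = 1 := by rw [← ofReal_norm, hn]; simp
  rw [this, one_mul]
  refine lintegral_congr fun r => ?_
  rw [finrank_euclideanSpace, Fintype.card_fin, surf]
  congr 2
  ext x
  simp only [SetLike.mem_coe, AffineSubspace.mem_mk', Submodule.mem_orthogonal_singleton_iff_inner_right,
    vsub_eq_sub, vadd_eq_add, add_zero, inner_sub_right, inner_smul_right, hnn, hyp, mem_ofPred_eq]
  constructor <;> intro h <;> linarith

/-- Volume as an oblique product of surface measure on a hyperplane and length along `w`. -/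
lemma map_prod_surf_hyp (hn : ‖n‖ = 1) (c : ℝ) (w : Eu d) (hw : inner ℝ n w ≠ 0) :
    ENNReal.ofReal |inner ℝ n w| •
      (((surf d).restrict (hyp n c)).prod (volume : Measure ℝ)).map (fun p => p.1 + p.2 • w)
      = volume := by
  have := sFinite_surf_hyp (d := d) hn c
  ext A hA
  have hmeas : Measurable (fun p : Eu d × ℝ => p.1 + p.2 • w) := by fun_prop
  rw [Measure.smul_apply, Measure.map_apply hmeas hA, Measure.prod_apply_symm (hmeas hA),
    volume_eq_lintegral_surf hn hA, smul_eq_mul]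
  have h1 : ∀ s : ℝ, ((surf d).restrict (hyp n c)) ((fun x => (x, s)) ⁻¹'
      ((fun p : Eu d × ℝ => p.1 + p.2 • w) ⁻¹' A)) = surf d (A ∩ hyp n (c + s * inner ℝ n w)) := by
    intro s
    rw [Measure.restrict_apply' (isClosed_hyp n c).measurableSet]
    -- The slice at parameter `s` is the section of `A` by the parallel hyperplane at height `c + s
    -- ⟨n, w⟩`, moved back by `s • w`; translations preserve surface measure.
    have hI : Isometry (fun x : Eu d => x + s • w) := isometry_add_right _
    rw [surf, ← hI.euclideanHausdorffMeasure_image]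
    congr 1
    ext x
    simp only [hyp, mem_image, mem_inter_iff, mem_preimage, mem_ofPred_eq]
    constructor
    · rintro ⟨y, ⟨h1, h2⟩, rfl⟩
      exact ⟨h1, by rw [inner_add_right, h2, inner_smul_right]⟩
    · rintro ⟨h1, h2⟩
      exact ⟨x - s • w, ⟨by simpa using h1, by rw [inner_sub_right, h2, inner_smul_right]; ring⟩,
        by simp⟩
  simp_rw [h1]
  set a : ℝ := inner ℝ n w
  let G : ℝ → ℝ≥0∞ := fun r => surf d (A ∩ hyp n r)
  -- Rescaling the height by `a` produces `|a|⁻¹`, which cancels the factor `|⟨n, w⟩|` of the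
  -- statement.
  have h2 : ∫⁻ s : ℝ, G (c + s * a) = ENNReal.ofReal |a⁻¹| * ∫⁻ r : ℝ, G r := by
    have e1 : ∫⁻ s : ℝ, G (c + s * a) = ∫⁻ r, G (c + r) ∂(Measure.map (fun x => x * a) volume) := by
      exact (((Homeomorph.mulRight₀ a hw).measurableEmbedding).lintegral_map
        (fun r => G (c + r))).symm
    rw [e1, Real.map_volume_mul_right hw, lintegral_smul_measure, smul_eq_mul,
      lintegral_add_left_eq_self]
  change _ * ∫⁻ s : ℝ, G (c + s * a) = _
  rw [h2, ← mul_assoc, ← ENNReal.ofReal_mul (abs_nonneg _), ← abs_mul, mul_inv_cancel₀ hw]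
  simp [G]

end PDWG

/-! ### Local geometry of cells at their faces -/

namespace PDWG

/-- `T` and the exterior of `T` are disjoint open sets that cover the complement of the frontier, so
a connected set avoiding the frontier lies in one of them. It is applied to half balls at a face and
to segments of translation. -/
lemma subset_or_subset_of_disjoint_frontier {X : Type*} [TopologicalSpace X] {S T : Set X}
    (hT : IsOpen T) (hS : IsPreconnected S) (h : Disjoint S (frontier T)) :
    S ⊆ T ∨ S ⊆ (closure T)ᶜ := by
  refine hS.subset_or_subset hT isClosed_closure.isOpen_compl
    (disjoint_compl_right.mono_left subset_closure) fun x hx => ?_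
  by_contra hx'
  simp only [mem_union, mem_compl_iff, not_or, not_not] at hx'
  exact disjoint_left.1 h hx ⟨hx'.2, by rw [hT.interior_eq]; exact hx'.1⟩

variable {d : ℕ}

lemma exists_smul_eq_of_perp {n m : Eu d} (h : ∀ v, inner ℝ n v = 0 → inner ℝ m v = 0) :
    ∃ r : ℝ, m = r • n := by
  have : m ∈ (ℝ ∙ n)ᗮᗮ := by
    rw [Submodule.mem_orthogonal]
    intro v hv
    rw [real_inner_comm]
    exact h v (Submodule.mem_orthogonal_singleton_iff_inner_right.1 hv)
  rw [Submodule.orthogonal_orthogonal] at this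
  obtain ⟨r, hr⟩ := Submodule.mem_span_singleton.1 this
  exact ⟨r, hr.symm⟩

/-- A nonempty relatively open subset of a hyperplane determines it. -/
lemma hyp_eq_of_open_subset {n m : Eu d} {c c' : ℝ} (hm : m ≠ 0) {U : Set (Eu d)} (hU : IsOpen U)
    (hne : (U ∩ hyp n c).Nonempty) (h : U ∩ hyp n c ⊆ hyp m c') : hyp m c' = hyp n c := by
  obtain ⟨x, hxU, hx⟩ := hne
  have hx' : inner ℝ m x = c' := h ⟨hxU, hx⟩
  have hx : inner ℝ n x = c := hx
  obtain ⟨r, hr⟩ : ∃ r : ℝ, m = r • n := by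
    apply exists_smul_eq_of_perp
    intro v hv
    -- Relative openness leaves room to move a little from `x` in every direction `v` of the
    -- hyperplane, so `m` is orthogonal to all of them.
    have : ∀ᶠ t : ℝ in 𝓝 0, x + t • v ∈ U := by
      have hc : Continuous fun t : ℝ => x + t • v := by fun_prop
      exact hc.continuousAt.eventually_mem (hU.mem_nhds (by simpa using hxU))
    obtain ⟨t, ht, ht0⟩ :=
      ((this.filter_mono nhdsWithin_le_nhds).and (self_mem_nhdsWithin (s := {(0 : ℝ)}ᶜ))).exists
    have h2 : inner ℝ m (x + t • v) = c' :=
      h ⟨ht, by simp [hyp, inner_add_right, inner_smul_right, hv, hx]⟩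
    rw [inner_add_right, hx', inner_smul_right] at h2
    have : t * inner ℝ m v = 0 := by linarith
    exact (mul_eq_zero.1 this).resolve_left ht0
  have hr0 : r ≠ 0 := by rintro rfl; exact hm (by simpa using hr)
  have : c' = r * c := by rw [← hx', hr, inner_smul_left, hx]; simp
  rw [this, hr, hyp_smul hr0]

namespace PolyMesh

variable {Ω : Set (Eu d)} (M : PolyMesh Ω) {T : M.Cell} {e : M.Face}

lemma face_nonempty (e : M.Face) : (M.face e).Nonempty := (M.face_connected e).nonempty

lemma exists_face_eq (e : M.Face) : ∃ (n : Eu d) (c : ℝ) (U : Set (Eu d)), ‖n‖ = 1 ∧ IsOpen U ∧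
    M.face e = U ∩ hyp n c := by
  obtain ⟨m, c, U, hm, hU, he⟩ := M.face_flat e
  obtain ⟨n, c', hn, h⟩ := exists_unit_hyp hm c
  exact ⟨n, c', U, hn, hU, by rw [← h]; exact he⟩

lemma normal_ne_zero (h : M.Inc T e) : M.normal T e ≠ 0 := by
  intro h0; have := M.normal_norm T e h; simp [h0] at this

lemma face_eq (h : M.Inc T e) : ∃ (c : ℝ) (U : Set (Eu d)), IsOpen U ∧
    M.face e = U ∩ hyp (M.normal T e) c := by
  obtain ⟨n, c, U, hn, hU, he⟩ := M.exists_face_eq e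
  obtain ⟨c', hc'⟩ := M.normal_perp T e h
  refine ⟨c', U, hU, ?_⟩
  rw [he] at hc'
  rw [he, ← hyp_eq_of_open_subset (M.normal_ne_zero h) hU (he ▸ M.face_nonempty e) hc']

lemma measurableSet_face (e : M.Face) : MeasurableSet (M.face e) := by
  obtain ⟨n, c, U, -, hU, he⟩ := M.exists_face_eq e
  rw [he]; exact hU.measurableSet.inter (isClosed_hyp n c).measurableSet

lemma isBounded_face (e : M.Face) : Bornology.IsBounded (M.face e) := by
  obtain ⟨T, hT⟩ := M.face_mem e
  exact ((M.cell_polyhedral T).isBounded.closure.subset frontier_subset_closure).subset hT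

lemma surf_face_lt_top (e : M.Face) : surf d (M.face e) < ⊤ := by
  obtain ⟨n, c, U, hn, hU, he⟩ := M.exists_face_eq e
  have h := surf_inter_hyp_lt_top (c := c) hn (M.isBounded_face e)
  rwa [inter_eq_self_of_subset_left] at h
  rw [he]; exact inter_subset_right

instance (e : M.Face) : IsFiniteMeasure ((surf d).restrict (M.face e)) :=
  ⟨by rw [Measure.restrict_apply_univ]; exact M.surf_face_lt_top e⟩

lemma surf_inter_face_pos (e : M.Face) {V : Set (Eu d)} (hV : IsOpen V)
    (hne : (V ∩ M.face e).Nonempty) : 0 < surf d (V ∩ M.face e) := by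
  obtain ⟨n, c, U, hn, hU, he⟩ := M.exists_face_eq e
  rw [he, ← inter_assoc] at hne ⊢
  exact surf_inter_hyp_pos hn (hV.inter hU) hne

lemma measurableSet_cell (T : M.Cell) : MeasurableSet (M.cell T) :=
  (M.cell_polyhedral T).isOpen.measurableSet

/-- At almost every point of a face, the cell coincides with a half space near the point, and no
other face is near the point. -/
lemma ae_face_local (h : M.Inc T e) : ∀ᵐ y ∂(surf d).restrict (M.face e), ∃ δ > 0,
    ∀ z ∈ Metric.ball y δ, (inner ℝ (M.normal T e) (z - y) < 0 → z ∈ M.cell T) ∧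
      (0 < inner ℝ (M.normal T e) (z - y) → z ∉ closure (M.cell T)) ∧
      ∀ e', e' ≠ e → z ∉ M.face e' := by
  classical
  set n := M.normal T e with hn
  have hn1 : ‖n‖ = 1 := M.normal_norm T e h
  obtain ⟨c, U, hU, he⟩ := M.face_eq h
  have heH : M.face e ⊆ hyp n c := he ▸ inter_subset_right
  obtain ⟨H, hH0, hH⟩ := (M.cell_polyhedral T).frontier_subset
  -- A hyperplane that does not contain the one of the face meets it in a null set, so almost every
  -- point of the face avoids the finitely many foreign hyperplanes.
  have null : ∀ m c', ¬ hyp n c ⊆ hyp m c' →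
      ∀ᵐ y ∂(surf d).restrict (M.face e), y ∉ hyp m c' := by
    intro m c' hnot
    rw [ae_restrict_iff' (M.measurableSet_face e), ae_iff]
    refine measure_mono_null (fun y hy => ?_) (surf_hyp_inter_hyp hn1 hnot)
    simp only [mem_ofPred_eq, Classical.not_imp, not_not] at hy
    exact ⟨hy.2, heH hy.1⟩
  have h1 : ∀ᵐ y ∂(surf d).restrict (M.face e), ∀ p ∈ H, ¬ hyp n c ⊆ hyp p.1 p.2 →
      y ∉ hyp p.1 p.2 := by
    refine (Filter.eventually_all_finset H).2 ?_
    intro p hp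
    by_cases hnot : hyp n c ⊆ hyp p.1 p.2
    · exact Eventually.of_forall fun y h => absurd hnot h
    · exact (null _ _ hnot).mono fun y hy _ => hy
  have h2 : ∀ᵐ y ∂(surf d).restrict (M.face e), ∀ e', e' ≠ e → y ∉ closure (M.face e') := by
    rw [ae_all_iff]
    intro e'
    obtain ⟨n', c', U', hn', hU', he'⟩ := M.exists_face_eq e'
    have hsub : closure (M.face e') ⊆ hyp n' c' :=
      closure_minimal (he' ▸ inter_subset_right) (isClosed_hyp _ _)
    by_cases hnot : hyp n c ⊆ hyp n' c'
    -- A face in the same hyperplane cannot accumulate at `y`: there `e` is relatively open, and the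
    -- two faces are disjoint.
    · have heq : hyp n' c' = hyp n c := by
        have hn0' : n' ≠ 0 := by rintro rfl; simp at hn'
        refine hyp_eq_of_open_subset hn0' isOpen_univ ?_ (by simpa using hnot)
        obtain ⟨x, hx⟩ := M.face_nonempty e
        exact ⟨x, trivial, heH hx⟩
      filter_upwards [ae_restrict_mem (M.measurableSet_face e)] with y hy hne hcl
      rw [he] at hy
      obtain ⟨z, hzU, hz⟩ := mem_closure_iff.1 hcl U hU hy.1
      refine disjoint_left.1 (M.face_disjoint e' e hne) hz ?_
      rw [he]
      exact ⟨hzU, heq ▸ hsub (subset_closure hz)⟩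
    · exact (null _ _ hnot).mono fun y hy _ hcl => hy (hsub hcl)
  filter_upwards [h1, h2, ae_restrict_mem (M.measurableSet_face e)] with y hy1 hy2 hye
  have hyc : inner ℝ n y = c := heH hye
  have e1 : ∀ᶠ z in 𝓝 y, z ∈ frontier (M.cell T) → inner ℝ n (z - y) = 0 := by
    have : ∀ᶠ z in 𝓝 y, ∀ p ∈ H, ¬ hyp n c ⊆ hyp p.1 p.2 → z ∉ hyp p.1 p.2 := by
      rw [Filter.eventually_all_finset]
      intro p hp
      by_cases hnot : hyp n c ⊆ hyp p.1 p.2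
      · exact Eventually.of_forall fun y h => absurd hnot h
      · exact ((isClosed_hyp p.1 p.2).isOpen_compl.eventually_mem (hy1 p hp hnot)).mono
          fun z hz _ => hz
    filter_upwards [this] with z hz hzf
    obtain ⟨p, hp, hzp⟩ := mem_iUnion₂.1 (hH hzf)
    have hsub : hyp n c ⊆ hyp p.1 p.2 := by
      by_contra hnot
      exact hz p hp hnot hzp
    have heq : hyp p.1 p.2 = hyp n c :=
      hyp_eq_of_open_subset (hH0 p hp) isOpen_univ ⟨y, trivial, hyc⟩ (by simpa using hsub)
    have : z ∈ hyp n c := heq ▸ hzp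
    have : inner ℝ n z = c := this
    rw [inner_sub_right, this, hyc, sub_self]
  have e2 : ∀ᶠ z in 𝓝 y, ∀ e', e' ≠ e → z ∉ M.face e' := by
    rw [Filter.eventually_all]
    intro e'
    by_cases hne : e' = e
    · exact Eventually.of_forall fun _ h => absurd hne h
    · exact (isClosed_closure.isOpen_compl.eventually_mem (hy2 e' hne)).mono
        fun z hz _ hz' => hz (subset_closure hz')
  obtain ⟨δ, hδ, hball⟩ := Metric.eventually_nhds_iff_ball.1 (e1.and e2)
  -- Near `y` the frontier lies in the hyperplane of the face, so each open half ball is convex and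
  -- misses it, and is entirely inside the cell or entirely outside its closure. One point `y ∓ t n`
  -- in each half, supplied by the outward normal, decides which.
  have hout := M.normal_outward T e h y hye
  have hsmall : ∀ᶠ t : ℝ in 𝓝[>] 0, 0 < t ∧ t < δ :=
    Ioo_mem_nhdsGT hδ
  obtain ⟨t, ⟨hin, hout⟩, ht0, htδ⟩ := (hout.and hsmall).exists
  rw [← hn] at hin hout
  have hO := (M.cell_polyhedral T).isOpen
  have conv : ∀ s : Set ℝ, Convex ℝ s →
      Convex ℝ (Metric.ball y δ ∩ {z | inner ℝ n (z - y) ∈ s}) := by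
    intro s hs
    refine (convex_ball y δ).inter ?_
    have : {z : Eu d | inner ℝ n (z - y) ∈ s} =
        ((innerSL ℝ n).toLinearMap) ⁻¹' ((fun r => r + inner ℝ n y) '' s) := by
      ext z
      simp [sub_eq_add_neg, inner_add_right, inner_neg_right]
    rw [this]
    refine Convex.linear_preimage ?_ _
    simpa [add_comm] using hs.translate (inner ℝ n y)
  have disj : ∀ s : Set ℝ, (0 : ℝ) ∉ s →
      Disjoint (Metric.ball y δ ∩ {z | inner ℝ n (z - y) ∈ s}) (frontier (M.cell T)) := by
    intro s hs
    rw [disjoint_left]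
    rintro z ⟨hz, hzs⟩ hzf
    have := (hball z hz).1 hzf
    simp only [mem_ofPred_eq, this] at hzs
    exact hs hzs
  refine ⟨δ, hδ, fun z hz => ⟨fun hlt => ?_, fun hgt => ?_, (hball z hz).2⟩⟩
  · rcases subset_or_subset_of_disjoint_frontier hO (conv (Iio 0) (convex_Iio 0)).isPreconnected
      (disj (Iio 0) (by simp)) with hs | hs
    · exact hs ⟨hz, hlt⟩
    · refine absurd (subset_closure hin) (hs ⟨?_, ?_⟩)
      · simp [Metric.mem_ball, norm_smul, hn1, abs_of_pos ht0, htδ]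
      · simp [inner_smul_right, ht0, hn1]
  · rcases subset_or_subset_of_disjoint_frontier hO (conv (Ioi 0) (convex_Ioi 0)).isPreconnected
      (disj (Ioi 0) (by simp)) with hs | hs
    · refine absurd (subset_closure (hs ⟨?_, ?_⟩)) hout
      · simp [Metric.mem_ball, norm_smul, hn1, abs_of_pos ht0, htδ]
      · simp [inner_smul_right, ht0, hn1]
    · exact hs ⟨hz, hgt⟩

end PolyMesh
end PDWG

/-! ### Gauss' theorem on a cell, by translation -/

namespace PDWG

variable {d : ℕ}

lemma integrableOn_of_isBounded {E F : Type*} [MetricSpace E] [ProperSpace E]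
    [MeasurableSpace E] [OpensMeasurableSpace E] [NormedAddCommGroup F] {μ : Measure E}
    [IsFiniteMeasureOnCompacts μ]
    {f : E → F} (hf : Continuous f) {S : Set E} (hS : Bornology.IsBounded S) :
    IntegrableOn f S μ :=
  (hf.continuousOn.integrableOn_compact hS.isCompact_closure).mono_set subset_closure

/-- Points that are passed when `S` is translated by `w`. -/
def sweep (S : Set (Eu d)) (w : Eu d) : Set (Eu d) := {x | ∃ s ∈ Icc (0 : ℝ) 1, x - s • w ∈ S}

/-- Because `w` is transversal, the time `s` at which the moving `S` passes `x` is determined by the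
height of `x` over the hyperplane. This gives measurability and the coordinates `(y, s)` on the
swept set. -/
lemma sweep_eq {S : Set (Eu d)} {n w : Eu d} {c : ℝ} (hS : S ⊆ hyp n c) (hw : inner ℝ n w ≠ 0) :
    sweep S w = {x | (inner ℝ n x - c) / inner ℝ n w ∈ Icc (0 : ℝ) 1} ∩
      (fun x => x - ((inner ℝ n x - c) / inner ℝ n w) • w) ⁻¹' S := by
  ext x
  constructor
  · rintro ⟨s, hs, hx⟩
    have h : inner ℝ n (x - s • w) = c := hS hx
    rw [inner_sub_right, inner_smul_right] at h
    have : (inner ℝ n x - c) / inner ℝ n w = s := by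
      rw [div_eq_iff hw]; linarith
    simp only [mem_inter_iff, mem_ofPred_eq, mem_preimage, this]
    exact ⟨hs, hx⟩
  · rintro ⟨h1, h2⟩
    exact ⟨_, h1, h2⟩

lemma measurableSet_sweep {S : Set (Eu d)} {n w : Eu d} {c : ℝ} (hS : S ⊆ hyp n c)
    (hw : inner ℝ n w ≠ 0) (hm : MeasurableSet S) : MeasurableSet (sweep S w) := by
  rw [sweep_eq hS hw]
  have h1 : Measurable fun x : Eu d => (inner ℝ n x - c) / inner ℝ n w := by fun_prop
  have h2 : Measurable fun x : Eu d => x - ((inner ℝ n x - c) / inner ℝ n w) • w := by fun_prop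
  exact (h1 measurableSet_Icc).inter (h2 hm)

lemma mem_sweep_iff {S : Set (Eu d)} {n w : Eu d} {c : ℝ} (hS : S ⊆ hyp n c)
    (hw : inner ℝ n w ≠ 0) {y : Eu d} (hy : y ∈ hyp n c) (s : ℝ) :
    y + s • w ∈ sweep S w ↔ y ∈ S ∧ s ∈ Icc (0 : ℝ) 1 := by
  have hy' : inner ℝ n y = c := hy
  have : (inner ℝ n (y + s • w) - c) / inner ℝ n w = s := by
    rw [inner_add_right, inner_smul_right, hy', add_sub_cancel_left, mul_div_cancel_right₀ _ hw]
  rw [sweep_eq hS hw]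
  simp only [mem_inter_iff, mem_ofPred_eq, mem_preimage, this, add_sub_cancel_right]
  exact and_comm

/-- In the coordinates `(y, s)` the swept set lies over the null set `S`. -/
lemma volume_sweep {S : Set (Eu d)} {n w : Eu d} {c : ℝ} (hn : ‖n‖ = 1) (hS : S ⊆ hyp n c)
    (hw : inner ℝ n w ≠ 0) (hm : MeasurableSet S) (h0 : surf d S = 0) :
    volume (sweep S w) = 0 := by
  have := sFinite_surf_hyp (d := d) hn c
  have hmeas : Measurable (fun p : Eu d × ℝ => p.1 + p.2 • w) := by fun_prop
  rw [← map_prod_surf_hyp hn c w hw, Measure.smul_apply,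
    Measure.map_apply hmeas (measurableSet_sweep hS hw hm)]
  have : ((surf d).restrict (hyp n c)).prod volume
      ((fun p : Eu d × ℝ => p.1 + p.2 • w) ⁻¹' sweep S w) = 0 := by
    have h1 : ∀ᵐ y ∂(surf d).restrict (hyp n c), y ∈ hyp n c ∧ y ∉ S :=
      (ae_restrict_mem (isClosed_hyp n c).measurableSet).and
        (ae_restrict_of_ae (measure_eq_zero_iff_ae_notMem.1 h0))
    have h2 : ∀ᵐ p ∂((surf d).restrict (hyp n c)).prod (volume : Measure ℝ),
        p.1 ∈ hyp n c ∧ p.1 ∉ S := Measure.quasiMeasurePreserving_fst.ae h1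
    rw [measure_eq_zero_iff_ae_notMem]
    filter_upwards [h2] with p hp hp'
    exact hp.2 ((mem_sweep_iff hS hw hp.1 p.2).1 hp').1
  rw [this, smul_zero]

/-- Change of variables `x = y + s • w` with Jacobian `|⟨n, w⟩|`, by `map_prod_surf_hyp`; the swept
set corresponds to `S × [0, 1]`. -/
lemma integral_sweep {S : Set (Eu d)} {n w : Eu d} {c : ℝ} (hn : ‖n‖ = 1) (hS : S ⊆ hyp n c)
    (hw : inner ℝ n w ≠ 0) (hm : MeasurableSet S) {K : Eu d → ℝ} (hK : Measurable K) :
    ∫ x in sweep S w, K x = |inner ℝ n w| *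
      ∫ p, K (p.1 + p.2 • w) ∂((surf d).restrict S).prod (volume.restrict (Icc (0 : ℝ) 1)) := by
  have := sFinite_surf_hyp (d := d) hn c
  have hmeas : Measurable (fun p : Eu d × ℝ => p.1 + p.2 • w) := by fun_prop
  have hsw := measurableSet_sweep hS hw hm
  have hSr : (surf d).restrict S = ((surf d).restrict (hyp n c)).restrict S := by
    rw [Measure.restrict_restrict hm, inter_eq_self_of_subset_left hS]
  conv_lhs => rw [← integral_indicator hsw, ← map_prod_surf_hyp hn c w hw]
  rw [integral_smul_measure, ENNReal.toReal_ofReal (abs_nonneg _), smul_eq_mul,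
    integral_map hmeas.aemeasurable (hK.indicator hsw).aestronglyMeasurable,
    hSr, Measure.prod_restrict, ← integral_indicator (hm.prod measurableSet_Icc)]
  congr 1
  have h2 : ∀ᵐ p ∂((surf d).restrict (hyp n c)).prod (volume : Measure ℝ), p.1 ∈ hyp n c :=
    Measure.quasiMeasurePreserving_fst.ae (ae_restrict_mem (isClosed_hyp n c).measurableSet)
  refine integral_congr_ae (h2.mono fun p hp => ?_)
  have := mem_sweep_iff hS hw hp p.2
  by_cases hp' : p ∈ S ×ˢ Icc (0 : ℝ) 1
  · rw [indicator_of_mem hp']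
    exact indicator_of_mem (this.2 hp') K
  · rw [indicator_of_notMem hp']
    exact indicator_of_notMem (fun h => hp' (this.1 h)) K

/-- The segment from `x` to `x - w` is connected and has exactly one endpoint in `T`, so it meets
the frontier. -/
lemma exists_frontier_of_segment {T : Set (Eu d)} (hT : IsOpen T) {x w : Eu d}
    (h : ¬ (x ∈ T ↔ x - w ∈ T)) : x ∈ sweep (frontier T) w := by
  by_contra hx
  have hseg : Disjoint (segment ℝ x (x - w)) (frontier T) := by
    rw [disjoint_left]
    intro z hz hzf
    rw [segment_eq_image'] at hz
    obtain ⟨s, hs, rfl⟩ := hz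
    refine hx ⟨s, hs, ?_⟩
    convert hzf using 1
    module
  apply h
  rcases subset_or_subset_of_disjoint_frontier hT (convex_segment x (x - w)).isPreconnected hseg
    with hs | hs
  · exact ⟨fun _ => hs (right_mem_segment ℝ _ _), fun _ => hs (left_mem_segment ℝ _ _)⟩
  · exact ⟨fun h => absurd (subset_closure h) (hs (left_mem_segment ℝ _ _)),
      fun h => absurd (subset_closure h) (hs (right_mem_segment ℝ _ _))⟩

/-- Differentiation under the integral sign at `τ = 0`; the derivative is bounded on a ball that
contains all translates of `T` by `τ • ν` with `|τ| < 1`. -/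
lemma tendsto_translate_integral {T : Set (Eu d)} (hT : MeasurableSet T)
    (hb : Bornology.IsBounded T) {f : Eu d → ℝ} (hf : ContDiff ℝ 1 f) (ν : Eu d) :
    Tendsto (fun τ : ℝ => τ⁻¹ * ((∫ x in T, f (x + τ • ν)) - ∫ x in T, f x)) (𝓝[>] 0)
      (𝓝 (∫ x in T, fderiv ℝ f x ν)) := by
  have hdf : Continuous (fderiv ℝ f) := hf.continuous_fderiv one_ne_zero
  obtain ⟨R, hR⟩ := hb.subset_closedBall (0 : Eu d)
  obtain ⟨C, hC⟩ := (isCompact_closedBall (0 : Eu d) (R + ‖ν‖)).exists_bound_of_continuousOn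
    (hdf.clm_apply continuous_const (g := fun _ => ν)).continuousOn
  have key := (hasDerivAt_integral_of_dominated_loc_of_deriv_le (μ := volume.restrict T)
    (F := fun (τ : ℝ) x => f (x + τ • ν)) (F' := fun τ x => fderiv ℝ f (x + τ • ν) ν)
    (x₀ := (0 : ℝ)) (s := Metric.ball 0 1) (bound := fun _ => C) (Metric.ball_mem_nhds _ one_pos)
    (Eventually.of_forall fun τ => by
      have : Continuous fun x => f (x + τ • ν) := hf.continuous.comp (by fun_prop)
      exact this.aestronglyMeasurable)
    (by simpa using (integrableOn_of_isBounded hf.continuous hb).integrable)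
    (by
      have : Continuous fun x => fderiv ℝ f (x + (0 : ℝ) • ν) ν :=
        (hdf.comp (by fun_prop)).clm_apply continuous_const
      exact this.aestronglyMeasurable)
    (by
      filter_upwards [ae_restrict_mem hT] with x hx τ hτ
      apply hC
      have h1 : ‖x‖ ≤ R := by simpa using hR hx
      have h2 : ‖τ‖ < 1 := by simpa using hτ
      rw [mem_closedBall_zero_iff]
      calc ‖x + τ • ν‖ ≤ ‖x‖ + ‖τ • ν‖ := norm_add_le _ _
        _ ≤ R + ‖ν‖ := by
          rw [norm_smul]
          nlinarith [norm_nonneg ν, norm_nonneg τ])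
    (by
      have : IsFiniteMeasure (volume.restrict T) :=
        ⟨by rw [Measure.restrict_apply_univ]; exact hb.measure_lt_top⟩
      exact integrable_const C)
    (by
      refine Eventually.of_forall fun x τ _ => ?_
      have h1 : HasDerivAt (fun τ : ℝ => x + τ • ν) ν τ := by
        simpa using ((hasDerivAt_id τ).smul_const ν).const_add x
      exact ((hf.differentiable one_ne_zero _).hasFDerivAt).comp_hasDerivAt τ h1)).2
  have h2 := key.tendsto_slope_zero_right
  simpa using h2

namespace PolyMesh

variable {Ω : Set (Eu d)} (M : PolyMesh Ω) {T : M.Cell} {e : M.Face}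

open Classical in
/-- The number of faces of `T`, transversal to `w`, that sweep over `x`. -/
noncomputable def sweepCount (T : M.Cell) (w x : Eu d) : ℝ :=
  ∑ e, if M.Inc T e ∧ inner ℝ (M.normal T e) w ≠ 0 then (sweep (M.face e) w).indicator 1 x else 0

/-- The count is a natural number, so dividing by it never increases an absolute value; division by
zero gives zero. -/
lemma sweepCount_zero_or_one_le (T : M.Cell) (w x : Eu d) :
    M.sweepCount T w x = 0 ∨ 1 ≤ M.sweepCount T w x := by
  classical
  have : ∃ k : ℕ, M.sweepCount T w x = k := by
    refine ⟨∑ e, if M.Inc T e ∧ inner ℝ (M.normal T e) w ≠ 0 then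
      (sweep (M.face e) w).indicator 1 x else 0, ?_⟩
    rw [sweepCount, Nat.cast_sum]
    refine Finset.sum_congr rfl fun e _ => ?_
    by_cases hx : x ∈ sweep (M.face e) w <;> simp [hx]
  obtain ⟨k, hk⟩ := this
  rw [hk]
  rcases Nat.eq_zero_or_pos k with h | h
  · left; simp [h]
  · right; exact_mod_cast h

lemma measurable_sweepCount (T : M.Cell) (w : Eu d) : Measurable (M.sweepCount T w) := by
  classical
  unfold sweepCount
  refine Finset.measurable_fun_sum _ fun e _ => ?_
  by_cases h : M.Inc T e ∧ inner ℝ (M.normal T e) w ≠ 0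
  · simp only [if_pos h]
    obtain ⟨c, U, hU, he⟩ := M.face_eq h.1
    exact measurable_one.indicator
      (measurableSet_sweep (he ▸ inter_subset_right) h.2 (M.measurableSet_face e))
  · simp only [if_neg h]; exact measurable_const

/-- `1_{T+w} - 1_T` -/
noncomputable def shiftDiff (T : M.Cell) (w x : Eu d) : ℝ :=
  (M.cell T).indicator 1 (x - w) - (M.cell T).indicator 1 x

lemma measurable_shiftDiff (T : M.Cell) (w : Eu d) : Measurable (M.shiftDiff T w) := by
  unfold shiftDiff
  have h : Measurable ((M.cell T).indicator (1 : Eu d → ℝ)) :=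
    measurable_one.indicator (M.measurableSet_cell T)
  exact (h.comp (measurable_id.sub_const w)).sub h

lemma abs_shiftDiff_le (T : M.Cell) (w x : Eu d) : |M.shiftDiff T w x| ≤ 1 := by
  unfold shiftDiff
  by_cases h1 : x - w ∈ M.cell T <;> by_cases h2 : x ∈ M.cell T <;> simp [h1, h2]

/-- A point whose membership changes under the translation is crossed by the frontier. Up to null
sets it is crossed by a transversal face: the part of the frontier outside the faces has surface
measure zero and sweeps a null set, and a face parallel to `w` sweeps inside its own hyperplane. -/
lemma ae_sweepCount_ne_zero (T : M.Cell) (w : Eu d) :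
    ∀ᵐ x, M.shiftDiff T w x ≠ 0 → M.sweepCount T w x ≠ 0 := by
  classical
  obtain ⟨H, hH0, hH⟩ := (M.cell_polyhedral T).frontier_subset
  set N := frontier (M.cell T) \ ⋃ e, M.face e with hN
  have hNm : MeasurableSet N :=
    isClosed_frontier.measurableSet.diff (MeasurableSet.iUnion fun e => M.measurableSet_face e)
  have h1 : ∀ᵐ x, ∀ p ∈ H, x ∉ sweep (N ∩ hyp p.1 p.2) w := by
    refine (Filter.eventually_all_finset H).2 fun p hp => ?_
    rw [← measure_eq_zero_iff_ae_notMem]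
    obtain ⟨n, c, hn, hnc⟩ := exists_unit_hyp (hH0 p hp) p.2
    have hn0 : n ≠ 0 := by rintro rfl; simp at hn
    rw [hnc]
    by_cases hw : inner ℝ n w = 0
    · refine measure_mono_null ?_ (volume_hyp hn0 c)
      rintro x ⟨s, -, hx⟩
      have : inner ℝ n (x - s • w) = c := hx.2
      rw [inner_sub_right, inner_smul_right, hw] at this
      simpa [hyp] using this
    · exact volume_sweep hn inter_subset_right hw (hNm.inter (isClosed_hyp n c).measurableSet)
        (measure_mono_null inter_subset_left (M.frontier_cover T))
  have h2 : ∀ᵐ x, ∀ e, M.Inc T e → inner ℝ (M.normal T e) w = 0 → x ∉ sweep (M.face e) w := by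
    rw [ae_all_iff]
    intro e
    by_cases h : M.Inc T e ∧ inner ℝ (M.normal T e) w = 0
    · obtain ⟨c, hc⟩ := M.normal_perp T e h.1
      have : ∀ᵐ x, x ∉ sweep (M.face e) w := by
        rw [← measure_eq_zero_iff_ae_notMem]
        refine measure_mono_null ?_ (volume_hyp (M.normal_ne_zero h.1) c)
        rintro x ⟨s, -, hx⟩
        have : inner ℝ (M.normal T e) (x - s • w) = c := hc hx
        rw [inner_sub_right, inner_smul_right, h.2] at this
        simpa [hyp] using this
      exact this.mono fun x hx _ _ => hx
    · exact Eventually.of_forall fun x h3 h4 => absurd ⟨h3, h4⟩ h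
  filter_upwards [h1, h2] with x hx1 hx2 hD hc
  have hnot : ¬ (x ∈ M.cell T ↔ x - w ∈ M.cell T) := by
    intro hiff
    apply hD
    unfold shiftDiff
    by_cases h : x ∈ M.cell T
    · simp [h, hiff.1 h]
    · simp [h, mt hiff.2 h]
  obtain ⟨s, hs, hxs⟩ := exists_frontier_of_segment (M.cell_polyhedral T).isOpen hnot
  by_cases hface : ∃ e, x - s • w ∈ M.face e
  · obtain ⟨e, he⟩ := hface
    have hinc : M.Inc T e := (M.face_cell T e).resolve_right
      fun hd => disjoint_left.1 hd he hxs
    have hsw : x ∈ sweep (M.face e) w := ⟨s, hs, he⟩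
    have htr : inner ℝ (M.normal T e) w ≠ 0 := fun h0 => hx2 e hinc h0 hsw
    rw [sweepCount, Finset.sum_eq_zero_iff_of_nonneg] at hc
    · have := hc e (Finset.mem_univ e)
      simp [hinc, htr, hsw] at this
    · intro e' _
      split_ifs
      · exact indicator_nonneg (fun _ _ => zero_le_one) _
      · exact le_rfl
  · obtain ⟨p, hp, hxp⟩ := mem_iUnion₂.1 (hH hxs)
    refine hx1 p hp ⟨s, hs, ⟨hxs, ?_⟩, hxp⟩
    rwa [mem_iUnion]

/-- Dominated convergence. For almost every `(y, s)` and small `τ`, the point `y + s τ ν` is passed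
by the face `e` only, and it lies across `e` from `y + (s - 1) τ ν`; so the count is `1` and
`shiftDiff` is the sign of `⟨n, ν⟩`. -/
lemma tendsto_sweep_integral (h : M.Inc T e) {f : Eu d → ℝ} (hf : Continuous f) (ν : Eu d)
    (hν : inner ℝ (M.normal T e) ν ≠ 0) :
    Tendsto (fun τ : ℝ => ∫ p, (fun x => f x * M.shiftDiff T (τ • ν) x / M.sweepCount T (τ • ν) x)
        (p.1 + p.2 • (τ • ν)) ∂((surf d).restrict (M.face e)).prod
          (volume.restrict (Icc (0 : ℝ) 1))) (𝓝[>] 0)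
      (𝓝 (SignType.sign (inner ℝ (M.normal T e) ν) * ∫ x in M.face e, f x ∂(surf d))) := by
  classical
  set n := M.normal T e with hn
  set σ : ℝ := ((SignType.sign (inner ℝ n ν) : SignType) : ℝ) with hσ
  obtain ⟨c, U, hU, he⟩ := M.face_eq h
  have hlim : σ * ∫ x in M.face e, f x ∂(surf d) = ∫ p : Eu d × ℝ, f p.1 * σ
      ∂((surf d).restrict (M.face e)).prod (volume.restrict (Icc (0 : ℝ) 1)) := by
    rw [integral_prod_mul f (fun _ : ℝ => σ)]
    simp [mul_comm]
  rw [hlim]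
  obtain ⟨R, hR⟩ := (M.isBounded_face e).subset_closedBall (0 : Eu d)
  obtain ⟨C, hC⟩ := (isCompact_closedBall (0 : Eu d) (R + ‖ν‖)).exists_bound_of_continuousOn
    hf.continuousOn
  have hpos : ∀ᶠ τ : ℝ in 𝓝[>] 0, 0 < τ := self_mem_nhdsWithin
  have hle : ∀ᶠ τ : ℝ in 𝓝[>] 0, τ < 1 := nhdsWithin_le_nhds (Iio_mem_nhds one_pos)
  refine tendsto_integral_filter_of_dominated_convergence (fun _ => C) ?_ ?_
    (integrable_const C) ?_
  · refine Eventually.of_forall fun τ => Measurable.aestronglyMeasurable ?_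
    have : Measurable fun x => f x * M.shiftDiff T (τ • ν) x / M.sweepCount T (τ • ν) x :=
      (hf.measurable.mul (M.measurable_shiftDiff T _)).div (M.measurable_sweepCount T _)
    exact this.comp (by fun_prop)
  · filter_upwards [hpos, hle] with τ hτ0 hτ1
    have h1 : ∀ᵐ p ∂((surf d).restrict (M.face e)).prod (volume.restrict (Icc (0 : ℝ) 1)),
        p.1 ∈ M.face e ∧ p.2 ∈ Icc (0 : ℝ) 1 :=
      (Measure.quasiMeasurePreserving_fst.ae (ae_restrict_mem (M.measurableSet_face e))).and
        (Measure.quasiMeasurePreserving_snd.ae (ae_restrict_mem measurableSet_Icc))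
    filter_upwards [h1] with p hp
    have hx : ‖f (p.1 + p.2 • τ • ν)‖ ≤ C := by
      apply hC
      have h1 : ‖p.1‖ ≤ R := by simpa using hR hp.1
      rw [mem_closedBall_zero_iff]
      refine (norm_add_le _ _).trans ?_
      rw [norm_smul, norm_smul, Real.norm_of_nonneg hp.2.1, Real.norm_of_nonneg hτ0.le]
      have : τ * ‖ν‖ ≤ ‖ν‖ := mul_le_of_le_one_left (norm_nonneg _) hτ1.le
      have : p.2 * (τ * ‖ν‖) ≤ τ * ‖ν‖ := mul_le_of_le_one_left (by positivity) hp.2.2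
      linarith
    have hD := M.abs_shiftDiff_le T (τ • ν) (p.1 + p.2 • τ • ν)
    have hfd : |f (p.1 + p.2 • τ • ν) * M.shiftDiff T (τ • ν) (p.1 + p.2 • τ • ν)| ≤ C := by
      rw [abs_mul]
      calc _ ≤ C * 1 := mul_le_mul hx hD (abs_nonneg _) ((norm_nonneg _).trans hx)
        _ = C := mul_one C
    rw [Real.norm_eq_abs, abs_div]
    rcases M.sweepCount_zero_or_one_le T (τ • ν) (p.1 + p.2 • τ • ν) with h0 | h1
    · rw [h0]; simp only [abs_zero, div_zero]; exact (norm_nonneg _).trans hx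
    · exact (div_le_self (abs_nonneg _) (h1.trans (le_abs_self _))).trans hfd
  -- The endpoints of `[0, 1]` are discarded so that the two points lie strictly on opposite sides
  -- of the face.
  · have hr : (volume : Measure ℝ).restrict (Icc 0 1) = volume.restrict (Ioo 0 1) :=
      Measure.restrict_congr_set Ioo_ae_eq_Icc.symm
    have h1 : ∀ᵐ p ∂((surf d).restrict (M.face e)).prod (volume.restrict (Icc (0 : ℝ) 1)),
        p.2 ∈ Ioo (0 : ℝ) 1 := by
      rw [hr]
      exact Measure.quasiMeasurePreserving_snd.ae (ae_restrict_mem measurableSet_Ioo)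
    have h2 := Measure.quasiMeasurePreserving_fst (ν := volume.restrict (Icc (0 : ℝ) 1)) |>.ae
      (M.ae_face_local h)
    have h3 := Measure.quasiMeasurePreserving_fst (ν := volume.restrict (Icc (0 : ℝ) 1)) |>.ae
      (ae_restrict_mem (μ := surf d) (M.measurableSet_face e))
    filter_upwards [h1, h2, h3] with p hp2 hp1 hpe
    obtain ⟨y, s⟩ := p
    simp only at hp2 hp1 hpe ⊢
    obtain ⟨δ, hδ, hloc⟩ := hp1
    have hc : Tendsto (fun τ : ℝ => f (y + s • τ • ν) * σ) (𝓝[>] 0) (𝓝 (f y * σ)) := by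
      have : Continuous fun τ : ℝ => f (y + s • τ • ν) * σ := by fun_prop
      have := (this.tendsto 0).mono_left (nhdsWithin_le_nhds (s := Ioi 0))
      simpa using this
    refine hc.congr' ?_
    have hsm : ∀ᶠ τ : ℝ in 𝓝[>] 0, τ * ‖ν‖ < δ := by
      have : Continuous fun τ : ℝ => τ * ‖ν‖ := by fun_prop
      exact ((this.tendsto 0).mono_left nhdsWithin_le_nhds).eventually_lt_const (by simpa using hδ)
    filter_upwards [hpos, hsm] with τ hτ hτδ
    have hball : ∀ r : ℝ, |r| ≤ 1 → y + r • τ • ν ∈ Metric.ball y δ := by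
      intro r hr
      rw [Metric.mem_ball, dist_eq_norm, add_sub_cancel_left, norm_smul, norm_smul,
        Real.norm_eq_abs, Real.norm_of_nonneg hτ.le]
      exact (mul_le_of_le_one_left (by positivity) hr).trans_lt hτδ
    have hin : ∀ r : ℝ, inner ℝ n (y + r • τ • ν - y) = r * τ * inner ℝ n ν := by
      intro r
      rw [add_sub_cancel_left, inner_smul_right, inner_smul_right, mul_assoc]
    have hback : y + s • τ • ν - τ • ν = y + (s - 1) • τ • ν := by module
    have hs1 : |s - 1| ≤ 1 := by rw [abs_le]; constructor <;> linarith [hp2.1, hp2.2]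
    have hs : |s| ≤ 1 := by rw [abs_le]; constructor <;> linarith [hp2.1, hp2.2]
    have hD : M.shiftDiff T (τ • ν) (y + s • τ • ν) = σ := by
      unfold shiftDiff
      rw [hback]
      have l1 := hloc _ (hball (s - 1) hs1)
      have l2 := hloc _ (hball s hs)
      rw [hin] at l1 l2
      have hsτ : 0 < s * τ := mul_pos hp2.1 hτ
      have hsτ' : (s - 1) * τ < 0 := mul_neg_of_neg_of_pos (by linarith [hp2.2]) hτ
      rcases lt_or_gt_of_ne hν with hneg | hpos
      · have m1 := l1.2.1 (mul_pos_of_neg_of_neg hsτ' hneg)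
        have m2 := l2.1 (mul_neg_of_pos_of_neg hsτ hneg)
        rw [indicator_of_notMem (fun h => m1 (subset_closure h)), indicator_of_mem m2, hσ,
          sign_neg hneg]
        simp
      · have m1 := l1.1 (mul_neg_of_neg_of_pos hsτ' hpos)
        have m2 := l2.2.1 (mul_pos hsτ hpos)
        rw [indicator_of_notMem (fun h => m2 (subset_closure h)), indicator_of_mem m1, hσ,
          sign_pos hpos]
        simp
    have hcnt : M.sweepCount T (τ • ν) (y + s • τ • ν) = 1 := by
      unfold sweepCount
      rw [Finset.sum_eq_single e]
      · rw [if_pos ⟨h, by rw [inner_smul_right]; exact mul_ne_zero hτ.ne' hν⟩,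
          indicator_of_mem (show y + s • τ • ν ∈ sweep (M.face e) (τ • ν) from
            ⟨s, ⟨hp2.1.le, hp2.2.le⟩, by simpa using hpe⟩)]
        rfl
      · intro e' _ hne
        split_ifs
        · apply indicator_of_notMem
          rintro ⟨s', hs', hmem⟩
          have : y + s • τ • ν - s' • τ • ν = y + (s - s') • τ • ν := by module
          rw [this] at hmem
          refine (hloc _ (hball (s - s') ?_)).2.2 e' hne hmem
          rw [abs_le]; constructor <;> linarith [hp2.1, hp2.2, hs'.1, hs'.2]
        · rfl
      · exact fun hne => absurd (Finset.mem_univ e) hne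
    rw [hD, hcnt, div_one]

open Classical in
/-- Gauss' theorem on a cell. -/
theorem integral_fderiv_cell (T : M.Cell) {f : Eu d → ℝ} (hf : ContDiff ℝ 1 f) (ν : Eu d) :
    ∫ x in M.cell T, fderiv ℝ f x ν =
      ∑ e, if M.Inc T e then inner ℝ (M.normal T e) ν * ∫ x in M.face e, f x ∂(surf d) else 0 := by
  classical
  have hT := M.measurableSet_cell T
  have hb := (M.cell_polyhedral T).isBounded
  have hfc := hf.continuous
  refine tendsto_nhds_unique (tendsto_translate_integral hT hb hf ν) ?_
  -- Moving the translation from `f` to the cell turns the difference of integrals into an integral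
  -- against `1_{T+w} - 1_T`, which lives where the frontier sweeps.
  have hint : ∀ w, Integrable (fun x => f x * M.shiftDiff T w x) ∧
      ∫ x, f x * M.shiftDiff T w x = (∫ x in M.cell T, f (x + w)) - ∫ x in M.cell T, f x := by
    intro w
    have i1 : Integrable ((M.cell T).indicator fun x => f (x + w)) :=
      (integrable_indicator_iff hT).2 (integrableOn_of_isBounded (by fun_prop) hb)
    have i2 : Integrable ((M.cell T).indicator f) :=
      (integrable_indicator_iff hT).2 (integrableOn_of_isBounded hfc hb)
    have e : (fun x => f x * M.shiftDiff T w x) = fun x =>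
        (M.cell T).indicator (fun x => f (x + w)) (x - w) - (M.cell T).indicator f x := by
      ext x
      unfold shiftDiff
      by_cases h1 : x - w ∈ M.cell T <;> by_cases h2 : x ∈ M.cell T <;> simp [h1, h2]
    rw [e]
    refine ⟨(i1.comp_sub_right w).sub i2, ?_⟩
    rw [integral_sub (i1.comp_sub_right w) i2,
      integral_sub_right_eq_self ((M.cell T).indicator fun x => f (x + w)) w,
      integral_indicator hT, integral_indicator hT]
  -- The integrand is shared out equally among the faces that pass over `x`. This avoids any
  -- bookkeeping of overlaps, and in the limit the weights are `1` almost everywhere.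
  have hsplit : ∀ τ : ℝ, 0 < τ →
      τ⁻¹ * ((∫ x in M.cell T, f (x + τ • ν)) - ∫ x in M.cell T, f x) =
      ∑ e, if M.Inc T e ∧ inner ℝ (M.normal T e) ν ≠ 0 then |inner ℝ (M.normal T e) ν| *
        ∫ p, (fun x => f x * M.shiftDiff T (τ • ν) x / M.sweepCount T (τ • ν) x)
        (p.1 + p.2 • (τ • ν)) ∂((surf d).restrict (M.face e)).prod
          (volume.restrict (Icc (0 : ℝ) 1)) else 0 := by
    intro τ hτ
    set w := τ • ν with hw
    set K : Eu d → ℝ := fun x => f x * M.shiftDiff T w x / M.sweepCount T w x with hK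
    have hKm : Measurable K :=
      (hfc.measurable.mul (M.measurable_shiftDiff T _)).div (M.measurable_sweepCount T _)
    have hKi : Integrable K := by
      refine (hint w).1.mono hKm.aestronglyMeasurable (Eventually.of_forall fun x => ?_)
      rw [hK, Real.norm_eq_abs, abs_div, Real.norm_eq_abs]
      rcases M.sweepCount_zero_or_one_le T w x with h0 | h1
      · rw [h0, abs_zero, div_zero]; exact abs_nonneg _
      · exact div_le_self (abs_nonneg _) (h1.trans (le_abs_self _))
    have htr : ∀ e, inner ℝ (M.normal T e) w ≠ 0 ↔ inner ℝ (M.normal T e) ν ≠ 0 := by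
      intro e; rw [hw, inner_smul_right]; simp [hτ.ne']
    rw [← (hint w).2]
    have hae : ∀ᵐ x, f x * M.shiftDiff T w x =
        ∑ e, if M.Inc T e ∧ inner ℝ (M.normal T e) w ≠ 0 then
          (sweep (M.face e) w).indicator K x else 0 := by
      filter_upwards [M.ae_sweepCount_ne_zero T w] with x hx
      have : (∑ e, if M.Inc T e ∧ inner ℝ (M.normal T e) w ≠ 0 then
          (sweep (M.face e) w).indicator K x else 0) = M.sweepCount T w x * K x := by
        rw [sweepCount, Finset.sum_mul]
        refine Finset.sum_congr rfl fun e _ => ?_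
        split_ifs
        · by_cases hxe : x ∈ sweep (M.face e) w <;> simp [hxe]
        · simp
      rw [this]
      by_cases hD : M.shiftDiff T w x = 0
      · simp [hK, hD]
      · simp only [hK]
        field_simp [hx hD]
    rw [integral_congr_ae hae, integral_finsetSum, Finset.mul_sum]
    · refine Finset.sum_congr rfl fun e _ => ?_
      simp only [htr]
      split_ifs with he
      · obtain ⟨c, U, hU, hec⟩ := M.face_eq he.1
        have hS : M.face e ⊆ hyp (M.normal T e) c := hec ▸ inter_subset_right
        have hw0 := (htr e).2 he.2
        rw [integral_indicator (measurableSet_sweep hS hw0 (M.measurableSet_face e)),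
          integral_sweep (M.normal_norm T e he.1) hS hw0 (M.measurableSet_face e) hKm, ← mul_assoc]
        congr 1
        rw [hw, inner_smul_right, abs_mul, abs_of_pos hτ, inv_mul_cancel_left₀ hτ.ne']
      · simp
    · intro e _
      split_ifs with he
      · obtain ⟨c, U, hU, hec⟩ := M.face_eq he.1
        exact hKi.indicator
          (measurableSet_sweep (hec ▸ inter_subset_right) he.2 (M.measurableSet_face e))
      · exact integrable_zero _ _ _
  have hev : ∀ᶠ τ : ℝ in 𝓝[>] 0, 0 < τ := self_mem_nhdsWithin
  refine Tendsto.congr' (hev.mono fun τ hτ => (hsplit τ hτ).symm) (tendsto_finsetSum _ ?_)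
  intro e _
  by_cases h : M.Inc T e
  · by_cases hν : inner ℝ (M.normal T e) ν = 0
    · simp [hν]
    · simp only [h, hν, ne_eq, not_false_eq_true, and_self, if_true]
      have := (M.tendsto_sweep_integral h hfc ν hν).const_mul |inner ℝ (M.normal T e) ν|
      rwa [← mul_assoc, abs_mul_sign] at this
  · simp [h]

end PolyMesh
end PDWG

/-! ### Neighbouring cells, Green's formula and piecewise functions -/

namespace PDWG

variable {d : ℕ}

lemma inner_gradient (f : Eu d → ℝ) (x v : Eu d) : inner ℝ (gradient f x) v = fderiv ℝ f x v := by
  rw [gradient, InnerProductSpace.toDual_symm_apply]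

lemma gradient_apply (f : Eu d → ℝ) (x : Eu d) (i : Fin d) : gradient f x i = pd i f x := by
  rw [pd, ← inner_gradient, EuclideanSpace.inner_single_right]
  simp

lemma inner_eq_sum (x y : Eu d) : inner ℝ x y = ∑ i, x i * y i := by
  simp [PiLp.inner_apply, mul_comm]

lemma dvg_mul {φ : Eu d → ℝ} {F : Eu d → Eu d} (hφ : Differentiable ℝ φ)
    (hF : Differentiable ℝ F) (x : Eu d) :
    dvg (fun y => φ y • F y) x = inner ℝ (F x) (gradient φ x) + dvg F x * φ x := by
  have hFi : ∀ i, DifferentiableAt ℝ (fun y => F y i) x := fun i => by fun_prop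
  simp only [dvg, pd, inner_eq_sum, gradient_apply, Finset.sum_mul, ← Finset.sum_add_distrib,
    PiLp.smul_apply, smul_eq_mul]
  refine Finset.sum_congr rfl fun i _ => ?_
  rw [fderiv_fun_mul (hφ x) (hFi i)]
  simp
  ring

namespace PolyMesh

variable {Ω : Set (Eu d)} (M : PolyMesh Ω) {T T' T'' : M.Cell} {e : M.Face}

lemma integrableOn_face {E : Type*} [NormedAddCommGroup E] {f : Eu d → E} (hf : Continuous f)
    (e : M.Face) : IntegrableOn f (M.face e) (surf d) := by
  obtain ⟨C, hC⟩ := (M.isBounded_face e).isCompact_closure.exists_bound_of_continuousOn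
    hf.continuousOn
  have hm : AEStronglyMeasurable f ((surf d).restrict (M.face e)) := by
    borelize E
    exact hf.aestronglyMeasurable
  refine Integrable.of_bound hm C ?_
  filter_upwards [ae_restrict_mem (M.measurableSet_face e)] with x hx
  exact hC x (subset_closure hx)

lemma integrableOn_cell {E : Type*} [NormedAddCommGroup E] {f : Eu d → E} (hf : Continuous f)
    (T : M.Cell) : IntegrableOn f (M.cell T) :=
  integrableOn_of_isBounded hf (M.cell_polyhedral T).isBounded

theorem integral_dvg_cell (T : M.Cell) {F : Eu d → Eu d} (hF : ContDiff ℝ 1 F) :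
    ∫ x in M.cell T, dvg F x = M.bdryInt T (fun e x => inner ℝ (F x) (M.normal T e)) := by
  classical
  have hFi : ∀ i, ContDiff ℝ 1 (fun y => F y i) := fun i => by fun_prop
  unfold dvg
  rw [integral_finsetSum]
  · simp only [pd, M.integral_fderiv_cell T (hFi _), bdryInt]
    rw [Finset.sum_comm]
    refine Finset.sum_congr rfl fun e _ => ?_
    split_ifs with h
    · simp only [inner_eq_sum (F _)]
      rw [integral_finsetSum]
      · refine Finset.sum_congr rfl fun i _ => ?_
        rw [integral_mul_const, mul_comm, EuclideanSpace.inner_single_right]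
        simp
      · intro i _
        exact M.integrableOn_face (by have := (hFi i).continuous; fun_prop) e
    · simp
  · intro i _
    refine M.integrableOn_cell ?_ T
    exact ((hFi i).continuous_fderiv one_ne_zero).clm_apply continuous_const

/-- Both normals are unit vectors orthogonal to the same hyperplane, so they agree up to sign. If
they were equal, the points `x - t n` with small `t` would lie in both of two disjoint cells. -/
lemma normal_eq_neg (hne : T ≠ T') (h : M.Inc T e) (h' : M.Inc T' e) :
    M.normal T' e = - M.normal T e := by
  obtain ⟨c, U, hU, he⟩ := M.face_eq h
  obtain ⟨c', hc'⟩ := M.normal_perp T' e h'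
  obtain ⟨x, hx⟩ := M.face_nonempty e
  have heq := hyp_eq_of_open_subset (M.normal_ne_zero h') hU (he ▸ M.face_nonempty e)
    (he ▸ hc' : U ∩ hyp _ _ ⊆ hyp _ _)
  have hxn : inner ℝ (M.normal T e) x = c := by rw [he] at hx; exact hx.2
  have hxn' : inner ℝ (M.normal T' e) x = c' := hc' hx
  obtain ⟨r, hr⟩ : ∃ r : ℝ, M.normal T' e = r • M.normal T e := by
    apply exists_smul_eq_of_perp
    intro v hv
    have : x + v ∈ hyp (M.normal T' e) c' := by
      rw [heq]; simp [hyp, inner_add_right, hv, hxn]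
    have : inner ℝ (M.normal T' e) (x + v) = c' := this
    rw [inner_add_right, hxn'] at this
    linarith
  have hn := M.normal_norm T' e h'
  rw [hr, norm_smul, M.normal_norm T e h, mul_one, Real.norm_eq_abs] at hn
  rcases (abs_eq one_pos.le).1 hn with h1 | h1
  · rw [h1, one_smul] at hr
    have o1 := M.normal_outward T e h x hx
    have o2 := M.normal_outward T' e h' x hx
    rw [hr] at o2
    obtain ⟨t, ht1, ht2⟩ := (o1.and o2).exists
    exact absurd ht2.1 (disjoint_left.1 (M.cell_disjoint T T' hne) ht1.1)
  · rw [hr, h1, neg_one_smul]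

/-- Three cells at one face would have pairwise opposite normals, which is impossible for nonzero
vectors. -/
lemma eq_or_eq_of_inc (hne : T ≠ T') (h : M.Inc T e) (h' : M.Inc T' e) (h'' : M.Inc T'' e) :
    T'' = T ∨ T'' = T' := by
  by_contra hc
  rw [not_or] at hc
  have h1 := M.normal_eq_neg hne h h'
  have h2 := M.normal_eq_neg (Ne.symm hc.1) h h''
  have h3 := M.normal_eq_neg (Ne.symm hc.2) h' h''
  rw [h2, h1, neg_neg] at h3
  have h4 : (2 : ℝ) • M.normal T e = 0 := by
    rw [two_smul]; nth_rewrite 1 [← h3]; exact neg_add_cancel _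
  exact M.normal_ne_zero h ((smul_eq_zero.1 h4).resolve_left two_ne_zero)

/-- Just beyond the face, the points `x + t n` are outside the closure of `T` but still in `Ω`,
hence in closures of other cells. For small `t` this forces `x` into the closure of such a cell, and
a cell with `x` on its frontier has all of `e` on its frontier. -/
lemma exists_neighbour (hΩ : IsOpen Ω) (h : M.Inc T e) (he : M.face e ⊆ Ω) : ∃ T', T ≠ T' ∧ M.Inc T' e := by
  obtain ⟨x, hx⟩ := M.face_nonempty e
  obtain ⟨n, c, U, hn, hU, heq⟩ := M.exists_face_eq e
  have hout := M.normal_outward T e h x hx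
  have hcov : ∀ᶠ t : ℝ in 𝓝[>] 0, x + t • M.normal T e ∉ closure (M.cell T) := hout.mono fun t h => h.2
  have htend : Tendsto (fun t : ℝ => x + t • M.normal T e) (𝓝[>] 0) (𝓝 x) := by
    have : Continuous fun t : ℝ => x + t • M.normal T e := by fun_prop
    simpa using (this.tendsto 0).mono_left (nhdsWithin_le_nhds (s := Ioi 0))
  by_contra hno
  push Not at hno
  have hxout : ∀ T', T' ≠ T → x ∉ closure (M.cell T') := by
    intro T' hne hcl
    by_cases hxT : x ∈ M.cell T'
    · have hxcl : x ∈ closure (M.cell T) := frontier_subset_closure (h hx)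
      obtain ⟨z, hz, hz'⟩ := mem_closure_iff.1 hxcl _ (M.cell_polyhedral T').isOpen hxT
      exact disjoint_left.1 (M.cell_disjoint T' T hne) hz hz'
    · have hxf : x ∈ frontier (M.cell T') :=
        ⟨hcl, by rwa [(M.cell_polyhedral T').isOpen.interior_eq]⟩
      have := (M.face_cell T' e).resolve_right fun hd => disjoint_left.1 hd hx hxf
      exact hno T' hne.symm this
  have h1 : ∀ᶠ t : ℝ in 𝓝[>] 0, ∀ T', T' ≠ T → x + t • M.normal T e ∉ closure (M.cell T') := by
    rw [Filter.eventually_all]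
    intro T'
    by_cases hne : T' = T
    · exact Eventually.of_forall fun _ h => absurd hne h
    · exact (htend.eventually_mem
        (isClosed_closure.isOpen_compl.mem_nhds (hxout T' hne))).mono fun t ht _ => ht
  have h2 : ∀ᶠ y in 𝓝 x, y ∈ ⋃ T, closure (M.cell T) :=
    (hΩ.eventually_mem (he hx)).mono fun y hy => M.cover hy
  obtain ⟨t, ht1, ht2, ht3⟩ := (hcov.and (h1.and (htend.eventually h2))).exists
  obtain ⟨T', hT'⟩ := mem_iUnion.1 ht3
  by_cases hne : T' = T
  · subst hne; exact ht1 hT'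
  · exact ht2 T' hne hT'

/-- With cells on both sides, the half balls of `ae_face_local` would place a point of the face in
the interior of the closure of `Ω`. This interior is `Ω`, so the point would not be a boundary
point. -/
lemma inc_unique_of_boundary (hΩ : interior (closure Ω) = Ω) (he : M.face e ⊆ frontier Ω)
    (h : M.Inc T e) (h' : M.Inc T' e) : T' = T := by
  by_contra hne
  have hneg := M.normal_eq_neg (Ne.symm hne) h h'
  have hae := (M.ae_face_local h).and (M.ae_face_local h')
  have hpos : (surf d).restrict (M.face e) ≠ 0 := by
    intro h0
    have := M.surf_inter_face_pos e isOpen_univ (by simpa using M.face_nonempty e)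
    rw [univ_inter, ← Measure.restrict_apply_univ, h0] at this
    simp at this
  have : (ae ((surf d).restrict (M.face e))).NeBot := ae_neBot.2 hpos
  obtain ⟨y, ⟨⟨δ, hδ, h1⟩, ⟨δ', hδ', h2⟩⟩, hye⟩ :=
    (hae.and (ae_restrict_mem (M.measurableSet_face e))).exists
  have hyΩ : y ∈ interior (closure Ω) := by
    refine mem_interior.2 ⟨Metric.ball y (min δ δ'), fun z hz => ?_, Metric.isOpen_ball,
      Metric.mem_ball_self (lt_min hδ hδ')⟩
    have hz1 : z ∈ Metric.ball y δ := Metric.ball_subset_ball (min_le_left _ _) hz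
    have hz2 : z ∈ Metric.ball y δ' := Metric.ball_subset_ball (min_le_right _ _) hz
    rcases lt_trichotomy (inner ℝ (M.normal T e) (z - y)) 0 with hl | hl | hl
    · exact subset_closure (M.cell_subset T ((h1 z hz1).1 hl))
    -- Points on the hyperplane itself are limits of points of `T`.
    · have htend : Tendsto (fun t : ℝ => z - t • M.normal T e) (𝓝[>] 0) (𝓝 z) := by
        have : Continuous fun t : ℝ => z - t • M.normal T e := by fun_prop
        simpa using (this.tendsto 0).mono_left (nhdsWithin_le_nhds (s := Ioi 0))
      refine mem_closure_of_tendsto htend ?_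
      have hb := htend.eventually_mem (Metric.isOpen_ball.mem_nhds hz1)
      have hp : ∀ᶠ t : ℝ in 𝓝[>] 0, 0 < t := self_mem_nhdsWithin
      filter_upwards [hb, hp] with t ht ht0
      refine M.cell_subset T ((h1 _ ht).1 ?_)
      have : z - t • M.normal T e - y = (z - y) - t • M.normal T e := by abel
      rw [this, inner_sub_right, hl, inner_smul_right, real_inner_self_eq_norm_sq,
        M.normal_norm T e h]
      linarith
    · refine subset_closure (M.cell_subset T' ((h2 z hz2).1 ?_))
      rw [hneg, inner_neg_left]; linarith
  rw [hΩ] at hyΩ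
  have hfr := he hye
  rw [frontier, ← hΩ, interior_interior, hΩ] at hfr
  exact hfr.2 hyΩ

lemma not_subset_frontier (hΩ : IsOpen Ω) (he : M.face e ⊆ Ω) : ¬ M.face e ⊆ frontier Ω := by
  intro h
  obtain ⟨x, hx⟩ := M.face_nonempty e
  exact (h hx).2 (by rw [hΩ.interior_eq]; exact he hx)

open Classical in
lemma sum_inc_interior {α : Type*} [AddCommMonoid α] (hne : T ≠ T') (h : M.Inc T e)
    (h' : M.Inc T' e) (F : M.Cell → α) : (∑ S, if M.Inc S e then F S else 0) = F T + F T' := by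
  rw [← Finset.sum_pair hne, ← Finset.sum_subset (Finset.subset_univ {T, T'})]
  · refine Finset.sum_congr rfl fun S hS => ?_
    rcases Finset.mem_insert.1 hS with rfl | hS
    · rw [if_pos h]
    · rw [Finset.mem_singleton.1 hS, if_pos h']
  · intro S _ hS
    rw [if_neg]
    intro hS'
    apply hS
    simpa using M.eq_or_eq_of_inc hne h h' hS'

open Classical in
lemma sum_inc_boundary {α : Type*} [AddCommMonoid α] (hΩ : interior (closure Ω) = Ω)
    (he : M.face e ⊆ frontier Ω) (h : M.Inc T e) (F : M.Cell → α) :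
    (∑ S, if M.Inc S e then F S else 0) = F T := by
  rw [Finset.sum_eq_single T]
  · rw [if_pos h]
  · intro S _ hS
    rw [if_neg]
    exact fun hS' => hS (M.inc_unique_of_boundary hΩ he h hS')
  · exact fun h => absurd (Finset.mem_univ T) h

lemma bdryInt_congr {F G : M.Face → Eu d → ℝ}
    (h : ∀ e, M.Inc T e → ∀ x ∈ M.face e, F e x = G e x) : M.bdryInt T F = M.bdryInt T G := by
  classical
  unfold bdryInt
  refine Finset.sum_congr rfl fun e _ => ?_
  split_ifs with he
  · exact setIntegral_congr_fun (M.measurableSet_face e) (h e he)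
  · rfl

/-- Piecewise Green's formula. -/
theorem sum_integral_green {F : M.Cell → Eu d → Eu d} {φ : Eu d → ℝ}
    (hF : ∀ T, ContDiff ℝ 1 (F T)) (hφ : ContDiff ℝ 1 φ) [DecidableRel M.Inc] :
    ∑ T, ∫ x in M.cell T, (inner ℝ (F T x) (gradient φ x) + dvg (F T) x * φ x) =
      ∑ e, ∫ x in M.face e,
        (∑ T, if M.Inc T e then inner ℝ (F T x) (M.normal T e) else 0) * φ x ∂(surf d) := by
  have h1 : ∀ T, ∫ x in M.cell T, (inner ℝ (F T x) (gradient φ x) + dvg (F T) x * φ x) =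
      ∑ e, ∫ x in M.face e, (if M.Inc T e then inner ℝ (F T x) (M.normal T e) else 0) * φ x
        ∂(surf d) := by
    intro T
    have : ∀ x, inner ℝ (F T x) (gradient φ x) + dvg (F T) x * φ x =
        dvg (fun y => φ y • F T y) x := fun x =>
      (dvg_mul (hφ.differentiable one_ne_zero) ((hF T).differentiable one_ne_zero) x).symm
    simp only [this]
    rw [M.integral_dvg_cell T (F := fun y => φ y • F T y) (hφ.smul (hF T)), bdryInt]
    refine Finset.sum_congr rfl fun e _ => ?_
    split_ifs
    · simp only [real_inner_smul_left, mul_comm (φ _)]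
    · simp
  simp only [h1]
  rw [Finset.sum_comm]
  refine Finset.sum_congr rfl fun e _ => ?_
  simp only [Finset.sum_mul]
  rw [integral_finsetSum]
  intro T _
  refine M.integrableOn_face ?_ e
  have := (hF T).continuous
  have := hφ.continuous
  split_ifs <;> fun_prop

/-! ### Piecewise functions -/

lemma volume_frontier_cell (T : M.Cell) : volume (frontier (M.cell T)) = 0 := by
  obtain ⟨H, hH0, hH⟩ := (M.cell_polyhedral T).frontier_subset
  refine measure_mono_null hH ?_
  refine (measure_biUnion_null_iff H.countable_toSet).2 ?_
  exact fun p hp => volume_hyp (hH0 p hp) p.2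

lemma ae_mem_iUnion_cell : ∀ᵐ x, x ∈ Ω → x ∈ ⋃ T, M.cell T := by
  have : ∀ᵐ x, ∀ T, x ∉ frontier (M.cell T) := by
    rw [ae_all_iff]
    exact fun T => measure_eq_zero_iff_ae_notMem.1 (M.volume_frontier_cell T)
  filter_upwards [this] with x hx hxΩ
  obtain ⟨T, hT⟩ := mem_iUnion.1 (M.cover hxΩ)
  refine mem_iUnion.2 ⟨T, ?_⟩
  by_contra h
  exact hx T ⟨hT, by rwa [(M.cell_polyhedral T).isOpen.interior_eq]⟩

lemma restrict_eq_iUnion_cell :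
    (volume : Measure (Eu d)).restrict Ω = volume.restrict (⋃ T, M.cell T) := by
  apply Measure.restrict_congr_set
  filter_upwards [M.ae_mem_iUnion_cell] with x hx
  exact propext ⟨hx, fun h => by
    obtain ⟨T, hT⟩ := mem_iUnion.1 h
    exact M.cell_subset T hT⟩

lemma ae_restrict_of_cells {p : Eu d → Prop} (h : ∀ T, ∀ x ∈ M.cell T, p x) :
    ∀ᵐ x ∂(volume.restrict Ω), p x := by
  rw [M.restrict_eq_iUnion_cell]
  filter_upwards [ae_restrict_mem (MeasurableSet.iUnion M.measurableSet_cell)] with x hx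
  obtain ⟨T, hT⟩ := mem_iUnion.1 hx
  exact h T x hT

lemma integrableOn_of_cells {E : Type*} [NormedAddCommGroup E] {G : Eu d → E}
    {H : M.Cell → Eu d → E} (hGH : ∀ T, ∀ x ∈ M.cell T, G x = H T x)
    (hH : ∀ T, IntegrableOn (H T) (M.cell T)) : IntegrableOn G Ω := by
  rw [IntegrableOn, M.restrict_eq_iUnion_cell]
  exact integrableOn_finite_iUnion.2 fun T =>
    (integrableOn_congr_fun (hGH T) (M.measurableSet_cell T)).2 (hH T)

lemma integral_of_cells {E : Type*} [NormedAddCommGroup E] [NormedSpace ℝ E] {G : Eu d → E}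
    {H : M.Cell → Eu d → E} (hGH : ∀ T, ∀ x ∈ M.cell T, G x = H T x)
    (hH : ∀ T, IntegrableOn (H T) (M.cell T)) :
    ∫ x in Ω, G x = ∑ T, ∫ x in M.cell T, H T x := by
  rw [M.restrict_eq_iUnion_cell, integral_iUnion_fintype M.measurableSet_cell
    (fun T T' h => M.cell_disjoint T T' h)]
  · exact Finset.sum_congr rfl fun T _ => setIntegral_congr_fun (M.measurableSet_cell T) (hGH T)
  · exact fun T => (integrableOn_congr_fun (hGH T) (M.measurableSet_cell T)).2 (hH T)

open Classical in
/-- The function that is `F T` on each cell `T`. -/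
noncomputable def pw {α : Type*} [Zero α] (F : M.Cell → Eu d → α) (x : Eu d) : α :=
  if h : ∃ T, x ∈ M.cell T then F h.choose x else 0

lemma pw_eq {α : Type*} [Zero α] (F : M.Cell → Eu d → α) {x : Eu d} (hx : x ∈ M.cell T) :
    M.pw F x = F T x := by
  have h : ∃ T, x ∈ M.cell T := ⟨T, hx⟩
  have : h.choose = T := by
    by_contra hne
    exact disjoint_left.1 (M.cell_disjoint _ _ hne) h.choose_spec hx
  rw [pw, dif_pos h, this]

lemma memLp_pw {E : Type*} [NormedAddCommGroup E] {F : M.Cell → Eu d → E}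
    (hF : ∀ T, Continuous (F T)) (hΩ : Bornology.IsBounded Ω) :
    MemLp (M.pw F) 2 (volume.restrict Ω) := by
  have : IsFiniteMeasure (volume.restrict Ω) :=
    ⟨by rw [Measure.restrict_apply_univ]; exact hΩ.measure_lt_top⟩
  have hb : ∀ T, ∃ C, ∀ x ∈ M.cell T, ‖F T x‖ ≤ C := fun T => by
    obtain ⟨C, hC⟩ := (M.cell_polyhedral T).isBounded.isCompact_closure.exists_bound_of_continuousOn
      (hF T).continuousOn
    exact ⟨C, fun x hx => hC x (subset_closure hx)⟩
  choose C hC using hb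
  refine MemLp.of_bound (M.integrableOn_of_cells (fun T x hx => M.pw_eq F hx)
    fun T => M.integrableOn_cell (hF T) T).aestronglyMeasurable (∑ T, |C T|) ?_
  refine M.ae_restrict_of_cells fun T x hx => ?_
  rw [M.pw_eq F hx]
  exact (hC T x hx).trans ((le_abs_self _).trans
    (Finset.single_le_sum (f := fun T => |C T|) (fun _ _ => abs_nonneg _) (Finset.mem_univ T)))

end PolyMesh
end PDWG

/-! ### Polynomials, algebraic identities and vanishing criteria -/

namespace PDWG

variable {d r s : ℕ}

/-! ### Polynomial functions -/

lemma mem_polyFun_iff {f : Eu d → ℝ} : f ∈ polyFun d r ↔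
    ∃ p : MvPolynomial (Fin d) ℝ, p.totalDegree ≤ r ∧
      ∀ x : Eu d, f x = MvPolynomial.aeval (fun i => x i) p := by
  rw [polyFun, Submodule.mem_map]
  constructor
  · rintro ⟨p, hp, rfl⟩
    exact ⟨p, (MvPolynomial.mem_restrictTotalDegree _ _ _).1 hp, fun x => rfl⟩
  · rintro ⟨p, hp, h⟩
    exact ⟨p, (MvPolynomial.mem_restrictTotalDegree _ _ _).2 hp, funext fun x => (h x).symm⟩

instance : Module.Finite ℝ (polyFun d r) := by
  unfold polyFun; infer_instance

lemma polyFun_mono (h : r ≤ s) : polyFun d r ≤ polyFun d s := by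
  intro f hf
  rw [mem_polyFun_iff] at hf ⊢
  obtain ⟨p, hp, hf⟩ := hf
  exact ⟨p, hp.trans h, hf⟩

lemma analyticOnNhd_of_mem_polyFun {f : Eu d → ℝ} (hf : f ∈ polyFun d r) :
    AnalyticOnNhd ℝ f univ := by
  obtain ⟨p, -, hp⟩ := mem_polyFun_iff.1 hf
  rw [funext hp]
  refine AnalyticOnNhd.aeval_mvPolynomial (fun i => ?_) p
  exact (EuclideanSpace.proj (𝕜 := ℝ) i).analyticOnNhd _

lemma contDiff_of_mem_polyFun {f : Eu d → ℝ} (hf : f ∈ polyFun d r) {n : ℕ∞ω} :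
    ContDiff ℝ n f :=
  (contDiffOn_univ.1 ((analyticOnNhd_of_mem_polyFun hf).contDiffOn uniqueDiffOn_univ))

lemma continuous_of_mem_polyFun {f : Eu d → ℝ} (hf : f ∈ polyFun d r) : Continuous f :=
  (contDiff_of_mem_polyFun hf (n := 0)).continuous

/-- A polynomial that vanishes on a nonempty open set is zero. -/
lemma polyFun_eq_zero {f : Eu d → ℝ} (hf : f ∈ polyFun d r) {U : Set (Eu d)} (hU : IsOpen U)
    (hne : U.Nonempty) (h : ∀ x ∈ U, f x = 0) : f = 0 := by
  obtain ⟨x, hx⟩ := hne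
  have := (analyticOnNhd_of_mem_polyFun hf).eqOn_zero_of_preconnected_of_eventuallyEq_zero
    isPreconnected_univ (mem_univ x) (Filter.eventually_of_mem (hU.mem_nhds hx) h)
  exact funext fun y => this (mem_univ y)

/-- For each monomial, either the variable is absent and the derivative is zero, or one exponent
drops by one; truncated subtraction covers constants. -/
lemma totalDegree_pderiv_le {σ : Type*} (i : σ) (p : MvPolynomial σ ℝ) :
    (MvPolynomial.pderiv i p).totalDegree ≤ p.totalDegree - 1 := by
  classical
  conv_lhs => rw [← MvPolynomial.support_sum_monomial_coeff p]
  rw [map_sum]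
  refine (MvPolynomial.totalDegree_finsetSum _ _).trans (Finset.sup_le fun m hm => ?_)
  rw [MvPolynomial.pderiv_monomial]
  by_cases hi : m i = 0
  · simp [hi]
  · refine (MvPolynomial.totalDegree_monomial_le _ _).trans ?_
    have h1 := MvPolynomial.le_totalDegree hm
    have h2 : (m - Finsupp.single i 1) + Finsupp.single i 1 = m :=
      tsub_add_cancel_of_le (by
        rw [Finsupp.single_le_iff]; omega)
    have h3 : (m.sum fun _ => id) = ((m - Finsupp.single i 1).sum fun _ => id) + 1 := by
      conv_lhs => rw [← h2]
      rw [Finsupp.sum_add_index' (by simp) (by simp)]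
      simp
    have h4 : (m.sum fun _ e => e) = (m.sum fun _ => id) := rfl
    omega

lemma pd_mem_polyFun {f : Eu d → ℝ} (hf : f ∈ polyFun d r) (i : Fin d) :
    pd i f ∈ polyFun d (r - 1) := by
  obtain ⟨p, hp, hfp⟩ := mem_polyFun_iff.1 hf
  refine mem_polyFun_iff.2 ⟨MvPolynomial.pderiv i p,
    (totalDegree_pderiv_le i p).trans (by omega), fun x => ?_⟩
  rw [funext hfp, pd]
  clear hp hfp hf f
  have hdiff : ∀ q : MvPolynomial (Fin d) ℝ, Differentiable ℝ
      fun x : Eu d => MvPolynomial.aeval (fun i => x i) q := fun q =>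
    (contDiff_of_mem_polyFun (mem_polyFun_iff.2 ⟨q, le_rfl, fun x => rfl⟩)
      (n := 1)).differentiable one_ne_zero
  induction p using MvPolynomial.induction_on with
  | C a => simp
  | add p q hp hq =>
    simp only [map_add]
    rw [fderiv_fun_add (hdiff p x) (hdiff q x), add_apply, hp, hq]
  | mul_X p j hp =>
    simp only [map_mul, MvPolynomial.aeval_X, Derivation.leibniz, smul_eq_mul, map_add]
    have hj : HasFDerivAt (fun x : Eu d => x j) (EuclideanSpace.proj (𝕜 := ℝ) j) x :=
      (EuclideanSpace.proj (𝕜 := ℝ) j).hasFDerivAt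
    have := (hdiff p x).hasFDerivAt.mul hj
    have := this.fderiv
    simp only [Pi.mul_def] at this
    rw [this]
    simp only [add_apply, smul_apply, hp, smul_eq_mul,
      MvPolynomial.pderiv_X]
    by_cases h : i = j
    · subst h; simp
    · simp [Ne.symm h]

lemma isPolyVec_gradient {f : Eu d → ℝ} (hf : f ∈ polyFun d r) : IsPolyVec (r - 1) (gradient f) := by
  intro i
  simp only [gradient_apply]
  exact pd_mem_polyFun hf i

lemma IsPolyVec.mono {F : Eu d → Eu d} (hF : IsPolyVec r F) (h : r ≤ s) : IsPolyVec s F :=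
  fun i => polyFun_mono h (hF i)

lemma IsPolyVec.contDiff {F : Eu d → Eu d} (hF : IsPolyVec r F) {n : ℕ∞ω} : ContDiff ℝ n F :=
  contDiff_euclidean.2 fun i => contDiff_of_mem_polyFun (hF i)

lemma IsPolyVec.mv {F : Eu d → Eu d} (hF : IsPolyVec r F) (A : Matrix (Fin d) (Fin d) ℝ) :
    IsPolyVec r (fun x => mv A (F x)) := by
  intro i
  have : (fun x => PDWG.mv A (F x) i) = ∑ j, A i j • fun x => F x j := by
    ext x
    simp [PDWG.mv, Matrix.mulVec, dotProduct]
  rw [this]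
  exact Submodule.sum_mem _ fun j _ => Submodule.smul_mem _ _ (hF j)

lemma IsPolyVec.add {F G : Eu d → Eu d} (hF : IsPolyVec r F) (hG : IsPolyVec r G) :
    IsPolyVec r (fun x => F x + G x) := fun i => Submodule.add_mem _ (hF i) (hG i)

lemma IsPolyVec.sub {F G : Eu d → Eu d} (hF : IsPolyVec r F) (hG : IsPolyVec r G) :
    IsPolyVec r (fun x => F x - G x) := fun i => Submodule.sub_mem _ (hF i) (hG i)

lemma isPolyVec_smul_const {f : Eu d → ℝ} (hf : f ∈ polyFun d r) (v : Eu d) :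
    IsPolyVec r (fun x => f x • v) := by
  intro i
  have : (fun x => (f x • v) i) = v i • f := by ext x; simp [mul_comm]
  rw [this]
  exact Submodule.smul_mem _ _ hf

lemma IsPolyVec.inner_const {F : Eu d → Eu d} (hF : IsPolyVec r F) (v : Eu d) :
    (fun x => inner ℝ (F x) v) ∈ polyFun d r := by
  have : (fun x => inner ℝ (F x) v) = ∑ i, v i • fun x => F x i := by
    ext x
    simp [inner_eq_sum, mul_comm]
  rw [this]
  exact Submodule.sum_mem _ fun j _ => Submodule.smul_mem _ _ (hF j)

lemma IsPolyVec.dvg {F : Eu d → Eu d} (hF : IsPolyVec r F) : dvg F ∈ polyFun d (r - 1) := by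
  have : PDWG.dvg F = ∑ i, pd i (fun y => F y i) := by
    ext x; simp [PDWG.dvg]
  rw [this]
  exact Submodule.sum_mem _ fun i _ => pd_mem_polyFun (hF i) i

/-! ### Algebraic identities -/

lemma inner_mv_comm {A : Matrix (Fin d) (Fin d) ℝ} (hA : A.IsSymm) (v w : Eu d) :
    inner ℝ (mv A v) w = inner ℝ v (mv A w) := by
  simp only [inner_eq_sum, mv, Matrix.mulVec, dotProduct, Finset.sum_mul, Finset.mul_sum]
  rw [Finset.sum_comm]
  refine Finset.sum_congr rfl fun i _ => Finset.sum_congr rfl fun j _ => ?_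
  rw [← hA.apply i j]; ring

lemma mv_add (A : Matrix (Fin d) (Fin d) ℝ) (v w : Eu d) : mv A (v + w) = mv A v + mv A w := by
  ext i; simp [mv, Matrix.mulVec_add]

lemma mv_smul (A : Matrix (Fin d) (Fin d) ℝ) (c : ℝ) (v : Eu d) : mv A (c • v) = c • mv A v := by
  ext i; simp [mv, Matrix.mulVec_smul]

lemma gradient_add {f g : Eu d → ℝ} (hf : Differentiable ℝ f) (hg : Differentiable ℝ g) :
    gradient (f + g) = gradient f + gradient g := by
  ext x i
  simp [gradient_apply, pd, fderiv_add (hf x) (hg x)]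

lemma gradient_smul {f : Eu d → ℝ} (c : ℝ) (hf : Differentiable ℝ f) :
    gradient (c • f) = c • gradient f := by
  ext x i
  simp [gradient_apply, pd, fderiv_const_smul (hf x) c]

lemma dvg_add {F G : Eu d → Eu d} (hF : Differentiable ℝ F) (hG : Differentiable ℝ G) (x : Eu d) :
    dvg (fun y => F y + G y) x = dvg F x + dvg G x := by
  simp only [dvg, pd, PiLp.add_apply, ← Finset.sum_add_distrib]
  refine Finset.sum_congr rfl fun i _ => ?_
  have h1 : DifferentiableAt ℝ (fun y => F y i) x := by fun_prop
  have h2 : DifferentiableAt ℝ (fun y => G y i) x := by fun_prop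
  rw [fderiv_fun_add h1 h2]; rfl

lemma dvg_sub {F G : Eu d → Eu d} (hF : Differentiable ℝ F) (hG : Differentiable ℝ G) (x : Eu d) :
    dvg (fun y => F y - G y) x = dvg F x - dvg G x := by
  simp only [dvg, pd, PiLp.sub_apply, ← Finset.sum_sub_distrib]
  refine Finset.sum_congr rfl fun i _ => ?_
  have h1 : DifferentiableAt ℝ (fun y => F y i) x := by fun_prop
  have h2 : DifferentiableAt ℝ (fun y => G y i) x := by fun_prop
  rw [fderiv_fun_sub h1 h2]; rfl

lemma dvg_smul_const {f : Eu d → ℝ} (hf : Differentiable ℝ f) (v : Eu d) (x : Eu d) :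
    dvg (fun y => f y • v) x = inner ℝ v (gradient f x) := by
  have h := dvg_mul hf (differentiable_const v) x
  have h0 : dvg (fun _ : Eu d => v) x = 0 := by simp [dvg, pd]
  rw [h, h0]; ring

lemma dvg_congr_of_eqOn {U : Set (Eu d)} (hU : IsOpen U) {F G : Eu d → Eu d}
    (h : ∀ x ∈ U, F x = G x) {x : Eu d} (hx : x ∈ U) : dvg F x = dvg G x := by
  simp only [dvg, pd]
  refine Finset.sum_congr rfl fun i _ => ?_
  have : (fun y => F y i) =ᶠ[𝓝 x] fun y => G y i :=
    Filter.eventually_of_mem (hU.mem_nhds hx) fun y hy => by simp only [h y hy]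
  rw [this.fderiv_eq]

/-! ### Nondegenerate forms in finite dimension -/

/-- An injective linear map from `V` to its dual is bijective, since both have the same dimension.
-/
lemma existsUnique_of_nondegenerate {V : Type*} [AddCommGroup V] [Module ℝ V]
    [FiniteDimensional ℝ V] (B : V →ₗ[ℝ] V →ₗ[ℝ] ℝ) (hB : ∀ v, (∀ w, B v w = 0) → v = 0)
    (l : V →ₗ[ℝ] ℝ) : ∃! v, ∀ w, B v w = l w := by
  have hinj : Function.Injective B := by
    rw [← LinearMap.ker_eq_bot, LinearMap.ker_eq_bot']
    exact fun v hv => hB v fun w => by rw [hv]; rfl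
  have hsurj : Function.Surjective B :=
    (LinearMap.injective_iff_surjective_of_finrank_eq_finrank
      (Subspace.dual_finrank_eq (K := ℝ) (V := V)).symm).1 hinj
  obtain ⟨v, hv⟩ := hsurj l
  refine ⟨v, fun w => by rw [hv], fun v' hv' => hinj ?_⟩
  rw [hv]
  exact LinearMap.ext hv'

/-! ### Vanishing of continuous functions from integrals -/

/-- The square vanishes almost everywhere on `S`, whereas a point of `S` with `f x ≠ 0` would make
it nonzero on a relatively open set of positive measure. -/
lemma eq_zero_of_integral_sq {μ : Measure (Eu d)} {S : Set (Eu d)} (hS : MeasurableSet S)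
    (hpos : ∀ V, IsOpen V → (V ∩ S).Nonempty → 0 < μ (V ∩ S)) {f : Eu d → ℝ} (hf : Continuous f)
    (hint : IntegrableOn (fun x => f x ^ 2) S μ) (h : ∫ x in S, f x ^ 2 ∂μ = 0) :
    ∀ x ∈ S, f x = 0 := by
  intro x hx
  by_contra hne
  rw [integral_eq_zero_iff_of_nonneg (fun x => sq_nonneg _) hint] at h
  have hV : IsOpen {y | f y ≠ 0} := isOpen_ne_fun hf continuous_const
  refine (hpos _ hV ⟨x, hne, hx⟩).ne' ?_
  rw [← Measure.restrict_apply' hS]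
  refine measure_mono_null (fun y hy => ?_) h
  simpa using hy

namespace PolyMesh

variable {Ω : Set (Eu d)} (M : PolyMesh Ω) {T : M.Cell} {e : M.Face}

lemma eq_zero_on_face {f : Eu d → ℝ} (hf : Continuous f)
    (h : ∫ x in M.face e, f x ^ 2 ∂(surf d) = 0) : ∀ x ∈ M.face e, f x = 0 :=
  eq_zero_of_integral_sq (M.measurableSet_face e) (fun _ hV => M.surf_inter_face_pos e hV) hf
    (M.integrableOn_face (by fun_prop) e) h

lemma eq_zero_on_cell {f : Eu d → ℝ} (hf : Continuous f)
    (h : ∫ x in M.cell T, f x ^ 2 = 0) : ∀ x ∈ M.cell T, f x = 0 :=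
  eq_zero_of_integral_sq (M.measurableSet_cell T)
    (fun _ hV hne => (hV.inter (M.cell_polyhedral T).isOpen).measure_pos _ hne) hf
    (M.integrableOn_cell (by fun_prop) T) h

lemma cell_nonempty (T : M.Cell) : (M.cell T).Nonempty := (M.cell_polyhedral T).isConnected.nonempty

end PolyMesh
end PDWG

/-! ### Piecewise smooth functions in `H¹` and `H(div)` -/

namespace PDWG

variable {d : ℕ}

/-- On a finite measure space convergence in `L²` implies convergence in `L¹`, here of the majorants
`C * ‖h n‖`. -/
lemma tendsto_integral_zero_of_eLpNorm {α E : Type*} [MeasurableSpace α] {μ : Measure α}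
    [IsFiniteMeasure μ] [NormedAddCommGroup E] {h : ℕ → α → E} {k : ℕ → α → ℝ}
    (hm : ∀ n, AEStronglyMeasurable (h n) μ)
    (hlim : Tendsto (fun n => eLpNorm (h n) 2 μ) atTop (𝓝 0)) (C : ℝ)
    (hk : ∀ n, ∀ᵐ x ∂μ, ‖k n x‖ ≤ C * ‖h n x‖) :
    Tendsto (fun n => ∫ x, k n x ∂μ) atTop (𝓝 0) := by
  have hle : ∀ n, ‖∫ x, k n x ∂μ‖ₑ ≤
      ENNReal.ofReal C * (eLpNorm (h n) 2 μ * μ univ ^ (1 / (1 : ℝ≥0∞).toReal - 1 / (2 : ℝ≥0∞).toReal)) := by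
    intro n
    calc ‖∫ x, k n x ∂μ‖ₑ ≤ ∫⁻ x, ‖k n x‖ₑ ∂μ := enorm_integral_le_lintegral_enorm _
      _ ≤ ∫⁻ x, ENNReal.ofReal C * ‖h n x‖ₑ ∂μ := by
        refine lintegral_mono_ae ((hk n).mono fun x hx => ?_)
        rw [← ofReal_norm, ← ofReal_norm, ← ENNReal.ofReal_mul' (norm_nonneg _)]
        exact ENNReal.ofReal_le_ofReal hx
      _ = ENNReal.ofReal C * eLpNorm (h n) 1 μ := by
        rw [lintegral_const_mul'' _ (hm n).enorm, eLpNorm_one_eq_lintegral_enorm]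
      _ ≤ _ := by
        gcongr
        exact eLpNorm_le_eLpNorm_mul_rpow_measure_univ one_le_two (hm n)
  have hfin : μ univ ^ (1 / (1 : ℝ≥0∞).toReal - 1 / (2 : ℝ≥0∞).toReal) ≠ ⊤ := by
    refine ENNReal.rpow_ne_top_of_nonneg ?_ (measure_ne_top μ _)
    norm_num
  have hz : Tendsto (fun n => ENNReal.ofReal C * (eLpNorm (h n) 2 μ *
      μ univ ^ (1 / (1 : ℝ≥0∞).toReal - 1 / (2 : ℝ≥0∞).toReal))) atTop (𝓝 0) := by
    have := ENNReal.Tendsto.const_mul (a := ENNReal.ofReal C)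
      (ENNReal.Tendsto.mul_const (b := μ univ ^ (1 / (1 : ℝ≥0∞).toReal - 1 / (2 : ℝ≥0∞).toReal)) hlim
        (Or.inr hfin)) (Or.inr ENNReal.ofReal_ne_top)
    simpa using this
  exact tendsto_zero_iff_enorm_tendsto_zero.2
    (tendsto_of_tendsto_of_tendsto_of_le_of_le tendsto_const_nhds hz (fun _ => zero_le) hle)

/-- The fundamental lemma of the calculus of variations. It is needed because `HasTrace` carries a
weak gradient of its own. -/
lemma HasWeakGrad.ae_eq {Ω : Set (Eu d)} (hΩ : IsOpen Ω) {w : Eu d → ℝ} {G G' : Eu d → Eu d}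
    (h : HasWeakGrad Ω w G) (h' : HasWeakGrad Ω w G') : ∀ᵐ x ∂(volume.restrict Ω), G x = G' x := by
  have key : ∀ i, ∀ᵐ x, x ∈ Ω → G x i - G' x i = 0 := by
    intro i
    have li : ∀ {F : Eu d → Eu d}, MemLp F 2 (volume.restrict Ω) →
        LocallyIntegrableOn (fun x => F x i) Ω := by
      intro F hF
      have : MemLp (fun x => F x i) 2 (volume.restrict Ω) :=
        (EuclideanSpace.proj (𝕜 := ℝ) i).comp_memLp' hF
      rw [locallyIntegrableOn_iff hΩ.isLocallyClosed]
      intro K hK hKc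
      have : MemLp (fun x => F x i) 2 (volume.restrict K) :=
        this.mono_measure (Measure.restrict_mono hK le_rfl)
      have : IsFiniteMeasure (volume.restrict K) :=
        ⟨by rw [Measure.restrict_apply_univ]; exact hKc.measure_lt_top⟩
      exact MemLp.integrable one_le_two (by assumption)
    refine hΩ.ae_eq_zero_of_integral_contDiff_smul_eq_zero
      ((li h.memLp_grad).sub (li h'.memLp_grad)) fun φ hφ hc hs => ?_
    have i1 : ∀ {F : Eu d → Eu d}, MemLp F 2 (volume.restrict Ω) →
        Integrable (fun x => F x i * φ x) (volume.restrict Ω) := by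
      intro F hF
      have h1 : MemLp (fun x => F x i) 2 (volume.restrict Ω) :=
        (EuclideanSpace.proj (𝕜 := ℝ) i).comp_memLp' hF
      have h2 : MemLp φ 2 (volume.restrict Ω) :=
        (hφ.continuous.memLp_of_hasCompactSupport hc).restrict _
      exact h1.integrable_mul h2
    have e : ∫ x, φ x • ((fun x => G x i) - fun x => G' x i) x =
        ∫ x in Ω, (G x i * φ x - G' x i * φ x) := by
      rw [← integral_indicator hΩ.measurableSet]
      congr 1
      ext x
      by_cases hx : x ∈ Ω
      · simp [hx]; ring
      · have : φ x = 0 := image_eq_zero_of_notMem_tsupport fun h => hx (hs h)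
        simp [hx, this]
    refine e.trans ?_
    rw [integral_sub (i1 h.memLp_grad) (i1 h'.memLp_grad)]
    have e1 := h.partials i φ hφ hc hs
    have e2 := h'.partials i φ hφ hc hs
    linarith
  rw [ae_restrict_iff' hΩ.measurableSet]
  filter_upwards [ae_all_iff.2 key] with x hx hxΩ
  ext i
  exact sub_eq_zero.1 (hx i hxΩ)

lemma integrable_inner_of_memLp {α E : Type*} [MeasurableSpace α] {μ : Measure α}
    [NormedAddCommGroup E] [InnerProductSpace ℝ E] {f g : α → E} (hf : MemLp f 2 μ)
    (hg : MemLp g 2 μ) : Integrable (fun x => inner ℝ (f x) (g x)) μ := by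
  refine (hf.norm.integrable_mul hg.norm).mono' (hf.1.inner hg.1) (Eventually.of_forall fun x => ?_)
  exact norm_inner_le_norm _ _

lemma memLp_of_continuous {E : Type*} [NormedAddCommGroup E] {f : Eu d → E} (hf : Continuous f)
    {S : Set (Eu d)} (hS : MeasurableSet S) (hb : Bornology.IsBounded S) :
    MemLp f 2 (volume.restrict S) := by
  have : IsFiniteMeasure (volume.restrict S) :=
    ⟨by rw [Measure.restrict_apply_univ]; exact hb.measure_lt_top⟩
  obtain ⟨C, hC⟩ := hb.isCompact_closure.exists_bound_of_continuousOn hf.continuousOn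
  exact MemLp.of_bound (integrableOn_of_isBounded hf hb).aestronglyMeasurable C
    ((ae_restrict_mem hS).mono fun x hx => hC x (subset_closure hx))

namespace PolyMesh

variable {Ω : Set (Eu d)} (M : PolyMesh Ω)

open Classical in
/-- Sum of the normal components of `F` on the face `e`, over the cells that have the face `e`. -/
noncomputable def jump (F : M.Cell → Eu d → Eu d) (e : M.Face) (x : Eu d) : ℝ :=
  ∑ T, if M.Inc T e then inner ℝ (F T x) (M.normal T e) else 0

lemma continuous_jump {F : M.Cell → Eu d → Eu d} (hF : ∀ T, Continuous (F T)) (e : M.Face) :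
    Continuous (M.jump F e) := by
  unfold jump
  refine continuous_finsetSum _ fun T _ => ?_
  have := hF T
  split_ifs <;> fun_prop

lemma exists_bound_cell {E : Type*} [NormedAddCommGroup E] {F : Eu d → E} (hF : Continuous F)
    (T : M.Cell) : ∃ C, ∀ x ∈ M.cell T, ‖F x‖ ≤ C := by
  obtain ⟨C, hC⟩ := (M.cell_polyhedral T).isBounded.isCompact_closure.exists_bound_of_continuousOn
    hF.continuousOn
  exact ⟨C, fun x hx => hC x (subset_closure hx)⟩

lemma continuous_dvg {F : Eu d → Eu d} (hF : ContDiff ℝ 1 F) : Continuous (dvg F) := by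
  unfold dvg
  refine continuous_finsetSum _ fun i _ => ?_
  have : ContDiff ℝ 1 fun y => F y i := by fun_prop
  exact (this.continuous_fderiv one_ne_zero).clm_apply continuous_const

lemma continuous_gradient {f : Eu d → ℝ} (hf : ContDiff ℝ 1 f) : Continuous (gradient f) :=
  (InnerProductSpace.toDual ℝ (Eu d)).symm.continuous.comp (hf.continuous_fderiv one_ne_zero)

/-- In the piecewise Green formula the interior faces contribute nothing because the normal jumps
vanish, and the boundary faces because the test function does. -/
lemma integral_green_test (hΩ : IsOpen Ω) {F : M.Cell → Eu d → Eu d} (hF : ∀ T, ContDiff ℝ 1 (F T))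
    (hjump : ∀ e, M.face e ⊆ Ω → ∀ x ∈ M.face e, M.jump F e x = 0)
    {φ : Eu d → ℝ} (hφ : ContDiff ℝ ∞ φ) (hs : tsupport φ ⊆ Ω)
    {A : Eu d → Eu d} {g : Eu d → ℝ} (hA : ∀ T, ∀ x ∈ M.cell T, A x = F T x)
    (hg : ∀ T, ∀ x ∈ M.cell T, g x = dvg (F T) x) :
    ∫ x in Ω, (inner ℝ (A x) (gradient φ x) + g x * φ x) = 0 := by
  classical
  have hφ1 : ContDiff ℝ 1 φ := hφ.of_le (by exact_mod_cast le_top)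
  have hφc := hφ.continuous
  have hgc := continuous_gradient hφ1
  rw [M.integral_of_cells (H := fun T x => inner ℝ (F T x) (gradient φ x) + dvg (F T) x * φ x)
    (fun T x hx => by rw [hA T x hx, hg T x hx])
    (fun T => M.integrableOn_cell (by
      have := (hF T).continuous
      have := continuous_dvg (hF T)
      fun_prop) T), M.sum_integral_green hF hφ1]
  refine Finset.sum_eq_zero fun e _ => ?_
  rw [setIntegral_congr_fun (g := fun _ => (0 : ℝ)) (M.measurableSet_face e)]
  · simp
  intro x hx
  rcases M.face_position e with he | he
  · have := hjump e he x hx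
    unfold jump at this
    simp only [this, zero_mul]
  · have : x ∉ Ω := by
      have := (he hx).2
      rwa [hΩ.interior_eq] at this
    have : φ x = 0 := image_eq_zero_of_notMem_tsupport fun h => this (hs h)
    simp only [this, mul_zero]

/-- Continuity of the normal component across interior faces makes the cellwise divergence a weak
divergence; nothing is required at the boundary of `Ω`. -/
lemma hasWeakDiv_of_jump (hΩ : IsOpen Ω) (hb : Bornology.IsBounded Ω)
    {F : M.Cell → Eu d → Eu d} (hF : ∀ T, ContDiff ℝ 1 (F T))
    (hjump : ∀ e, M.face e ⊆ Ω → ∀ x ∈ M.face e, M.jump F e x = 0)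
    {A : Eu d → Eu d} {g : Eu d → ℝ} (hA : ∀ T, ∀ x ∈ M.cell T, A x = F T x)
    (hg : ∀ T, ∀ x ∈ M.cell T, g x = dvg (F T) x) : HasWeakDiv Ω A g := by
  have mA : MemLp A 2 (volume.restrict Ω) :=
    (memLp_congr_ae (M.ae_restrict_of_cells fun T x hx => by rw [hA T x hx, M.pw_eq F hx])).2
      (M.memLp_pw (fun T => (hF T).continuous) hb)
  have mg : MemLp g 2 (volume.restrict Ω) :=
    (memLp_congr_ae (M.ae_restrict_of_cells fun T x hx => by
      rw [hg T x hx, M.pw_eq (fun T => dvg (F T)) hx])).2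
      (M.memLp_pw (fun T => continuous_dvg (hF T)) hb)
  refine ⟨mA, mg, fun φ hφ hc hs => ?_⟩
  have h := M.integral_green_test hΩ hF hjump hφ hs hA hg
  have hφ1 : ContDiff ℝ 1 φ := hφ.of_le (by exact_mod_cast le_top)
  have m1 : MemLp φ 2 (volume.restrict Ω) :=
    (hφ.continuous.memLp_of_hasCompactSupport hc).restrict _
  have hcg : HasCompactSupport (gradient φ) := by
    have := (hc.fderiv (𝕜 := ℝ))
    exact this.comp_left (map_zero _)
  have m2 : MemLp (gradient φ) 2 (volume.restrict Ω) :=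
    ((continuous_gradient hφ1).memLp_of_hasCompactSupport hcg).restrict _
  have i1 : Integrable (fun x => inner ℝ (A x) (gradient φ x)) (volume.restrict Ω) :=
    integrable_inner_of_memLp mA m2
  have i2 : Integrable (fun x => g x * φ x) (volume.restrict Ω) := mg.integrable_mul m1
  rw [integral_add i1 i2] at h
  linarith

lemma jump_smul_const_eq_zero (hΩ : IsOpen Ω) {p : M.Cell → Eu d → ℝ} {e : M.Face}
    (he : M.face e ⊆ Ω) {x : Eu d}
    (hcont : ∀ T T', M.Inc T e → M.Inc T' e → p T x = p T' x) (v : Eu d) :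
    M.jump (fun T x => p T x • v) e x = 0 := by
  classical
  obtain ⟨T, hT⟩ := M.face_mem e
  obtain ⟨T', hne, hT'⟩ := M.exists_neighbour hΩ hT he
  unfold jump
  rw [M.sum_inc_interior hne hT hT']
  simp only [M.normal_eq_neg hne hT hT', hcont T T' hT hT', inner_neg_right]
  ring

/-- The `i`-th weak derivative is the weak divergence of the field `p e_i`, whose normal jumps
vanish because `p` is continuous across interior faces and the two normals are opposite. -/
lemma hasWeakGrad_of_continuous (hΩ : IsOpen Ω) (hb : Bornology.IsBounded Ω)
    {p : M.Cell → Eu d → ℝ} (hp : ∀ T, ContDiff ℝ 1 (p T))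
    (hcont : ∀ e, M.face e ⊆ Ω → ∀ T T', M.Inc T e → M.Inc T' e → ∀ x ∈ M.face e, p T x = p T' x) :
    HasWeakGrad Ω (M.pw p) (M.pw fun T => gradient (p T)) := by
  refine ⟨M.memLp_pw (fun T => (hp T).continuous) hb,
    M.memLp_pw (fun T => continuous_gradient (hp T)) hb, fun i φ hφ hc hs => ?_⟩
  have h := (M.hasWeakDiv_of_jump hΩ hb (F := fun T x => p T x • EuclideanSpace.single i (1 : ℝ))
    (fun T => (hp T).smul contDiff_const)
    (fun e he x hx => M.jump_smul_const_eq_zero hΩ he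
      (fun T T' h h' => hcont e he T T' h h' x hx) _)
    (A := fun x => M.pw p x • EuclideanSpace.single i (1 : ℝ))
    (g := fun x => (M.pw fun T => gradient (p T)) x i)
    (fun T x hx => by rw [M.pw_eq p hx])
    (fun T x hx => by
      rw [M.pw_eq _ hx, dvg_smul_const ((hp T).differentiable one_ne_zero),
        EuclideanSpace.inner_single_left]
      simp)).div φ hφ hc hs
  rw [← h]
  congr 1
  ext x
  rw [real_inner_smul_left, EuclideanSpace.inner_single_left, gradient_apply]
  simp

/-- Green's formula for a piecewise smooth flux with vanishing jumps, tested with a function that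
vanishes on `ΓD`. -/
theorem integral_flux_eq_zero (hΩ : IsOpen Ω) (hb : Bornology.IsBounded Ω) {ΓD : Set (Eu d)}
    {F : M.Cell → Eu d → Eu d} (hF : ∀ T, ContDiff ℝ 1 (F T))
    (hjump : ∀ e, ¬ M.face e ⊆ ΓD → ∀ x ∈ M.face e, M.jump F e x = 0)
    (hΓ : ΓD ⊆ frontier Ω)
    {A : Eu d → Eu d} {g : Eu d → ℝ} (hA : ∀ T, ∀ x ∈ M.cell T, A x = F T x)
    (hg : ∀ T, ∀ x ∈ M.cell T, g x = dvg (F T) x)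
    {v : Eu d → ℝ} {Gv : Eu d → Eu d} (hv : HasWeakGrad Ω v Gv) (hv0 : TraceZeroOn Ω ΓD v) :
    ∫ x in Ω, (inner ℝ (A x) (Gv x) + g x * v x) = 0 := by
  classical
  obtain ⟨t, ⟨G, hG, ht, φ, hφ, hφ1, hφ2, hφ3⟩, ht0⟩ := hv0
  have hfin : IsFiniteMeasure (volume.restrict Ω) :=
    ⟨by rw [Measure.restrict_apply_univ]; exact hb.measure_lt_top⟩
  have hφC : ∀ n, ContDiff ℝ 1 (φ n) := fun n => (hφ n).of_le (by exact_mod_cast le_top)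
  have hGv := hv.ae_eq hΩ hG
  have mA : MemLp A 2 (volume.restrict Ω) :=
    (memLp_congr_ae (M.ae_restrict_of_cells fun T x hx => by rw [hA T x hx, M.pw_eq F hx])).2
      (M.memLp_pw (fun T => (hF T).continuous) hb)
  have mg : MemLp g 2 (volume.restrict Ω) :=
    (memLp_congr_ae (M.ae_restrict_of_cells fun T x hx => by
      rw [hg T x hx, M.pw_eq (fun T => dvg (F T)) hx])).2
      (M.memLp_pw (fun T => continuous_dvg (hF T)) hb)
  obtain ⟨CA, hCA⟩ : ∃ C, ∀ T, ∀ x ∈ M.cell T, ‖A x‖ ≤ C := by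
    choose C hC using fun T => M.exists_bound_cell (hF T).continuous T
    refine ⟨∑ T, |C T|, fun T x hx => ?_⟩
    rw [hA T x hx]
    exact (hC T x hx).trans ((le_abs_self _).trans
      (Finset.single_le_sum (f := fun T => |C T|) (fun _ _ => abs_nonneg _) (Finset.mem_univ T)))
  obtain ⟨Cg, hCg⟩ : ∃ C, ∀ T, ∀ x ∈ M.cell T, ‖g x‖ ≤ C := by
    choose C hC using fun T => M.exists_bound_cell (continuous_dvg (hF T)) T
    refine ⟨∑ T, |C T|, fun T x hx => ?_⟩
    rw [hg T x hx]
    exact (hC T x hx).trans ((le_abs_self _).trans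
      (Finset.single_le_sum (f := fun T => |C T|) (fun _ _ => abs_nonneg _) (Finset.mem_univ T)))
  have mφ : ∀ n, MemLp (φ n) 2 (volume.restrict Ω) := fun n =>
    memLp_of_continuous (hφ n).continuous hΩ.measurableSet hb
  have mdφ : ∀ n, MemLp (gradient (φ n)) 2 (volume.restrict Ω) := fun n =>
    memLp_of_continuous (continuous_gradient (hφC n)) hΩ.measurableSet hb
  have lim1 : Tendsto (fun n => ∫ x in Ω, inner ℝ (A x) (gradient (φ n) x - G x)) atTop (𝓝 0) :=
    tendsto_integral_zero_of_eLpNorm (fun n => ((mdφ n).sub hG.memLp_grad).1) hφ2 CA fun n =>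
      M.ae_restrict_of_cells fun T x hx => (norm_inner_le_norm _ _).trans
        (mul_le_mul_of_nonneg_right (hCA T x hx) (norm_nonneg _))
  have lim2 : Tendsto (fun n => ∫ x in Ω, g x * (φ n x - v x)) atTop (𝓝 0) :=
    tendsto_integral_zero_of_eLpNorm (fun n => ((mφ n).sub hv.memLp).1) hφ1 Cg fun n =>
      M.ae_restrict_of_cells fun T x hx => by
        rw [norm_mul]; exact mul_le_mul_of_nonneg_right (hCg T x hx) (norm_nonneg _)
  -- Convergence of the traces is used on faces in `ΓD`, where the jump of the flux need not vanish.
  have lim3 : ∀ e, Tendsto (fun n => if M.face e ⊆ ΓD then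
      ∫ x in M.face e, M.jump F e x * (φ n x - t x) ∂(surf d) else 0) atTop (𝓝 0) := by
    intro e
    by_cases he : M.face e ⊆ ΓD
    · simp only [if_pos he]
      have hef : M.face e ⊆ frontier Ω := he.trans hΓ
      have hmono : (surf d).restrict (M.face e) ≤ (surf d).restrict (frontier Ω) :=
        Measure.restrict_mono hef le_rfl
      obtain ⟨C, hC⟩ := (M.isBounded_face e).isCompact_closure.exists_bound_of_continuousOn
        (M.continuous_jump (fun T => (hF T).continuous) e).continuousOn
      refine tendsto_integral_zero_of_eLpNorm (h := fun n x => φ n x - t x)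
        (fun n => (hφ n).continuous.aestronglyMeasurable.sub (ht.1.mono_measure hmono)) ?_ C
        fun n => ?_
      · exact tendsto_of_tendsto_of_tendsto_of_le_of_le tendsto_const_nhds hφ3
          (fun _ => zero_le) fun n => eLpNorm_mono_measure _ hmono
      · filter_upwards [ae_restrict_mem (M.measurableSet_face e)] with x hx
        rw [norm_mul]
        exact mul_le_mul_of_nonneg_right (hC x (subset_closure hx)) (norm_nonneg _)
    · simp only [if_neg he]; exact tendsto_const_nhds
  -- The left side does not depend on `n`, while each of the three terms on the right tends to zero.
  have hK : ∀ n, ∫ x in Ω, (inner ℝ (A x) (Gv x) + g x * v x) =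
      (∑ e, if M.face e ⊆ ΓD then
        ∫ x in M.face e, M.jump F e x * (φ n x - t x) ∂(surf d) else 0) -
      (∫ x in Ω, inner ℝ (A x) (gradient (φ n) x - G x)) - ∫ x in Ω, g x * (φ n x - v x) := by
    intro n
    have i1 : Integrable (fun x => inner ℝ (A x) (gradient (φ n) x - G x)) (volume.restrict Ω) :=
      integrable_inner_of_memLp mA ((mdφ n).sub hG.memLp_grad)
    have i2 : Integrable (fun x => g x * (φ n x - v x)) (volume.restrict Ω) :=
      mg.integrable_mul ((mφ n).sub hv.memLp)
    have i3 := integrable_inner_of_memLp mA hv.memLp_grad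
    have i4 : Integrable (fun x => g x * v x) (volume.restrict Ω) := mg.integrable_mul hv.memLp
    have e1 : ∫ x in Ω, (inner ℝ (A x) (gradient (φ n) x) + g x * φ n x) =
        ∑ e, if M.face e ⊆ ΓD then
          ∫ x in M.face e, M.jump F e x * (φ n x - t x) ∂(surf d) else 0 := by
      have hφc := (hφ n).continuous
      have hgc := continuous_gradient (hφC n)
      rw [M.integral_of_cells (H := fun T x => inner ℝ (F T x) (gradient (φ n) x) +
        dvg (F T) x * φ n x) (fun T x hx => by rw [hA T x hx, hg T x hx])
        (fun T => M.integrableOn_cell (by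
          have := (hF T).continuous
          have := continuous_dvg (hF T)
          fun_prop) T), M.sum_integral_green hF (hφC n)]
      refine Finset.sum_congr rfl fun e _ => ?_
      split_ifs with he
      · refine integral_congr_ae ?_
        filter_upwards [ae_restrict_mem (M.measurableSet_face e), ae_restrict_of_ae ht0]
          with x hx hx0
        -- `t` vanishes almost everywhere on `ΓD`, so subtracting it there changes nothing.
        rw [hx0 (he hx), sub_zero, jump]
      · rw [setIntegral_congr_fun (g := fun _ => (0 : ℝ)) (M.measurableSet_face e)]
        · simp
        intro x hx
        have := hjump e he x hx
        unfold jump at this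
        simp only [this, zero_mul]
    rw [← e1]
    have e2 : (∫ x in Ω, inner ℝ (A x) (gradient (φ n) x - G x)) + (∫ x in Ω, g x * (φ n x - v x))
        + ∫ x in Ω, (inner ℝ (A x) (Gv x) + g x * v x) =
        ∫ x in Ω, (inner ℝ (A x) (gradient (φ n) x) + g x * φ n x) := by
      have i12 : Integrable (fun x => inner ℝ (A x) (gradient (φ n) x - G x) +
        g x * (φ n x - v x)) (volume.restrict Ω) := i1.add i2
      have i34 : Integrable (fun x => inner ℝ (A x) (Gv x) + g x * v x) (volume.restrict Ω) :=
        i3.add i4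
      rw [← integral_add i1 i2, ← integral_add i12 i34]
      refine integral_congr_ae (hGv.mono fun x hx => ?_)
      simp only [hx, inner_sub_right]
      ring
    linarith
  have hlim := ((tendsto_finsetSum Finset.univ fun e _ => lim3 e).sub lim1).sub lim2
  simp only [← hK, Finset.sum_const_zero, sub_zero] at hlim
  exact tendsto_nhds_unique tendsto_const_nhds hlim

end PolyMesh
end PDWG

/-! ### Regularization of functions with bounded weak gradient -/

namespace PDWG

variable {d : ℕ}

/-! ### Mollification -/

/-- A sequence of bump functions with radii tending to zero. -/
noncomputable def bump (d n : ℕ) : ContDiffBump (0 : Eu d) where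
  rIn := 1 / (2 * ((n : ℝ) + 1))
  rOut := 1 / ((n : ℝ) + 1)
  rIn_pos := by positivity
  rIn_lt_rOut := by
    apply one_div_lt_one_div_of_lt <;> [positivity; linarith [(Nat.cast_nonneg n : (0 : ℝ) ≤ n)]]

lemma tendsto_bump_rOut (d : ℕ) : Tendsto (fun n => (bump d n).rOut) atTop (𝓝 0) :=
  tendsto_one_div_add_atTop_nhds_zero_nat

/-- The normalized mollifier. -/
noncomputable def molli (d n : ℕ) : Eu d → ℝ := (bump d n).normed volume

/-- Mollification. -/
noncomputable def moll (n : ℕ) (U : Eu d → ℝ) : Eu d → ℝ :=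
  convolution (molli d n) U (ContinuousLinearMap.lsmul ℝ ℝ) volume

lemma contDiff_molli (n : ℕ) : ContDiff ℝ ∞ (molli d n) := (bump d n).contDiff_normed

lemma hasCompactSupport_molli (n : ℕ) : HasCompactSupport (molli d n) :=
  (bump d n).hasCompactSupport_normed

lemma molli_nonneg (n : ℕ) (x : Eu d) : 0 ≤ molli d n x := (bump d n).nonneg_normed x

lemma moll_eq (n : ℕ) (U : Eu d → ℝ) (x : Eu d) : moll n U x = ∫ t, molli d n (x - t) * U t := by
  rw [moll, convolution_eq_swap]; rfl

lemma contDiff_moll {U : Eu d → ℝ} (hU : LocallyIntegrable U) (n : ℕ) :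
    ContDiff ℝ ∞ (moll n U) :=
  (hasCompactSupport_molli n).contDiff_convolution_left _ (contDiff_molli n) hU

lemma tsupport_molli_sub (n : ℕ) (x : Eu d) :
    tsupport (fun t => molli d n (x - t)) ⊆ Metric.closedBall x (bump d n).rOut := by
  refine closure_minimal (fun t ht => ?_) Metric.isClosed_closedBall
  have : x - t ∈ Function.support (molli d n) := ht
  rw [molli, ContDiffBump.support_normed_eq] at this
  rw [Metric.mem_closedBall, dist_comm, dist_eq_norm]
  simpa using (Metric.ball_subset_closedBall this)

/-- The derivative falls on the kernel, and `t ↦ ρ (x - t)` is a legitimate test function for the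
weak derivative on `O` once the ball around `x` that contains its support lies in `O`. -/
lemma pd_moll {U g : Eu d → ℝ} (hU : LocallyIntegrable U) {O : Set (Eu d)} {i : Fin d}
    (hg : HasWeakPartial O i U g) (n : ℕ) {x : Eu d}
    (hx : Metric.closedBall x (bump d n).rOut ⊆ O) : pd i (moll n U) x = moll n g x := by
  set ρ := molli d n with hρ
  have hρ1 : ContDiff ℝ 1 ρ := (contDiff_molli n).of_le (by exact_mod_cast le_top)
  have hs := (tsupport_molli_sub n x).trans hx
  have hder := (hasCompactSupport_molli (d := d) n).hasFDerivAt_convolution_right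
    (ContinuousLinearMap.lsmul ℝ ℝ : ℝ →L[ℝ] ℝ →L[ℝ] ℝ).flip hU hρ1 x
  rw [convolution_flip] at hder
  have hφ : ContDiff ℝ ∞ (fun t => ρ (x - t)) := (contDiff_molli n).comp (by fun_prop)
  have hφd : ∀ t v, fderiv ℝ (fun t => ρ (x - t)) t v = - fderiv ℝ ρ (x - t) v := by
    intro t v
    have h1 : HasFDerivAt (fun t => x - t) (-ContinuousLinearMap.id ℝ (Eu d)) t := by
      simpa using (hasFDerivAt_id t).const_sub x
    have h2 := ((hρ1.differentiable one_ne_zero (x - t)).hasFDerivAt).comp t h1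
    have h3 : fderiv ℝ (fun t => ρ (x - t)) t = _ := h2.fderiv
    rw [h3]; simp
  have hφc : HasCompactSupport (fun t => ρ (x - t)) :=
    (isCompact_closedBall x _).of_isClosed_subset (isClosed_tsupport _) (tsupport_molli_sub n x)
  have hw := hg _ hφ hφc hs
  -- Outside `O` the test function and its derivative are zero, so the integrals over `O` become
  -- integrals over the whole space, as a convolution requires.
  have hout : ∀ t, t ∉ O → ρ (x - t) = 0 ∧ pd i (fun t => ρ (x - t)) t = 0 := by
    intro t ht
    refine ⟨?_, ?_⟩
    · exact image_eq_zero_of_notMem_tsupport (f := fun t => ρ (x - t)) fun h => ht (hs h)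
    · have : fderiv ℝ (fun t => ρ (x - t)) t = 0 := by
        by_contra h
        exact ht (hs (support_fderiv_subset ℝ h))
      simp [pd, this]
  rw [setIntegral_eq_integral_of_forall_compl_eq_zero (fun t ht => by rw [(hout t ht).2, mul_zero]),
    setIntegral_eq_integral_of_forall_compl_eq_zero (fun t ht => by rw [(hout t ht).1, mul_zero])]
    at hw
  have hfd : pd i (moll n U) x = ∫ t, U t * fderiv ℝ ρ (x - t) (EuclideanSpace.single i 1) := by
    rw [pd, moll, hder.fderiv, convolution_precompR_apply _ hU
      ((hasCompactSupport_molli n).fderiv (𝕜 := ℝ)) (hρ1.continuous_fderiv one_ne_zero)]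
    rw [convolution_def]
    refine integral_congr_ae (Eventually.of_forall fun t => ?_)
    simp [mul_comm, hρ]
  rw [hfd, moll_eq]
  simp only [pd, hφd, mul_neg] at hw
  rw [integral_neg, neg_inj] at hw
  rw [hw]
  refine integral_congr_ae (Eventually.of_forall fun t => ?_)
  simp [mul_comm, hρ]

lemma abs_moll_le {g : Eu d → ℝ} {L : ℝ} (hg : ∀ x, |g x| ≤ L) (n : ℕ) (x : Eu d) :
    |moll n g x| ≤ L := by
  rw [moll, convolution_def]
  have hi : Integrable (fun t => molli d n t * L) :=
    ((contDiff_molli n).continuous.integrable_of_hasCompactSupport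
      (hasCompactSupport_molli n)).mul_const L
  have h1 : ‖∫ t, (ContinuousLinearMap.lsmul ℝ ℝ (molli d n t)) (g (x - t))‖ ≤
      ∫ t, molli d n t * L := by
    refine norm_integral_le_of_norm_le hi (Eventually.of_forall fun t => ?_)
    simp only [ContinuousLinearMap.lsmul_apply, smul_eq_mul, norm_mul, Real.norm_eq_abs,
      abs_of_nonneg (molli_nonneg n t)]
    exact mul_le_mul_of_nonneg_left (hg _) (molli_nonneg n t)
  rw [integral_mul_const] at h1
  have : ∫ t, molli d n t = 1 := (bump d n).integral_normed
  rwa [this, one_mul] at h1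

lemma tendsto_moll {g : Eu d → ℝ} (hg : AEStronglyMeasurable g) {x : Eu d}
    (hx : ContinuousAt g x) : Tendsto (fun n => moll n g x) atTop (𝓝 (g x)) := by
  rw [Metric.tendsto_atTop]
  intro ε hε
  obtain ⟨δ, hδ, h⟩ := Metric.continuousAt_iff.1 hx (ε / 2) (half_pos hε)
  obtain ⟨N, hN⟩ := eventually_atTop.1
    ((tendsto_bump_rOut d).eventually_lt_const hδ)
  refine ⟨N, fun n hn => ?_⟩
  refine lt_of_le_of_lt ((bump d n).dist_normed_convolution_le hg fun y hy => ?_) (half_lt_self hε)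
  exact (h (lt_trans hy (hN n hn))).le

lemma lipschitzWith_moll {U : Eu d → ℝ} {K : ℝ≥0} (hU : LipschitzWith K U) (n : ℕ) :
    LipschitzWith K (moll n U) := by
  refine LipschitzWith.of_dist_le_mul fun x y => ?_
  have ci : ∀ z, Integrable (fun t => molli d n t * U (z - t)) := by
    intro z
    have := (hasCompactSupport_molli (d := d) n).convolutionExists_left
      (ContinuousLinearMap.lsmul ℝ ℝ : ℝ →L[ℝ] ℝ →L[ℝ] ℝ) (contDiff_molli n).continuous
      (hU.continuous.locallyIntegrable (μ := volume)) z
    exact this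
  have e : ∀ z, moll n U z = ∫ t, molli d n t * U (z - t) := fun z => rfl
  rw [Real.dist_eq, e, e, ← integral_sub (ci x) (ci y)]
  have hi : Integrable (fun t => molli d n t * (K * dist x y)) :=
    ((contDiff_molli n).continuous.integrable_of_hasCompactSupport
      (hasCompactSupport_molli n)).mul_const _
  have h1 : ‖∫ t, (molli d n t * U (x - t) - molli d n t * U (y - t))‖ ≤
      ∫ t, molli d n t * (K * dist x y) := by
    refine norm_integral_le_of_norm_le hi (Eventually.of_forall fun t => ?_)
    rw [← mul_sub, norm_mul, Real.norm_eq_abs, abs_of_nonneg (molli_nonneg n t)]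
    refine mul_le_mul_of_nonneg_left ?_ (molli_nonneg n t)
    have := hU.dist_le_mul (x - t) (y - t)
    rwa [dist_sub_right] at this
  rw [integral_mul_const] at h1
  have : ∫ t, molli d n t = 1 := (bump d n).integral_normed
  rwa [this, one_mul] at h1

lemma norm_fderiv_le_of_pd {f : Eu d → ℝ} {x : Eu d} {L : ℝ}
    (h : ∀ i, |pd i f x| ≤ L) : ‖fderiv ℝ f x‖ ≤ d * L := by
  have hn : ‖fderiv ℝ f x‖ = ‖gradient f x‖ := by
    rw [gradient, LinearIsometryEquiv.norm_map]
  rw [hn]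
  have : gradient f x = ∑ i, pd i f x • EuclideanSpace.single i (1 : ℝ) := by
    ext j
    simp [gradient_apply, Finset.sum_apply, Pi.single_apply]
  rw [this]
  refine (norm_sum_le _ _).trans ?_
  calc ∑ i, ‖pd i f x • EuclideanSpace.single i (1 : ℝ)‖ ≤ ∑ _i : Fin d, L := by
        refine Finset.sum_le_sum fun i _ => ?_
        rw [norm_smul]; simpa using h i
    _ = d * L := by simp

/-- A function with bounded weak gradient is Lipschitz along segments, at points of continuity. -/
lemma eventually_abs_moll_sub_le {W : Eu d → ℝ} {G : Eu d → Eu d} (hW : LocallyIntegrable W)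
    {O : Set (Eu d)} (hO : IsOpen O) (hG : ∀ i, HasWeakPartial O i W (fun x => G x i)) {L : ℝ}
    (hL : ∀ x i, |G x i| ≤ L) {p q : Eu d} (hseg : segment ℝ p q ⊆ O) :
    ∀ᶠ n in atTop, |moll n W p - moll n W q| ≤ d * L * ‖p - q‖ := by
  have hc : IsCompact (segment ℝ p q) := by
    rw [segment_eq_image]
    exact isCompact_Icc.image (by fun_prop)
  -- By compactness a whole neighbourhood of the segment lies in `O`, so for large `n` the
  -- derivative of the mollification is controlled at every point of the segment and the mean value
  -- inequality applies.
  obtain ⟨δ, hδ, hthick⟩ := hc.exists_cthickening_subset_open hO hseg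
  filter_upwards [(tendsto_bump_rOut d).eventually_lt_const hδ] with n hn
  have hdiff : Differentiable ℝ (moll n W) := (contDiff_moll hW n).differentiable (by simp)
  have := (convex_segment p q).norm_image_sub_le_of_norm_hasFDerivWithin_le (𝕜 := ℝ)
    (f := moll n W) (C := d * L) (f' := fderiv ℝ (moll n W))
    (fun x _ => (hdiff x).hasFDerivAt.hasFDerivWithinAt) (fun x hx => ?_)
    (right_mem_segment ℝ p q) (left_mem_segment ℝ p q)
  · simpa using this
  · apply norm_fderiv_le_of_pd
    intro i
    rw [pd_moll hW (hG i) n]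
    · exact abs_moll_le (fun y => hL y i) n x
    · refine Subset.trans ?_ hthick
      intro y hy
      exact Metric.mem_cthickening_of_dist_le y x δ _ hx ((Metric.mem_closedBall.1 hy).trans hn.le)

lemma tendsto_eLpNorm_two_zero {α E : Type*} [MeasurableSpace α] {μ : Measure α}
    [IsFiniteMeasure μ] [NormedAddCommGroup E] {h : ℕ → α → E} {C : ℝ}
    (hm : ∀ n, AEStronglyMeasurable (h n) μ) (hb : ∀ n, ∀ᵐ x ∂μ, ‖h n x‖ ≤ C)
    (hlim : ∀ᵐ x ∂μ, Tendsto (fun n => h n x) atTop (𝓝 0)) :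
    Tendsto (fun n => eLpNorm (h n) 2 μ) atTop (𝓝 0) := by
  have h2 : ∀ n, eLpNorm (h n) 2 μ = (∫⁻ x, ‖h n x‖ₑ ^ (2 : ℝ) ∂μ) ^ (1 / 2 : ℝ) := by
    intro n
    rw [eLpNorm_eq_lintegral_rpow_enorm_toReal two_ne_zero ENNReal.ofNat_ne_top]
    simp
  simp only [h2]
  have : Tendsto (fun n => ∫⁻ x, ‖h n x‖ₑ ^ (2 : ℝ) ∂μ) atTop (𝓝 (∫⁻ _, 0 ∂μ)) := by
    refine tendsto_lintegral_of_dominated_convergence' (fun _ => ENNReal.ofReal C ^ (2 : ℝ))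
      (fun n => (hm n).enorm.pow_const _) (fun n => ?_) ?_ ?_
    · filter_upwards [hb n] with x hx
      rw [← ofReal_norm]
      gcongr
    · rw [lintegral_const]
      exact ENNReal.mul_ne_top (ENNReal.rpow_ne_top_of_nonneg (by norm_num) ENNReal.ofReal_ne_top)
        (measure_ne_top μ _)
    · filter_upwards [hlim] with x hx
      have h1 := (continuous_enorm.tendsto (0 : E)).comp hx
      have h3 := ((ENNReal.continuous_rpow_const (y := (2 : ℝ))).tendsto _).comp h1
      simpa [Function.comp_def] using h3
  rw [lintegral_zero] at this
  have h3 := ((ENNReal.continuous_rpow_const (y := (1 / 2 : ℝ))).tendsto _).comp this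
  simpa [Function.comp_def] using h3

end PDWG

/-! ### Lipschitz continuity up to the boundary, and traces -/

namespace PDWG

variable {d : ℕ}

section Lipschitz

variable {Ω D : Set (Eu d)} {W : Eu d → ℝ} {G : Eu d → Eu d} {L : ℝ}

/-- The estimate holds for the mollifications and passes to the limit. Continuity of `W` is required
at the two ends only, so the path in between may run along faces of the mesh. -/
lemma abs_sub_le_of_chain (hΩ : IsOpen Ω) (hW : LocallyIntegrable W)
    (hG : ∀ i, HasWeakPartial Ω i W (fun x => G x i)) (hL : ∀ x i, |G x i| ≤ L)
    {x x' y' y : Eu d} (hx : ContinuousAt W x) (hy : ContinuousAt W y)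
    (h1 : segment ℝ x x' ⊆ Ω) (h2 : segment ℝ x' y' ⊆ Ω) (h3 : segment ℝ y' y ⊆ Ω) :
    |W x - W y| ≤ d * L * (‖x - x'‖ + ‖x' - y'‖ + ‖y' - y‖) := by
  have hm := hW.aestronglyMeasurable
  have ht : Tendsto (fun n => |moll n W x - moll n W y|) atTop (𝓝 |W x - W y|) :=
    ((tendsto_moll hm hx).sub (tendsto_moll hm hy)).abs
  refine le_of_tendsto ht ?_
  filter_upwards [eventually_abs_moll_sub_le hW hΩ hG hL h1,
    eventually_abs_moll_sub_le hW hΩ hG hL h2, eventually_abs_moll_sub_le hW hΩ hG hL h3]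
    with n e1 e2 e3
  have := abs_sub_le (moll n W x) (moll n W x') (moll n W y)
  have := abs_sub_le (moll n W x') (moll n W y') (moll n W y)
  linarith

/-- In the interior a segment joins the two points. Near a boundary point the path goes up along `ν`
by `t`, across, and down again; the boundary being a Lipschitz graph, a `t` proportional to `‖x -
y‖` keeps it in `Ω`, and its length stays comparable with `‖x - y‖`. -/
lemma exists_local_lipschitz (hΩ : IsOpen Ω) (hLip : HasLipschitzBoundary Ω)
    (hW : LocallyIntegrable W) (hG : ∀ i, HasWeakPartial Ω i W (fun x => G x i))
    (hL : ∀ x i, |G x i| ≤ L) (hD : D ⊆ Ω) (hc : ∀ x ∈ D, ContinuousAt W x)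
    {x₀ : Eu d} (hx₀ : x₀ ∈ closure Ω) :
    ∃ C : ℝ, ∃ r > 0, ∀ x ∈ D ∩ Metric.ball x₀ r, ∀ y ∈ D ∩ Metric.ball x₀ r,
      |W x - W y| ≤ C * ‖x - y‖ := by
  by_cases hin : x₀ ∈ Ω
  · obtain ⟨r, hr, hball⟩ := Metric.isOpen_iff.1 hΩ x₀ hin
    refine ⟨d * L, r, hr, fun x hx y hy => ?_⟩
    have hs : segment ℝ x y ⊆ Ω := ((convex_ball x₀ r).segment_subset hx.2 hy.2).trans hball
    have := abs_sub_le_of_chain hΩ hW hG hL (x' := x) (y' := y) (hc x hx.1) (hc y hy.1)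
      (by rw [segment_same]; exact singleton_subset_iff.2 (hD hx.1)) hs
      (by rw [segment_same]; exact singleton_subset_iff.2 (hD hy.1))
    simpa using this
  · have hfr : x₀ ∈ frontier Ω := ⟨hx₀, by rwa [hΩ.interior_eq]⟩
    obtain ⟨ν, hν, U, hU, hxU, K, ζ, hζ, hgraph⟩ := hLip x₀ hfr
    obtain ⟨r₀, hr₀, hball⟩ := Metric.isOpen_iff.1 hU x₀ hxU
    have hK : (0 : ℝ) ≤ K := K.2
    have hνν : inner ℝ ν ν = (1 : ℝ) := by rw [real_inner_self_eq_norm_sq, hν]; norm_num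
    -- A point of the small ball raised by at most `t` has distance less than `r + (4K + 2) r` from
    -- `x₀`, which is below `r₀`.
    set r := r₀ / (4 * K + 4) with hr
    have hrpos : 0 < r := by positivity
    have hr' : (4 * K + 4) * r = r₀ := by rw [hr]; field_simp
    refine ⟨d * L * (4 * K + 3), r, hrpos, fun x hx y hy => ?_⟩
    -- From `x` to a point of the segment towards `y` the graph rises by at most `2K ‖x - y‖` and
    -- the height of the point falls by at most `‖x - y‖`; `t` is the sum. The path has length `2t +
    -- ‖x - y‖ = (4K + 3) ‖x - y‖`.
    set t := (2 * K + 1) * ‖x - y‖ with ht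
    have ht0 : 0 ≤ t := by positivity
    have hxy : ‖x - y‖ < 2 * r := by
      have h1 : dist x x₀ < r := hx.2
      have h2 : dist y x₀ < r := hy.2
      rw [← dist_eq_norm]
      linarith [dist_triangle_right x y x₀]
    have htr : t < (4 * K + 3) * r - r := by
      have : t < (2 * K + 1) * (2 * r) := mul_lt_mul_of_pos_left hxy (by positivity)
      linarith
    have hnear : ∀ z ∈ Metric.ball x₀ r, ∀ s ∈ Icc 0 t, z + s • ν ∈ U := by
      intro z hz s hs
      apply hball
      rw [Metric.mem_ball, dist_eq_norm]
      have h1 : ‖z - x₀‖ < r := by rw [← dist_eq_norm]; exact hz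
      calc ‖z + s • ν - x₀‖ = ‖(z - x₀) + s • ν‖ := by congr 1; abel
        _ ≤ ‖z - x₀‖ + ‖s • ν‖ := norm_add_le _ _
        _ = ‖z - x₀‖ + s := by rw [norm_smul, hν, mul_one, Real.norm_of_nonneg hs.1]
        _ < r₀ := by nlinarith [hs.2]
    have hproj : ∀ (z : Eu d) (s : ℝ), z + s • ν - (inner ℝ ν (z + s • ν) : ℝ) • ν =
        z - (inner ℝ ν z : ℝ) • ν := by
      intro z s
      rw [inner_add_right, inner_smul_right, hνν]
      module
    have hself : ∀ z ∈ Metric.ball x₀ r, z ∈ Ω → ζ (z - (inner ℝ ν z : ℝ) • ν) < inner ℝ ν z := by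
      intro z hz hzΩ
      exact (hgraph z (by simpa using hnear z hz 0 ⟨le_rfl, ht0⟩)).1 hzΩ
    have hup : ∀ z ∈ D ∩ Metric.ball x₀ r, ∀ s ∈ Icc 0 t, z + s • ν ∈ Ω := by
      intro z hz s hs
      rw [hgraph _ (hnear z hz.2 s hs), hproj, inner_add_right, inner_smul_right, hνν]
      have := hself z hz.2 (hD hz.1)
      linarith [hs.1]
    have hvert : ∀ z ∈ D ∩ Metric.ball x₀ r, segment ℝ z (z + t • ν) ⊆ Ω := by
      intro z hz w hw
      rw [segment_eq_image'] at hw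
      obtain ⟨θ, hθ, rfl⟩ := hw
      have : z + θ • (z + t • ν - z) = z + (θ * t) • ν := by module
      simp only [this]
      exact hup z hz _ ⟨mul_nonneg hθ.1 ht0, mul_le_of_le_one_left ht0 hθ.2⟩
    have hmid : segment ℝ (x + t • ν) (y + t • ν) ⊆ Ω := by
      intro w hw
      rw [segment_eq_image'] at hw
      obtain ⟨θ, hθ, rfl⟩ := hw
      have hzt : ∀ z : Eu d, (inner ℝ ν (z + t • ν) : ℝ) = inner ℝ ν z + t := by
        intro z
        rw [inner_add_right, inner_smul_right, hνν, mul_one]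
      set z := x + θ • (y - x) with hz
      have hzeq : x + t • ν + θ • (y + t • ν - (x + t • ν)) = z + t • ν := by rw [hz]; module
      have hzb : z ∈ Metric.ball x₀ r :=
        (convex_ball x₀ r).segment_subset hx.2 hy.2 (by
          rw [segment_eq_image']; exact ⟨θ, hθ, rfl⟩)
      simp only [hzeq]
      rw [hgraph _ (hnear z hzb t ⟨ht0, le_rfl⟩), hproj, hzt]
      have hyx : ‖y - x‖ = ‖x - y‖ := norm_sub_rev _ _
      have hin : |inner ℝ ν (y - x)| ≤ ‖x - y‖ := by
        have := abs_real_inner_le_norm ν (y - x)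
        rwa [hν, one_mul, hyx] at this
      have h1 : ζ (z - (inner ℝ ν z : ℝ) • ν) ≤ ζ (x - (inner ℝ ν x : ℝ) • ν) +
          K * (2 * ‖x - y‖) := by
        have h2 := hζ.dist_le_mul (z - (inner ℝ ν z : ℝ) • ν) (x - (inner ℝ ν x : ℝ) • ν)
        have h3 : dist (z - (inner ℝ ν z : ℝ) • ν) (x - (inner ℝ ν x : ℝ) • ν) ≤ 2 * ‖x - y‖ := by
          rw [dist_eq_norm]
          have : z - (inner ℝ ν z : ℝ) • ν - (x - (inner ℝ ν x : ℝ) • ν) =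
              θ • ((y - x) - (inner ℝ ν (y - x) : ℝ) • ν) := by
            rw [hz, inner_add_right, inner_smul_right]; module
          rw [this, norm_smul, Real.norm_of_nonneg hθ.1]
          have h4 : ‖(y - x) - (inner ℝ ν (y - x) : ℝ) • ν‖ ≤ 2 * ‖x - y‖ := by
            refine (norm_sub_le _ _).trans ?_
            rw [norm_smul, hν, mul_one, Real.norm_eq_abs, hyx]
            linarith
          exact (mul_le_of_le_one_left (norm_nonneg _) hθ.2).trans h4
        have h5 := (Real.dist_eq _ _ ▸ h2).trans (mul_le_mul_of_nonneg_left h3 hK)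
        linarith [le_abs_self (ζ (z - (inner ℝ ν z : ℝ) • ν) - ζ (x - (inner ℝ ν x : ℝ) • ν))]
      have h2 := hself x hx.2 (hD hx.1)
      have h3 : (inner ℝ ν x : ℝ) - ‖x - y‖ ≤ inner ℝ ν z := by
        rw [hz, inner_add_right, inner_smul_right]
        have h4 : |θ * inner ℝ ν (y - x)| ≤ ‖x - y‖ := by
          rw [abs_mul, abs_of_nonneg hθ.1]
          exact (mul_le_of_le_one_left (abs_nonneg _) hθ.2).trans hin
        linarith [neg_abs_le (θ * inner ℝ ν (y - x))]
      have : t = 2 * K * ‖x - y‖ + ‖x - y‖ := by rw [ht]; ring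
      linarith
    have := abs_sub_le_of_chain hΩ hW hG hL (hc x hx.1) (hc y hy.1) (hvert x hx) hmid
      (by rw [segment_symm]; exact hvert y hy)
    refine this.trans (le_of_eq ?_)
    have e1 : ‖x - (x + t • ν)‖ = t := by
      rw [sub_add_cancel_left, norm_neg, norm_smul, hν, mul_one, Real.norm_of_nonneg ht0]
    have e2 : ‖y + t • ν - y‖ = t := by
      rw [add_sub_cancel_left, norm_smul, hν, mul_one, Real.norm_of_nonneg ht0]
    rw [e1, e2, add_sub_add_right_eq_sub, ht]
    ring

/-- Pairs closer than a Lebesgue number `δ` of the cover by good balls share a local constant; for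
all other pairs `|W x - W y| ≤ 2B ≤ (2B / δ) ‖x - y‖`. -/
lemma exists_lipschitzOnWith (hΩ : IsOpen Ω) (hb : Bornology.IsBounded Ω)
    (hLip : HasLipschitzBoundary Ω) (hW : LocallyIntegrable W)
    (hG : ∀ i, HasWeakPartial Ω i W (fun x => G x i)) (hL : ∀ x i, |G x i| ≤ L)
    (hD : D ⊆ Ω) (hc : ∀ x ∈ D, ContinuousAt W x) {B : ℝ} (hB : ∀ x, |W x| ≤ B) :
    ∃ K : ℝ≥0, LipschitzOnWith K W D := by
  choose! C r hr hloc using fun x₀ (hx₀ : x₀ ∈ closure Ω) =>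
    exists_local_lipschitz hΩ hLip hW hG hL hD hc hx₀
  obtain ⟨t, ht, hcov⟩ := hb.isCompact_closure.elim_nhds_subcover
    (fun x => Metric.ball x (r x)) (fun x hx => Metric.ball_mem_nhds x (hr x hx))
  obtain ⟨δ, hδ, hleb⟩ := lebesgue_number_lemma_of_metric (ι := t)
    (c := fun x => Metric.ball (x : Eu d) (r x)) hb.isCompact_closure
    (fun _ => Metric.isOpen_ball) (by simpa [iUnion_subtype] using hcov)
  have hB0 : 0 ≤ B := (abs_nonneg _).trans (hB 0)
  set K : ℝ := ∑ x ∈ t, |C x| + 2 * B / δ with hK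
  have hsum : 0 ≤ ∑ x ∈ t, |C x| := Finset.sum_nonneg fun _ _ => abs_nonneg _
  have hK0 : 0 ≤ K := by positivity
  refine ⟨⟨K, hK0⟩, LipschitzOnWith.of_dist_le_mul fun x hx y hy => ?_⟩
  rw [Real.dist_eq, dist_eq_norm]
  change |W x - W y| ≤ K * ‖x - y‖
  by_cases hxy : ‖x - y‖ < δ
  · obtain ⟨i, hi⟩ := hleb x (subset_closure (hD hx))
    have h1 := hloc i (ht i i.2) x ⟨hx, hi (Metric.mem_ball_self hδ)⟩ y
      ⟨hy, hi (by rw [Metric.mem_ball, dist_comm, dist_eq_norm]; exact hxy)⟩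
    refine h1.trans (mul_le_mul_of_nonneg_right ?_ (norm_nonneg _))
    have h2 : |C i| ≤ ∑ x ∈ t, |C x| :=
      Finset.single_le_sum (f := fun x => |C x|) (fun _ _ => abs_nonneg _) i.2
    have : 0 ≤ 2 * B / δ := by positivity
    linarith [le_abs_self (C i)]
  · have h1 : |W x - W y| ≤ 2 * B := by
      have := abs_sub (W x) (W y)
      linarith [hB x, hB y]
    have h2 : 2 * B ≤ 2 * B / δ * ‖x - y‖ := by
      rw [div_mul_eq_mul_div, le_div_iff₀ hδ]
      exact mul_le_mul_of_nonneg_left (not_lt.1 hxy) (by positivity)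
    have h3 : 2 * B / δ * ‖x - y‖ ≤ K * ‖x - y‖ :=
      mul_le_mul_of_nonneg_right (by linarith) (norm_nonneg _)
    linarith

end Lipschitz

namespace PolyMesh

variable {Ω : Set (Eu d)} (M : PolyMesh Ω)

lemma exists_bound_pw {E : Type*} [NormedAddCommGroup E] {F : M.Cell → Eu d → E}
    (hF : ∀ T, Continuous (F T)) : ∃ C, ∀ x, ‖M.pw F x‖ ≤ C := by
  choose C hC using fun T => M.exists_bound_cell (hF T) T
  refine ⟨∑ T, |C T|, fun x => ?_⟩
  by_cases h : ∃ T, x ∈ M.cell T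
  · obtain ⟨T, hT⟩ := h
    rw [M.pw_eq F hT]
    exact (hC T x hT).trans ((le_abs_self _).trans
      (Finset.single_le_sum (f := fun T => |C T|) (fun _ _ => abs_nonneg _) (Finset.mem_univ T)))
  · rw [pw, dif_neg h, norm_zero]
    exact Finset.sum_nonneg fun _ _ => abs_nonneg _

lemma pw_eventuallyEq {α : Type*} [Zero α] (F : M.Cell → Eu d → α) {T : M.Cell} {x : Eu d}
    (hx : x ∈ M.cell T) : M.pw F =ᶠ[𝓝 x] F T :=
  Filter.eventually_of_mem ((M.cell_polyhedral T).isOpen.mem_nhds hx) fun _ hy => M.pw_eq F hy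

lemma measurable_pw {F : M.Cell → Eu d → ℝ} (hF : ∀ T, Continuous (F T)) :
    Measurable (M.pw F) := by
  classical
  have : M.pw F = fun x => ∑ T, (M.cell T).indicator (F T) x := by
    ext x
    by_cases h : ∃ T, x ∈ M.cell T
    · obtain ⟨T, hT⟩ := h
      rw [M.pw_eq F hT, Finset.sum_eq_single T]
      · rw [indicator_of_mem hT]
      · intro T' _ hne
        exact indicator_of_notMem (fun h' => disjoint_left.1 (M.cell_disjoint T' T hne) h' hT) _
      · exact fun h => absurd (Finset.mem_univ T) h
    · rw [pw, dif_neg h, Finset.sum_eq_zero]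
      intro T _
      exact indicator_of_notMem (fun h' => h ⟨T, h'⟩) _
  rw [this]
  exact Finset.measurable_fun_sum _ fun T _ =>
    (hF T).measurable.indicator (M.measurableSet_cell T)

lemma frontier_subset_iUnion (hΩ : IsOpen Ω) : frontier Ω ⊆ ⋃ T, frontier (M.cell T) := by
  intro x hx
  have hcl : closure Ω ⊆ ⋃ T, closure (M.cell T) :=
    closure_minimal M.cover (isClosed_iUnion_of_finite fun T => isClosed_closure)
  obtain ⟨T, hT⟩ := mem_iUnion.1 (hcl hx.1)
  refine mem_iUnion.2 ⟨T, hT, ?_⟩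
  rw [(M.cell_polyhedral T).isOpen.interior_eq]
  intro h
  exact hx.2 (by rw [hΩ.interior_eq]; exact M.cell_subset T h)

/-- The frontier is covered by finitely many faces, each of finite measure, and null sets.
Finiteness is needed for dominated convergence on the boundary. -/
lemma surf_frontier_lt_top (M : PolyMesh Ω) (hΩ : IsOpen Ω) : surf d (frontier Ω) < ⊤ := by
  have hsub : frontier Ω ⊆ ⋃ T, ((frontier (M.cell T) \ ⋃ e, M.face e) ∪ ⋃ e, M.face e) := by
    refine (M.frontier_subset_iUnion hΩ).trans (iUnion_mono fun T => ?_)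
    rw [sdiff_union_self]; exact subset_union_left
  refine (measure_mono hsub).trans_lt ?_
  refine (measure_iUnion_fintype_le _ _).trans_lt (ENNReal.sum_lt_top.2 fun T _ => ?_)
  refine (measure_union_le _ _).trans_lt ?_
  rw [M.frontier_cover T, zero_add]
  exact (measure_iUnion_fintype_le _ _).trans_lt
    (ENNReal.sum_lt_top.2 fun e _ => M.surf_face_lt_top e)

lemma ae_mem_face (hΩ : IsOpen Ω) : ∀ᵐ x ∂(surf d), x ∈ frontier Ω → ∃ e, x ∈ M.face e := by
  have : ∀ᵐ x ∂(surf d), ∀ T, x ∉ frontier (M.cell T) \ ⋃ e, M.face e := by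
    rw [ae_all_iff]
    exact fun T => measure_eq_zero_iff_ae_notMem.1 (M.frontier_cover T)
  filter_upwards [this] with x hx hxf
  obtain ⟨T, hT⟩ := mem_iUnion.1 (M.frontier_subset_iUnion hΩ hxf)
  by_contra hno
  exact hx T ⟨hT, by simpa using hno⟩

/-- A continuous piecewise smooth function that vanishes on `ΓD` has zero trace on `ΓD`. -/
theorem traceZeroOn_of_continuous (hΩ : IsOpen Ω) (hb : Bornology.IsBounded Ω)
    (hLip : HasLipschitzBoundary Ω) {ΓD ΓN : Set (Eu d)} (hΓ : M.IsBoundaryPartition ΓD ΓN)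
    {p : M.Cell → Eu d → ℝ} (hp : ∀ T, ContDiff ℝ 1 (p T))
    (hcont : ∀ e, M.face e ⊆ Ω → ∀ T T', M.Inc T e → M.Inc T' e → ∀ x ∈ M.face e, p T x = p T' x)
    (hzero : ∀ e, M.face e ⊆ ΓD → ∀ T, M.Inc T e → ∀ x ∈ M.face e, p T x = 0) :
    TraceZeroOn Ω ΓD (M.pw p) := by
  set W := M.pw p with hWdef
  set G := M.pw fun T => gradient (p T) with hGdef
  have hpc : ∀ T, Continuous (p T) := fun T => (hp T).continuous
  have hgc : ∀ T, Continuous (gradient (p T)) := fun T => continuous_gradient (hp T)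
  have hgrad : HasWeakGrad Ω W G := M.hasWeakGrad_of_continuous hΩ hb hp hcont
  have hfin : IsFiniteMeasure (volume.restrict Ω) :=
    ⟨by rw [Measure.restrict_apply_univ]; exact hb.measure_lt_top⟩
  have hfin' : IsFiniteMeasure ((surf d).restrict (frontier Ω)) :=
    ⟨by rw [Measure.restrict_apply_univ]; exact M.surf_frontier_lt_top hΩ⟩
  obtain ⟨L, hL⟩ := M.exists_bound_pw hgc
  obtain ⟨B, hB⟩ := M.exists_bound_pw hpc
  have hWli : LocallyIntegrable W := by
    refine (locallyIntegrable_const B).mono (M.measurable_pw hpc).aestronglyMeasurable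
      (Eventually.of_forall fun x => ?_)
    exact (hB x).trans (le_abs_self B)
  have hLi : ∀ x i, |G x i| ≤ L := fun x i => (PiLp.norm_apply_le (G x) i).trans (hL x)
  have hcontW : ∀ x ∈ ⋃ T, M.cell T, ContinuousAt W x := by
    intro x hx
    obtain ⟨T, hT⟩ := mem_iUnion.1 hx
    exact ((hpc T).continuousAt).congr (M.pw_eventuallyEq p hT).symm
  obtain ⟨K, hK⟩ := exists_lipschitzOnWith hΩ hb hLip hWli hgrad.partials hLi
    (iUnion_subset M.cell_subset) hcontW (B := B) hB
  -- The Lipschitz extension `V` agrees with `p T` on the closure of each cell. It serves as the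
  -- trace and also as the function to be mollified.
  obtain ⟨V, hV, hVW⟩ := hK.extend_real
  have hVp : ∀ T, ∀ x ∈ closure (M.cell T), V x = p T x := by
    intro T x hx
    have hcl : IsClosed {x | V x = p T x} := isClosed_eq hV.continuous (hpc T)
    refine closure_minimal (fun y hy => ?_) hcl hx
    exact (hVW (mem_iUnion.2 ⟨T, hy⟩)).symm.trans (M.pw_eq p hy)
  have hVli : LocallyIntegrable V := hV.continuous.locallyIntegrable
  have hVWae : ∀ᵐ x ∂(volume.restrict Ω), V x = W x := M.ae_restrict_of_cells fun T x hx => by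
    rw [hVp T x (subset_closure hx), hWdef, M.pw_eq p hx]
  have hVpart : ∀ i, HasWeakPartial Ω i V (fun x => G x i) := by
    intro i φ h1 h2 h3
    rw [← hgrad.partials i φ h1 h2 h3]
    exact integral_congr_ae (hVWae.mono fun x hx => by simp only [hx])
  have hsm : ∀ n, ContDiff ℝ ∞ (moll n V) := contDiff_moll hVli
  -- The kernels have radius at most `1`, over which `V` varies by at most `K`; this is the bound
  -- for dominated convergence.
  have hclose : ∀ n x, ‖moll n V x - V x‖ ≤ K := by
    intro n x
    have h1 : (bump d n).rOut ≤ 1 := by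
      have : (1 : ℝ) / ((n : ℝ) + 1) ≤ 1 := by
        rw [div_le_one (by positivity)]; linarith [(Nat.cast_nonneg n : (0 : ℝ) ≤ n)]
      exact this
    rw [← dist_eq_norm]
    refine (bump d n).dist_normed_convolution_le hV.continuous.aestronglyMeasurable fun y hy => ?_
    refine (hV.dist_le_mul y x).trans (mul_le_of_le_one_right K.2 ?_)
    exact (le_of_lt hy).trans h1
  have hlimV : ∀ x, Tendsto (fun n => moll n V x - V x) atTop (𝓝 0) := fun x => by
    have := tendsto_moll hV.continuous.aestronglyMeasurable (hV.continuous.continuousAt (x := x))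
    simpa using this.sub_const (V x)
  refine ⟨V, ⟨G, hgrad, ?_, fun n => moll n V, hsm, ?_, ?_, ?_⟩, ?_⟩
  · obtain ⟨C, hC⟩ := (hb.isCompact_closure).exists_bound_of_continuousOn
      hV.continuous.continuousOn
    refine MemLp.of_bound hV.continuous.aestronglyMeasurable C ?_
    filter_upwards [ae_restrict_mem isClosed_frontier.measurableSet] with x hx
    exact hC x hx.1
  · have h1 : ∀ n, eLpNorm (fun x => moll n V x - W x) 2 (volume.restrict Ω) =
        eLpNorm (fun x => moll n V x - V x) 2 (volume.restrict Ω) := fun n =>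
      eLpNorm_congr_ae (hVWae.mono fun x hx => by simp only [hx])
    simp only [h1]
    exact tendsto_eLpNorm_two_zero
      (fun n => ((hsm n).continuous.sub hV.continuous).aestronglyMeasurable)
      (fun n => Eventually.of_forall (hclose n)) (Eventually.of_forall hlimV)
  · have hGm : AEStronglyMeasurable G (volume.restrict Ω) := hgrad.memLp_grad.1
    have hsm1 : ∀ n, ContDiff ℝ 1 (moll n V) := fun n => (hsm n).of_le (by exact_mod_cast le_top)
    refine tendsto_eLpNorm_two_zero (C := K + L)
      (fun n => (continuous_gradient (hsm1 n)).aestronglyMeasurable.sub hGm)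
      (fun n => Eventually.of_forall fun x => ?_) (M.ae_restrict_of_cells fun T x hx => ?_)
    · refine (norm_sub_le _ _).trans (add_le_add ?_ (hL x))
      rw [gradient, LinearIsometryEquiv.norm_map]
      exact norm_fderiv_le_of_lipschitz ℝ (lipschitzWith_moll hV n)
    -- Inside a cell `G` is continuous, and for large `n` the gradient of the mollification is the
    -- mollification of `G`, so it converges pointwise. The cells fill `Ω` up to a null set.
    · obtain ⟨δ, hδ, hball⟩ := Metric.isOpen_iff.1 hΩ x (M.cell_subset T hx)
      have hcomp : ∀ i, Tendsto (fun n => gradient (moll n V) x i - G x i) atTop (𝓝 0) := by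
        intro i
        have hpd : Continuous fun y => gradient (p T) y i := by
          have := hgc T; fun_prop
        have hGc : ContinuousAt (fun y => G y i) x :=
          hpd.continuousAt.congr ((M.pw_eventuallyEq (fun T => gradient (p T)) hx).symm.mono
            fun y hy => by simp only [hGdef, hy])
        have hGmi : AEStronglyMeasurable (fun y => G y i) := by
          have : (fun y => G y i) = M.pw fun T y => gradient (p T) y i := by
            ext y
            by_cases h : ∃ T, y ∈ M.cell T
            · obtain ⟨T, hT⟩ := h
              rw [hGdef, M.pw_eq _ hT, M.pw_eq _ hT]
            · simp only [hGdef, pw, dif_neg h]; rfl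
          rw [this]
          exact (M.measurable_pw fun T => by
            have := hgc T; fun_prop).aestronglyMeasurable
        have h1 := (tendsto_moll hGmi hGc).sub_const (G x i)
        rw [sub_self] at h1
        refine h1.congr' ?_
        filter_upwards [(tendsto_bump_rOut d).eventually_lt_const hδ] with n hn
        rw [gradient_apply, pd_moll hVli (hVpart i) n
          ((Metric.closedBall_subset_ball hn).trans hball)]
      have h2 : Tendsto (fun n => WithLp.toLp 2 fun i => gradient (moll n V) x i - G x i) atTop
          (𝓝 (WithLp.toLp 2 (0 : Fin d → ℝ))) :=
        ((PiLp.continuous_toLp 2 _).tendsto _).comp (tendsto_pi_nhds.2 hcomp)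
      have h3 : Tendsto (fun n => gradient (moll n V) x - G x) atTop
          (𝓝 (WithLp.toLp 2 (0 : Fin d → ℝ))) := h2
      simpa using h3
  · exact tendsto_eLpNorm_two_zero
      (fun n => ((hsm n).continuous.sub hV.continuous).aestronglyMeasurable)
      (fun n => Eventually.of_forall (hclose n)) (Eventually.of_forall hlimV)
  -- Almost every point of `ΓD` lies on a face. This is a boundary face, and it belongs to `ΓD`,
  -- since otherwise the point would lie in the null set `ΓD ∩ ΓN`.
  · have hinter : ∀ᵐ x ∂(surf d), x ∉ ΓD ∩ ΓN := measure_eq_zero_iff_ae_notMem.1 hΓ.inter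
    filter_upwards [M.ae_mem_face hΩ, hinter] with x hx hxi hxD
    have hxf : x ∈ frontier Ω := hΓ.union ▸ Or.inl hxD
    obtain ⟨e, he⟩ := hx hxf
    obtain ⟨T, hT⟩ := M.face_mem e
    have hef : M.face e ⊆ frontier Ω := (M.face_position e).resolve_left fun h =>
      hxf.2 (by rw [hΩ.interior_eq]; exact h he)
    have heD : M.face e ⊆ ΓD := (hΓ.resolved e hef).resolve_right fun h => hxi ⟨hxD, h he⟩
    rw [hVp T x (frontier_subset_closure (hT he))]
    exact hzero e heD T hT x he

end PolyMesh
end PDWG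

/-! ### Fractional norms and the dual problem -/

namespace PDWG

/-- For Lipschitz `φ` the integrand is at most a multiple of `‖z‖ ^ (2 - d - 2θ)` with `z = x - y`.
In polar coordinates this is `r ^ (1 - 2θ)`, integrable at zero because `θ < 1`. -/
lemma gagliardoSq_lt_top {d : ℕ} [NeZero d] {Ω : Set (Eu d)} (hm : MeasurableSet Ω)
    (hΩ : Bornology.IsBounded Ω) {θ : ℝ}
    (hθ : θ < 1) {K : ℝ≥0} {φ : Eu d → ℝ} (hφ : LipschitzWith K φ) : gagliardoSq Ω θ φ < ⊤ := by
  have : Nontrivial (Eu d) := by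
    have : Nonempty (Fin d) := ⟨0⟩
    infer_instance
  obtain ⟨R, hR0, hR⟩ : ∃ R : ℝ, 0 < R ∧ ∀ x ∈ Ω, ∀ y ∈ Ω, ‖x - y‖ < R := by
    obtain ⟨C, hC⟩ := Metric.isBounded_iff.1 hΩ
    refine ⟨|C| + 1, by positivity, fun x hx y hy => ?_⟩
    have := hC hx hy
    rw [dist_eq_norm] at this
    linarith [le_abs_self C]
  set h : Eu d → ℝ≥0∞ := fun z => ENNReal.ofReal (K ^ 2 * ‖z‖ ^ (2 - ((d : ℝ) + 2 * θ))) with hh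
  have hint : ∫⁻ z in Metric.ball (0 : Eu d) R, h z < ⊤ := by
    have h1 : IntegrableOn (fun z : Eu d => K ^ 2 * ‖z‖ ^ (2 - ((d : ℝ) + 2 * θ)))
        (Metric.ball (0 : Eu d) R) := by
      refine Integrable.const_mul ?_ _
      rw [← IntegrableOn, integrableOn_fun_norm_addHaar volume
        (f := fun t : ℝ => t ^ (2 - ((d : ℝ) + 2 * θ)))]
      have h2 : IntegrableOn (fun y : ℝ => y ^ (1 - 2 * θ)) (Ioo 0 R) :=
        (intervalIntegral.integrableOn_Ioo_rpow_iff hR0).2 (by linarith)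
      refine h2.congr_fun (fun y hy => ?_) measurableSet_Ioo
      rw [finrank_euclideanSpace_fin, smul_eq_mul, ← Real.rpow_natCast, ← Real.rpow_add hy.1,
        Nat.cast_sub (NeZero.one_le)]
      push_cast
      ring_nf
    exact Integrable.lintegral_lt_top h1
  have hinner : ∀ x ∈ Ω, ∫⁻ y in Ω, ENNReal.ofReal (|φ x - φ y| ^ 2 / ‖x - y‖ ^ ((d : ℝ) + 2 * θ)) ≤
      ∫⁻ z in Metric.ball (0 : Eu d) R, h z := by
    intro x hx
    have hpt : ∀ y ∈ Ω, ENNReal.ofReal (|φ x - φ y| ^ 2 / ‖x - y‖ ^ ((d : ℝ) + 2 * θ)) ≤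
        (Metric.ball (0 : Eu d) R).indicator h (x - y) := by
      intro y hy
      rw [indicator_of_mem (by simpa using hR x hx y hy)]
      refine ENNReal.ofReal_le_ofReal ?_
      rcases eq_or_ne x y with rfl | hne
      · simp only [sub_self, abs_zero, ne_eq, OfNat.ofNat_ne_zero, not_false_eq_true, zero_pow,
          zero_div]
        positivity
      · have hpos : 0 < ‖x - y‖ := norm_pos_iff.2 (sub_ne_zero.2 hne)
        rw [Real.rpow_sub hpos, ← mul_div_assoc]
        gcongr
        have := hφ.dist_le_mul x y
        rw [dist_eq_norm, dist_eq_norm, Real.norm_eq_abs] at this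
        calc |φ x - φ y| ^ 2 ≤ (K * ‖x - y‖) ^ 2 := by gcongr
          _ = K ^ 2 * ‖x - y‖ ^ (2 : ℝ) := by
            rw [mul_pow]; norm_num
    calc _ ≤ ∫⁻ y in Ω, (Metric.ball (0 : Eu d) R).indicator h (x - y) := by
          exact setLIntegral_mono' hm hpt
      _ ≤ ∫⁻ y, (Metric.ball (0 : Eu d) R).indicator h (x - y) := setLIntegral_le_lintegral _ _
      _ = ∫⁻ z, (Metric.ball (0 : Eu d) R).indicator h z :=
          lintegral_sub_left_eq_self _ x
      _ = _ := lintegral_indicator Metric.isOpen_ball.measurableSet _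
  calc gagliardoSq Ω θ φ ≤ ∫⁻ _ in Ω, ∫⁻ z in Metric.ball (0 : Eu d) R, h z :=
        setLIntegral_mono' hm hinner
    _ = (∫⁻ z in Metric.ball (0 : Eu d) R, h z) * volume Ω := setLIntegral_const _ _
    _ < ⊤ := ENNReal.mul_lt_top hint hΩ.measure_lt_top

/-- For `ε < 1` only the `L²` norm and the Gagliardo seminorm enter, so the Lipschitz case suffices.
Smooth test functions are thereby admissible in the dual problem. -/
lemma sobolevNorm_lt_top_of_contDiff {d : ℕ} [NeZero d] {Ω : Set (Eu d)} (hm : MeasurableSet Ω)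
    (hΩ : Bornology.IsBounded Ω) {ε : ℝ} (hε₀ : 0 ≤ ε) (hε₁ : ε < 1) {φ : Eu d → ℝ}
    (hφ : ContDiff ℝ ∞ φ) (hc : HasCompactSupport φ) : sobolevNorm Ω ε φ < ⊤ := by
  obtain ⟨K, hK⟩ := hφ.lipschitzWith_of_hasCompactSupport hc (by simp)
  have hl : l2Sq Ω φ < ⊤ := by
    have h2 := (memLp_of_continuous hφ.continuous hm hΩ).2
    rw [l2Sq, iInf_pos hφ.continuous.aestronglyMeasurable]
    rw [eLpNorm_lt_top_iff_lintegral_rpow_enorm_lt_top (by simp) (by simp)] at h2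
    simpa using h2
  have hfl : ⌊ε⌋₊ = 0 := Nat.floor_eq_zero.2 hε₁
  rw [sobolevNorm, hfl]
  refine ENNReal.rpow_lt_top_of_nonneg (by norm_num) ?_
  rw [sobolevSq]
  refine (ENNReal.add_lt_top.2 ⟨hl, ?_⟩).ne
  split_ifs
  · simp
  · rw [Int.fract_eq_self.2 ⟨hε₀, hε₁⟩]
    exact gagliardoSq_lt_top hm hΩ hε₁ hK

/-- The squared `L²` norm is a summand of the squared norm at every order. -/
lemma ae_eq_zero_of_sobolevNorm_eq_zero {d : ℕ} {Ω : Set (Eu d)} {s : ℝ} {w : Eu d → ℝ}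
    (h : sobolevNorm Ω s w = 0) : ∀ᵐ x ∂(volume.restrict Ω), w x = 0 := by
  have h1 : l2Sq Ω w ≤ sobolevSq Ω (Int.fract s) ⌊s⌋₊ w := by
    rcases ⌊s⌋₊ with _ | n
    · exact le_self_add
    · exact le_iInf₂ fun g _ => le_self_add
  have h2 : l2Sq Ω w = 0 := by
    rw [sobolevNorm, ENNReal.rpow_eq_zero_iff_of_pos (by norm_num)] at h
    exact le_antisymm (h ▸ h1) bot_le
  have hmeas : AEStronglyMeasurable w (volume.restrict Ω) := by
    by_contra hn
    rw [l2Sq, iInf_neg hn] at h2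
    exact ENNReal.top_ne_zero h2
  rw [l2Sq, iInf_pos hmeas, lintegral_eq_zero_iff' (hmeas.enorm.pow_const 2)] at h2
  filter_upwards [h2] with x hx
  simpa using hx

lemma DualRegular.ae_eq_zero {d : ℕ} {Ω ΓD : Set (Eu d)} {a : Eu d → Matrix (Fin d) (Fin d) ℝ}
    {b : Eu d → Eu d} {ε : ℝ} (h : DualRegular Ω ΓD a b ε) {lam : Eu d → ℝ}
    (hl : IsDualSolution Ω ΓD a b ε 0 lam) : ∀ᵐ x ∂(volume.restrict Ω), lam x = 0 := by
  obtain ⟨C, hC⟩ := h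
  have h1 := (hC 0 MemLp.zero).2 lam hl
  have h2 : negSobolevNorm Ω ε 0 = 0 := by
    simp [negSobolevNorm]
  rw [h2, mul_zero] at h1
  exact ae_eq_zero_of_sobolevNorm_eq_zero (le_antisymm h1 bot_le)

lemma PolyMesh.memLp_inner_pw {d : ℕ} {Ω : Set (Eu d)} (M : PolyMesh Ω)
    (hbd : Bornology.IsBounded Ω) {b : Eu d → Eu d} (hb : M.IsPiecewiseConstant b)
    {G : Eu d → Eu d} (hG : MemLp G 2 (volume.restrict Ω)) :
    MemLp (fun x => inner ℝ (b x) (G x)) 2 (volume.restrict Ω) := by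
  choose c hc using hb
  obtain ⟨C, hC⟩ := M.exists_bound_pw (F := fun T _ => c T) fun T => continuous_const
  have hae : ∀ᵐ x ∂(volume.restrict Ω), M.pw (fun T _ => c T) x = b x :=
    M.ae_restrict_of_cells fun T x hx => by rw [M.pw_eq _ hx, hc T x hx]
  have hm := (M.memLp_pw (F := fun T _ => c T) (fun T => continuous_const) hbd).1
  refine hG.of_le_mul (c := C) ((hm.inner hG.1).congr (hae.mono fun x hx => by simp only [hx]))
    (hae.mono fun x hx => (norm_inner_le_norm _ _).trans ?_)
  rw [← hx]
  exact mul_le_mul_of_nonneg_right (hC x) (norm_nonneg _)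

/-- Compactly supported smooth functions have finite `H^ε` norm, so the fundamental lemma turns the
variational equation into one that holds almost everywhere. -/
lemma ae_eq_of_forall_integral_eq {d : ℕ} [NeZero d] {Ω : Set (Eu d)} (hΩ : IsOpen Ω)
    (hbd : Bornology.IsBounded Ω) {ε : ℝ} (hε₀ : 0 ≤ ε) (hε₁ : ε < 1) {f ψ : Eu d → ℝ}
    (hf : MemLp f 2 (volume.restrict Ω)) (hψ : MemLp ψ 2 (volume.restrict Ω))
    (h : ∀ v : Eu d → ℝ, sobolevNorm Ω ε v < ⊤ → ∫ x in Ω, v x * f x = ∫ x in Ω, ψ x * v x) :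
    ∀ᵐ x ∂(volume.restrict Ω), f x = ψ x := by
  have hfin : IsFiniteMeasure (volume.restrict Ω) :=
    ⟨by rw [Measure.restrict_apply_univ]; exact hbd.measure_lt_top⟩
  have hl : LocallyIntegrableOn (fun x => f x - ψ x) Ω :=
    IntegrableOn.locallyIntegrableOn ((hf.sub hψ).integrable (by norm_num))
  have := hΩ.ae_eq_zero_of_integral_contDiff_smul_eq_zero hl fun φ hφ hc hs => ?_
  · rw [ae_restrict_iff' hΩ.measurableSet]
    filter_upwards [this] with x hx hxΩ
    exact sub_eq_zero.1 (hx hxΩ)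
  · rw [← setIntegral_eq_integral_of_forall_compl_eq_zero (s := Ω)]
    · have hφ2 := memLp_of_continuous hφ.continuous hΩ.measurableSet hbd
      have i1 : IntegrableOn (fun x => φ x * f x) Ω := MemLp.integrable_mul hφ2 hf
      have i2 : IntegrableOn (fun x => ψ x * φ x) Ω := MemLp.integrable_mul hψ hφ2
      have h1 := h φ (sobolevNorm_lt_top_of_contDiff hΩ.measurableSet hbd hε₀ hε₁ hφ hc)
      calc ∫ x in Ω, φ x • (f x - ψ x) = ∫ x in Ω, (φ x * f x - ψ x * φ x) := by
            congr 1; ext x; rw [smul_eq_mul]; ring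
        _ = 0 := by rw [integral_sub i1 i2, h1, sub_self]
    · intro x hx
      rw [image_eq_zero_of_notMem_tsupport fun h => hx (hs h), zero_smul]

end PDWG

/-! ### Elimination of the discrete weak operators -/

namespace PDWG

variable {d : ℕ}

lemma dvg_lin {F G : Eu d → Eu d} (hF : Differentiable ℝ F) (hG : Differentiable ℝ G) (c : ℝ)
    (x : Eu d) : dvg (fun y => c • F y + G y) x = c * dvg F x + dvg G x := by
  have h := dvg_mul (φ := fun _ => c) (differentiable_const c) hF x
  have hg : gradient (fun _ : Eu d => c) x = 0 := by
    simp [gradient]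
  rw [dvg_add (F := fun y => c • F y) (hF.const_smul c) hG, h, hg, inner_zero_right]
  ring

lemma gradient_lin {f g : Eu d → ℝ} (hf : Differentiable ℝ f) (hg : Differentiable ℝ g) (c : ℝ)
    (x : Eu d) : gradient (c • f + g) x = c • gradient f x + gradient g x := by
  rw [gradient_add (hf.const_smul c) hg, gradient_smul c hf]; rfl

/-- The flux `A ∇u - u β` of the formal adjoint of `w ↦ ∇ · (A ∇w) + β · ∇w`. -/
noncomputable def adjFlux (A : Matrix (Fin d) (Fin d) ℝ) (β : Eu d) (u : Eu d → ℝ) (x : Eu d) :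
    Eu d := mv A (gradient u x) - u x • β

/-- The term `u β` keeps the degree at `r`, although the diffusive part has degree `r - 1`. -/
lemma isPolyVec_adjFlux (A : Matrix (Fin d) (Fin d) ℝ) (β : Eu d) {r : ℕ} {u : Eu d → ℝ}
    (hu : u ∈ polyFun d r) : IsPolyVec r (adjFlux A β u) :=
  (((isPolyVec_gradient hu).mv A).mono (Nat.sub_le r 1)).sub (isPolyVec_smul_const hu β)

lemma differentiable_of_mem_polyFun {r : ℕ} {u : Eu d → ℝ} (hu : u ∈ polyFun d r) :
    Differentiable ℝ u := (contDiff_of_mem_polyFun hu (n := 1)).differentiable one_ne_zero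

lemma IsPolyVec.differentiable {r : ℕ} {F : Eu d → Eu d} (hF : IsPolyVec r F) :
    Differentiable ℝ F := (hF.contDiff (n := 1)).differentiable one_ne_zero

lemma IsPolyVec.continuous {r : ℕ} {F : Eu d → Eu d} (hF : IsPolyVec r F) :
    Continuous F := (hF.contDiff (n := 1)).continuous

lemma adjFlux_lin (A : Matrix (Fin d) (Fin d) ℝ) (β : Eu d) {r : ℕ} {u v : Eu d → ℝ}
    (hu : u ∈ polyFun d r) (hv : v ∈ polyFun d r) (c : ℝ) :
    adjFlux A β (c • u + v) = fun x => c • adjFlux A β u x + adjFlux A β v x := by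
  ext1 x
  rw [adjFlux, gradient_lin (differentiable_of_mem_polyFun hu) (differentiable_of_mem_polyFun hv),
    mv_add, mv_smul, adjFlux, adjFlux, Pi.add_apply, Pi.smul_apply, smul_eq_mul]
  module

lemma dvg_adjFlux_lin (A : Matrix (Fin d) (Fin d) ℝ) (β : Eu d) {r : ℕ} {u v : Eu d → ℝ}
    (hu : u ∈ polyFun d r) (hv : v ∈ polyFun d r) (c : ℝ) (x : Eu d) :
    dvg (adjFlux A β (c • u + v)) x = c * dvg (adjFlux A β u) x + dvg (adjFlux A β v) x := by
  rw [adjFlux_lin A β hu hv, dvg_lin (isPolyVec_adjFlux A β hu).differentiable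
    (isPolyVec_adjFlux A β hv).differentiable]

lemma dvg_adjFlux (A : Matrix (Fin d) (Fin d) ℝ) (β : Eu d) {r : ℕ} {u : Eu d → ℝ}
    (hu : u ∈ polyFun d r) (x : Eu d) : dvg (adjFlux A β u) x =
      dvg (fun y => mv A (gradient u y)) x - dvg (fun y => u y • β) x :=
  dvg_sub ((isPolyVec_gradient hu).mv A).differentiable (isPolyVec_smul_const hu β).differentiable x

namespace PolyMesh

variable {Ω : Set (Eu d)} (M : PolyMesh Ω)

/-- `g` agrees on the face `e` with a continuous function. -/
def FaceCont (e : M.Face) (g : Eu d → ℝ) : Prop :=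
  ∃ p : Eu d → ℝ, Continuous p ∧ ∀ x ∈ M.face e, g x = p x

variable {M} {e : M.Face} {f g : Eu d → ℝ}

lemma FaceCont.of_continuous (hf : Continuous f) : M.FaceCont e f := ⟨f, hf, fun _ _ => rfl⟩

lemma FaceCont.add (hf : M.FaceCont e f) (hg : M.FaceCont e g) :
    M.FaceCont e fun x => f x + g x := by
  obtain ⟨p, hp, h⟩ := hf
  obtain ⟨q, hq, h'⟩ := hg
  exact ⟨_, hp.add hq, fun x hx => by simp only [Pi.add_apply, h x hx, h' x hx]⟩

lemma FaceCont.sub (hf : M.FaceCont e f) (hg : M.FaceCont e g) :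
    M.FaceCont e fun x => f x - g x := by
  obtain ⟨p, hp, h⟩ := hf
  obtain ⟨q, hq, h'⟩ := hg
  exact ⟨_, hp.sub hq, fun x hx => by simp only [Pi.sub_apply, h x hx, h' x hx]⟩

lemma FaceCont.mul (hf : M.FaceCont e f) (hg : M.FaceCont e g) :
    M.FaceCont e fun x => f x * g x := by
  obtain ⟨p, hp, h⟩ := hf
  obtain ⟨q, hq, h'⟩ := hg
  exact ⟨_, hp.mul hq, fun x hx => by simp only [Pi.mul_apply, h x hx, h' x hx]⟩

lemma FaceCont.of_mem_polyOn {r : ℕ} (hf : f ∈ polyOn r (M.face e)) : M.FaceCont e f := by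
  obtain ⟨p, hp, rfl⟩ := hf
  exact ⟨p, continuous_of_mem_polyFun hp, fun x hx => indicator_of_mem hx p⟩

lemma FaceCont.integrableOn (hf : M.FaceCont e f) : IntegrableOn f (M.face e) (surf d) := by
  obtain ⟨p, hp, h⟩ := hf
  exact (M.integrableOn_face hp e).congr_fun (fun x hx => (h x hx).symm) (M.measurableSet_face e)

lemma FaceCont.integrableOn_mul (hf : M.FaceCont e f) (hg : IntegrableOn g (M.face e) (surf d)) :
    IntegrableOn (fun x => g x * f x) (M.face e) (surf d) := by
  obtain ⟨p, hp, h⟩ := hf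
  obtain ⟨C, hC⟩ := (M.isBounded_face e).isCompact_closure.exists_bound_of_continuousOn
    hp.continuousOn
  have : IntegrableOn (fun x => g x * p x) (M.face e) (surf d) :=
    Integrable.mul_bdd hg (M.integrableOn_face hp e).aestronglyMeasurable (c := C)
      ((ae_restrict_mem (M.measurableSet_face e)).mono fun x hx => hC x (subset_closure hx))
  exact this.congr_fun (fun x hx => by rw [h x hx]) (M.measurableSet_face e)

variable (M) {T : M.Cell}

lemma integrableOn_cell_mul (hf : Continuous f) (hg : IntegrableOn g (M.cell T)) :
    IntegrableOn (fun x => g x * f x) (M.cell T) := by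
  obtain ⟨C, hC⟩ := M.exists_bound_cell hf T
  exact Integrable.mul_bdd hg (M.integrableOn_cell hf T).aestronglyMeasurable (c := C)
    ((ae_restrict_mem (M.measurableSet_cell T)).mono fun x hx => hC x hx)

lemma bdryInt_lin {F G : M.Face → Eu d → ℝ} (hF : ∀ e, M.Inc T e → M.FaceCont e (F e))
    (hG : ∀ e, M.Inc T e → M.FaceCont e (G e)) (c : ℝ) :
    M.bdryInt T (fun e x => c * F e x + G e x) = c * M.bdryInt T F + M.bdryInt T G := by
  classical
  unfold bdryInt
  rw [Finset.mul_sum, ← Finset.sum_add_distrib]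
  refine Finset.sum_congr rfl fun e _ => ?_
  split_ifs with h
  · rw [integral_add ((hF e h).integrableOn.const_mul c) (hG e h).integrableOn, integral_const_mul]
  · ring

lemma tr_eq {α : Type} [TopologicalSpace α] [Nonempty α] [T2Space α] {h : Eu d → α} {c : α}
    (hc : ∀ x ∈ M.cell T, h x = c) {x : Eu d} (hx : x ∈ closure (M.cell T)) : M.tr T h x = c :=
  extendFrom_eq hx (tendsto_const_nhds.congr'
    (eventually_nhdsWithin_of_forall fun y hy => (hc y hy).symm))

lemma face_subset_closure (h : M.Inc T e) : M.face e ⊆ closure (M.cell T) :=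
  h.trans frontier_subset_closure

lemma diffOp_eq {a : Eu d → Matrix (Fin d) (Fin d) ℝ} {A : Matrix (Fin d) (Fin d) ℝ}
    (ha : ∀ x ∈ M.cell T, a x = A) (u : Eu d → ℝ) {x : Eu d} (hx : x ∈ M.cell T) :
    diffOp a u x = dvg (fun y => mv A (gradient u y)) x :=
  dvg_congr_of_eqOn (M.cell_polyhedral T).isOpen (fun y hy => by rw [ha y hy]) hx

/-- Riesz representation for the `L²(T)` inner product, which is definite on `V` because by `hV0` a
member is determined by its values on the cell. The discrete weak gradient and the discrete weak
diffusion operator exist for this reason. -/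
lemma exists_riesz {E : Type*} [NormedAddCommGroup E] [InnerProductSpace ℝ E]
    (V : Submodule ℝ (Eu d → E)) [FiniteDimensional ℝ V] (hV : ∀ f ∈ V, Continuous f)
    (hV0 : ∀ f ∈ V, (∀ x ∈ M.cell T, f x = 0) → f = 0) (l : (Eu d → E) → ℝ)
    (hl : ∀ f ∈ V, ∀ g ∈ V, ∀ c : ℝ, l (c • f + g) = c * l f + l g) :
    ∃ q ∈ V, ∀ p ∈ V, ∫ x in M.cell T, inner ℝ (q x) (p x) = l p := by
  have hadd : ∀ f ∈ V, ∀ g ∈ V, l (f + g) = l f + l g := fun f hf g hg => by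
    simpa using hl f hf g hg 1
  have hsmul : ∀ f ∈ V, ∀ c : ℝ, l (c • f) = c * l f := fun f hf c => by
    have h0 := hl 0 V.zero_mem 0 V.zero_mem 1
    have := hl f hf 0 V.zero_mem c
    simp only [one_smul, add_zero, one_mul] at h0
    rw [add_zero] at this
    linarith
  have hi : ∀ f ∈ V, ∀ g ∈ V, IntegrableOn (fun x => (inner ℝ (f x) (g x) : ℝ)) (M.cell T) :=
    fun f hf g hg => M.integrableOn_cell ((hV f hf).inner (hV g hg)) T
  let B : V →ₗ[ℝ] V →ₗ[ℝ] ℝ := LinearMap.mk₂ ℝ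
    (fun f g => ∫ x in M.cell T, inner ℝ (f.1 x) (g.1 x))
    (fun f f' g => by
      rw [← integral_add (hi _ f.2 _ g.2) (hi _ f'.2 _ g.2)]
      simp [inner_add_left])
    (fun c f g => by
      rw [smul_eq_mul, ← integral_const_mul]
      simp [real_inner_smul_left])
    (fun f g g' => by
      rw [← integral_add (hi _ f.2 _ g.2) (hi _ f.2 _ g'.2)]
      simp [inner_add_right])
    (fun c f g => by
      rw [smul_eq_mul, ← integral_const_mul]
      simp [real_inner_smul_right])
  let l' : V →ₗ[ℝ] ℝ :=
    { toFun := fun f => l f.1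
      map_add' := fun f g => hadd _ f.2 _ g.2
      map_smul' := fun c f => hsmul _ f.2 c }
  have hB : ∀ f, (∀ g, B f g = 0) → f = 0 := by
    intro f hf
    have h1 : ∫ x in M.cell T, inner ℝ (f.1 x) (f.1 x) = 0 := hf f
    refine Subtype.ext (hV0 _ f.2 fun x hx => norm_eq_zero.1
      (M.eq_zero_on_cell (hV _ f.2).norm ?_ x hx))
    simpa only [real_inner_self_eq_norm_sq] using h1
  obtain ⟨q, hq, -⟩ := existsUnique_of_nondegenerate B hB l'
  exact ⟨q.1, q.2, fun p hp => hq ⟨p, hp⟩⟩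

/-- Polynomial vector fields. -/
def polyVec (d r : ℕ) : Submodule ℝ (Eu d → Eu d) where
  carrier := {F | IsPolyVec r F}
  add_mem' hF hG := hF.add hG
  zero_mem' _ := Submodule.zero_mem _
  smul_mem' c _ hF i := Submodule.smul_mem _ c (hF i)

instance (d r : ℕ) : FiniteDimensional ℝ (polyVec d r) := by
  let φ : polyVec d r →ₗ[ℝ] (Fin d → polyFun d r) :=
    { toFun := fun F i => ⟨fun x => F.1 x i, F.2 i⟩
      map_add' := fun F G => rfl
      map_smul' := fun c F => rfl }
  refine Module.Finite.of_injective φ fun F G h => Subtype.ext (funext fun x => ?_)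
  ext i
  exact congrFun (congrArg Subtype.val (congrFun h i)) x

variable {k : ℕ} {w : M.WeakFn}

lemma continuous_wh_cell (hw : w ∈ M.Wh k) (T : M.Cell) : Continuous (w.1 T) :=
  continuous_of_mem_polyFun (hw.1 T)

variable {M}

lemma faceCont_wb (hw : w ∈ M.Wh k) (e : M.Face) : M.FaceCont e (w.2.1 e) :=
  .of_mem_polyOn (hw.2.1 e)

lemma faceCont_wn (hw : w ∈ M.Wh k) (T : M.Cell) (e : M.Face) : M.FaceCont e (w.2.2 T e) := by
  by_cases h : M.Inc T e
  · exact .of_mem_polyOn (hw.2.2.1 T e h)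
  · rw [hw.2.2.2.1 T e h]; exact .of_continuous continuous_zero

variable (M)

lemma exists_isWeakGrad (hw : w ∈ M.Wh k) (r : ℕ) (T : M.Cell) : ∃ G, M.IsWeakGrad r T w G := by
  have key := M.exists_riesz (T := T) (polyVec d r) (fun F hF => IsPolyVec.continuous hF)
    (fun F hF h0 => ?_)
    (fun Ψ => - (∫ x in M.cell T, w.1 T x * dvg Ψ x)
      + M.bdryInt T (fun e x => w.2.1 e x * inner ℝ (Ψ x) (M.normal T e)))
    (fun F hF G hG c => ?_)
  · obtain ⟨G, hG, h⟩ := key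
    exact ⟨G, hG, h⟩
  · ext x i
    exact congrFun (polyFun_eq_zero (hF i) (M.cell_polyhedral T).isOpen (M.cell_nonempty T)
      fun y hy => by rw [h0 y hy]; rfl) x
  · have hF : IsPolyVec r F := hF
    have hG : IsPolyVec r G := hG
    have e1 : ∀ x, dvg (c • F + G) x = c * dvg F x + dvg G x :=
      dvg_lin hF.differentiable hG.differentiable c
    have i1 : ∀ F, IsPolyVec r F → IntegrableOn (fun x => w.1 T x * dvg F x) (M.cell T) :=
      fun F hF => M.integrableOn_cell ((M.continuous_wh_cell hw T).mul
        (continuous_of_mem_polyFun hF.dvg)) T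
    have f1 : ∀ F, IsPolyVec r F → ∀ e,
        M.FaceCont e (fun x => w.2.1 e x * inner ℝ (F x) (M.normal T e)) := fun F hF e =>
      (faceCont_wb hw e).mul (.of_continuous (hF.continuous.inner continuous_const))
    have b1 := M.bdryInt_lin (T := T) (fun e _ => f1 F hF e) (fun e _ => f1 G hG e) c
    have b2 : ∫ x in M.cell T, w.1 T x * dvg (c • F + G) x =
        c * (∫ x in M.cell T, w.1 T x * dvg F x) + ∫ x in M.cell T, w.1 T x * dvg G x := by
      rw [← integral_const_mul, ← integral_add ((i1 F hF).const_mul c) (i1 G hG)]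
      congr 1; ext x; rw [e1]; ring
    have b3 : M.bdryInt T (fun e x => w.2.1 e x * inner ℝ ((c • F + G) x) (M.normal T e)) =
        M.bdryInt T (fun e x => c * (w.2.1 e x * inner ℝ (F x) (M.normal T e)) +
          w.2.1 e x * inner ℝ (G x) (M.normal T e)) := by
      congr 1; ext e x
      rw [Pi.add_apply, Pi.smul_apply, inner_add_left, real_inner_smul_left]; ring
    rw [b2, b3, b1]; ring

lemma exists_isWeakDiffOp (hw : w ∈ M.Wh k) {a : Eu d → Matrix (Fin d) (Fin d) ℝ}
    {A : Matrix (Fin d) (Fin d) ℝ} (ha : ∀ x ∈ M.cell T, a x = A) (r : ℕ) :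
    ∃ q, M.IsWeakDiffOp a r T w q := by
  have key := M.exists_riesz (T := T) (polyFun d r)
    (fun F hF => continuous_of_mem_polyFun hF)
    (fun F hF h0 => polyFun_eq_zero hF (M.cell_polyhedral T).isOpen (M.cell_nonempty T) h0)
    (fun p => (∫ x in M.cell T, w.1 T x * diffOp a p x)
      - M.bdryInt T (fun e x => w.2.1 e x *
          inner ℝ (mv (M.tr T a x) (gradient p x)) (M.normal T e))
      + M.bdryInt T (fun e x => w.2.2 T e x * p x))
    (fun f hf g hg c => ?_)
  · obtain ⟨G, hG, h⟩ := key
    exact ⟨G, hG, fun p hp => by rw [← h p hp]; congr 1; ext x; simp [mul_comm]⟩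
  · have ip : ∀ f ∈ polyFun d r, IsPolyVec (r - 1) fun x => mv A (gradient f x) :=
      fun f hf => (isPolyVec_gradient hf).mv A
    have tra : ∀ e, M.Inc T e → ∀ x ∈ M.face e, M.tr T a x = A := fun e he x hx =>
      M.tr_eq ha (M.face_subset_closure he hx)
    have gl : ∀ x, mv A (gradient (c • f + g) x) =
        c • mv A (gradient f x) + mv A (gradient g x) := fun x => by
      rw [gradient_lin (differentiable_of_mem_polyFun hf) (differentiable_of_mem_polyFun hg),
        mv_add, mv_smul]
    have c1 : ∀ p : Eu d → ℝ, ∫ x in M.cell T, w.1 T x * diffOp a p x =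
        ∫ x in M.cell T, w.1 T x * dvg (fun y => mv A (gradient p y)) x := fun p =>
      setIntegral_congr_fun (M.measurableSet_cell T) fun x hx => by
        simp only [M.diffOp_eq ha p hx]
    have c2 : ∀ p : Eu d → ℝ, M.bdryInt T (fun e x => w.2.1 e x *
          inner ℝ (mv (M.tr T a x) (gradient p x)) (M.normal T e)) =
        M.bdryInt T (fun e x => w.2.1 e x * inner ℝ (mv A (gradient p x)) (M.normal T e)) :=
      fun p => M.bdryInt_congr fun e he x hx => by rw [tra e he x hx]
    simp only [c1, c2]
    have i1 : ∀ f ∈ polyFun d r,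
        IntegrableOn (fun x => w.1 T x * dvg (fun y => mv A (gradient f y)) x) (M.cell T) :=
      fun f hf => M.integrableOn_cell ((M.continuous_wh_cell hw T).mul
        (continuous_of_mem_polyFun (ip f hf).dvg)) T
    have f1 : ∀ f ∈ polyFun d r, ∀ e,
        M.FaceCont e (fun x => w.2.1 e x * inner ℝ (mv A (gradient f x)) (M.normal T e)) :=
      fun f hf e => (faceCont_wb hw e).mul
        (.of_continuous ((ip f hf).continuous.inner continuous_const))
    have f2 : ∀ f ∈ polyFun d r, ∀ e, M.FaceCont e (fun x => w.2.2 T e x * f x) :=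
      fun f hf e => (faceCont_wn hw T e).mul (.of_continuous (continuous_of_mem_polyFun hf))
    have b0 : ∫ x in M.cell T, w.1 T x * dvg (fun y => mv A (gradient (c • f + g) y)) x =
        c * (∫ x in M.cell T, w.1 T x * dvg (fun y => mv A (gradient f y)) x) +
          ∫ x in M.cell T, w.1 T x * dvg (fun y => mv A (gradient g y)) x := by
      rw [← integral_const_mul, ← integral_add ((i1 f hf).const_mul c) (i1 g hg)]
      congr 1; ext x
      simp only [gl]
      rw [dvg_lin (ip f hf).differentiable (ip g hg).differentiable]; ring
    have b1 := M.bdryInt_lin (T := T) (fun e _ => f1 f hf e) (fun e _ => f1 g hg e) c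
    have b2 := M.bdryInt_lin (T := T) (fun e _ => f2 f hf e) (fun e _ => f2 g hg e) c
    have b3 : M.bdryInt T (fun e x => w.2.1 e x *
          inner ℝ (mv A (gradient (c • f + g) x)) (M.normal T e)) =
        M.bdryInt T (fun e x => c * (w.2.1 e x * inner ℝ (mv A (gradient f x)) (M.normal T e)) +
          w.2.1 e x * inner ℝ (mv A (gradient g x)) (M.normal T e)) := by
      congr 1; ext e x
      rw [gl, inner_add_left, real_inner_smul_left]; ring
    have b4 : M.bdryInt T (fun e x => w.2.2 T e x * (c • f + g) x) =
        M.bdryInt T (fun e x => c * (w.2.2 T e x * f x) + w.2.2 T e x * g x) := by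
      congr 1; ext e x
      rw [Pi.add_apply, Pi.smul_apply, smul_eq_mul]; ring
    rw [b0, b3, b4, b1, b2]; ring

lemma isWeakGrad_weakGrad (hw : w ∈ M.Wh k) (r : ℕ) (T : M.Cell) :
    M.IsWeakGrad r T w (M.weakGrad r T w) :=
  Classical.epsilon_spec (M.exists_isWeakGrad hw r T)

lemma isWeakDiffOp_weakDiffOp (hw : w ∈ M.Wh k) {a : Eu d → Matrix (Fin d) (Fin d) ℝ}
    {A : Matrix (Fin d) (Fin d) ℝ} (ha : ∀ x ∈ M.cell T, a x = A) (r : ℕ) :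
    M.IsWeakDiffOp a r T w (M.weakDiffOp a r T w) :=
  Classical.epsilon_spec (M.exists_isWeakDiffOp hw ha r)

/-- The form `(u, 𝓛_w w + β · ∇_w w)_T` with the discrete weak operators eliminated. -/
noncomputable def dualForm (A : Matrix (Fin d) (Fin d) ℝ) (β : Eu d) (T : M.Cell) (u : Eu d → ℝ)
    (w : M.WeakFn) : ℝ :=
  (∫ x in M.cell T, w.1 T x * dvg (adjFlux A β u) x) +
    M.bdryInt T (fun e x => w.2.2 T e x * u x -
      w.2.1 e x * inner ℝ (adjFlux A β u x) (M.normal T e))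

/-- The defining identities are used with `p = u` for `𝓛_w` and `Ψ = u β` for `∇_w`; the second
choice is admissible because `s ≤ k - 1`. What remains involves only the three components of `w`,
paired with `u` and its adjoint flux `A ∇u - u β`. -/
lemma bForm_eq (hw : w ∈ M.Wh k) {a : Eu d → Matrix (Fin d) (Fin d) ℝ} {b : Eu d → Eu d}
    {A : M.Cell → Matrix (Fin d) (Fin d) ℝ} {β : M.Cell → Eu d}
    (ha : ∀ T, ∀ x ∈ M.cell T, a x = A T) (hb : ∀ T, ∀ x ∈ M.cell T, b x = β T) {s : ℕ}
    (hs : s ≤ k - 1) {u : M.Cell → Eu d → ℝ} (hu : u ∈ M.Mh s) :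
    M.bForm a b k s u w = ∑ T, M.dualForm (A T) (β T) T (u T) w := by
  refine Finset.sum_congr rfl fun T _ => ?_
  have huT : u T ∈ polyFun d s := hu T (mem_univ T)
  have huc := continuous_of_mem_polyFun huT
  have h1 := M.isWeakDiffOp_weakDiffOp hw (ha T) s
  have h2 := M.isWeakGrad_weakGrad hw (k - 1) T
  have hub : IsPolyVec (k - 1) fun x => u T x • β T := (isPolyVec_smul_const huT _).mono hs
  have e1 := h1.2 (u T) huT
  have e2 := h2.2 _ hub
  have i1 : IntegrableOn (fun x => M.weakDiffOp a s T w x * u T x) (M.cell T) :=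
    M.integrableOn_cell ((continuous_of_mem_polyFun h1.1).mul huc) T
  have i2 : IntegrableOn (fun x => (inner ℝ (M.weakGrad (k - 1) T w x) (u T x • β T) : ℝ))
      (M.cell T) :=
    M.integrableOn_cell (h2.1.continuous.inner (huc.smul continuous_const)) T
  have e3 : ∫ x in M.cell T,
      u T x * (M.weakDiffOp a s T w x + inner ℝ (b x) (M.weakGrad (k - 1) T w x)) =
      (∫ x in M.cell T, M.weakDiffOp a s T w x * u T x) +
        ∫ x in M.cell T, inner ℝ (M.weakGrad (k - 1) T w x) (u T x • β T) := by
    rw [← integral_add i1 i2]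
    refine setIntegral_congr_fun (M.measurableSet_cell T) fun x hx => ?_
    simp only [hb T x hx, real_inner_smul_right, real_inner_comm (β T)]
    ring
  have tra : ∀ e, M.Inc T e → ∀ x ∈ M.face e, M.tr T a x = A T := fun e he x hx =>
    M.tr_eq (ha T) (M.face_subset_closure he hx)
  have ip : IsPolyVec (s - 1) fun x => mv (A T) (gradient (u T) x) :=
    (isPolyVec_gradient huT).mv (A T)
  have c1 : ∫ x in M.cell T, w.1 T x * diffOp a (u T) x =
      ∫ x in M.cell T, w.1 T x * dvg (fun y => mv (A T) (gradient (u T) y)) x :=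
    setIntegral_congr_fun (M.measurableSet_cell T) fun x hx => by
      simp only [M.diffOp_eq (ha T) (u T) hx]
  have c2 : M.bdryInt T (fun e x => w.2.1 e x *
        inner ℝ (mv (M.tr T a x) (gradient (u T) x)) (M.normal T e)) =
      M.bdryInt T (fun e x => w.2.1 e x * inner ℝ (mv (A T) (gradient (u T) x)) (M.normal T e)) :=
    M.bdryInt_congr fun e he x hx => by rw [tra e he x hx]
  have hwc := M.continuous_wh_cell hw T
  have c3 : ∫ x in M.cell T, w.1 T x * dvg (adjFlux (A T) (β T) (u T)) x =
      (∫ x in M.cell T, w.1 T x * dvg (fun y => mv (A T) (gradient (u T) y)) x) -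
        ∫ x in M.cell T, w.1 T x * dvg (fun y => u T y • β T) x := by
    have j1 : IntegrableOn (fun x => w.1 T x *
        dvg (fun y => mv (A T) (gradient (u T) y)) x) (M.cell T) :=
      M.integrableOn_cell (hwc.mul (continuous_of_mem_polyFun ip.dvg)) T
    have j2 : IntegrableOn (fun x => w.1 T x * dvg (fun y => u T y • β T) x) (M.cell T) :=
      M.integrableOn_cell (hwc.mul (continuous_of_mem_polyFun hub.dvg)) T
    rw [← integral_sub j1 j2]
    congr 1; ext x
    rw [dvg_adjFlux (A T) (β T) huT]; ring
  have f1 : ∀ e, M.FaceCont e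
      (fun x => w.2.1 e x * inner ℝ (mv (A T) (gradient (u T) x)) (M.normal T e)) := fun e =>
    (faceCont_wb hw e).mul (.of_continuous (ip.continuous.inner continuous_const))
  have f2 : ∀ e, M.FaceCont e (fun x => w.2.2 T e x * u T x) := fun e =>
    (faceCont_wn hw T e).mul (.of_continuous huc)
  have f3 : ∀ e, M.FaceCont e (fun x => w.2.1 e x * inner ℝ (u T x • β T) (M.normal T e)) :=
    fun e => (faceCont_wb hw e).mul (.of_continuous (hub.continuous.inner continuous_const))
  have b1 := M.bdryInt_lin (T := T) (fun e _ => f1 e) (fun e _ => (f2 e).add (f3 e)) (-1)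
  have b2 := M.bdryInt_lin (T := T) (fun e _ => f2 e) (fun e _ => f3 e) 1
  have b3 : M.bdryInt T (fun e x => w.2.2 T e x * u T x -
      w.2.1 e x * inner ℝ (adjFlux (A T) (β T) (u T) x) (M.normal T e)) =
      - M.bdryInt T (fun e x => w.2.1 e x *
        inner ℝ (mv (A T) (gradient (u T) x)) (M.normal T e)) +
      (M.bdryInt T (fun e x => w.2.2 T e x * u T x) +
      M.bdryInt T (fun e x => w.2.1 e x * inner ℝ (u T x • β T) (M.normal T e))) := by
    simp only [one_mul] at b2
    rw [← b2, ← neg_one_mul, ← b1]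
    congr 1; ext e x
    rw [adjFlux, inner_sub_left]; ring
  rw [e3, e1, e2, c1, c2, dualForm, c3, b3]
  ring

end PolyMesh
end PDWG

/-! ### Saddle point systems and linearity of the scheme -/

namespace PDWG

/-- The two equations are those of the single bilinear form `S y z + B u z + B v y` on `P × Q`,
which is nondegenerate by `hinj`. Bilinearity is asked on the subspaces only: outside them integrals
may diverge and the discrete operators need not exist. -/
lemma existsUnique_saddle {X Y : Type*} [AddCommGroup X] [Module ℝ X] [AddCommGroup Y] [Module ℝ Y]
    (P : Submodule ℝ X) (Q : Submodule ℝ Y) [FiniteDimensional ℝ P] [FiniteDimensional ℝ Q]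
    (S : Y → Y → ℝ) (B : X → Y → ℝ) (l : Y → ℝ)
    (hSl : ∀ y ∈ Q, ∀ y' ∈ Q, ∀ z ∈ Q, ∀ c : ℝ, S (c • y + y') z = c * S y z + S y' z)
    (hSr : ∀ y ∈ Q, ∀ y' ∈ Q, ∀ z ∈ Q, ∀ c : ℝ, S z (c • y + y') = c * S z y + S z y')
    (hBl : ∀ u ∈ P, ∀ u' ∈ P, ∀ z ∈ Q, ∀ c : ℝ, B (c • u + u') z = c * B u z + B u' z)
    (hBr : ∀ y ∈ Q, ∀ y' ∈ Q, ∀ u ∈ P, ∀ c : ℝ, B u (c • y + y') = c * B u y + B u y')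
    (hl : ∀ y ∈ Q, ∀ y' ∈ Q, ∀ c : ℝ, l (c • y + y') = c * l y + l y')
    (hinj : ∀ u ∈ P, ∀ y ∈ Q, (∀ z ∈ Q, S y z + B u z = 0) → (∀ v ∈ P, B v y = 0) →
      u = 0 ∧ y = 0) :
    ∃! p : X × Y, p.1 ∈ P ∧ p.2 ∈ Q ∧ (∀ z ∈ Q, S p.2 z + B p.1 z = l z) ∧
      ∀ v ∈ P, B v p.2 = 0 := by
  have S0r : ∀ y ∈ Q, S y 0 = 0 := fun y hy => by
    have := hSr 0 Q.zero_mem 0 Q.zero_mem y hy 1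
    simp only [smul_zero, add_zero, one_mul] at this
    linarith
  have S0l : ∀ y ∈ Q, S 0 y = 0 := fun y hy => by
    have := hSl 0 Q.zero_mem 0 Q.zero_mem y hy 1
    simp only [smul_zero, add_zero, one_mul] at this
    linarith
  have B0r : ∀ u ∈ P, B u 0 = 0 := fun u hu => by
    have := hBr 0 Q.zero_mem 0 Q.zero_mem u hu 1
    simp only [smul_zero, add_zero, one_mul] at this
    linarith
  have B0l : ∀ y ∈ Q, B 0 y = 0 := fun y hy => by
    have := hBl 0 P.zero_mem 0 P.zero_mem y hy 1
    simp only [smul_zero, add_zero, one_mul] at this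
    linarith
  have l0 : l 0 = 0 := by
    have := hl 0 Q.zero_mem 0 Q.zero_mem 1
    simp only [smul_zero, add_zero, one_mul] at this
    linarith
  let F : P × Q → P × Q → ℝ := fun p q => S p.2 q.2 + B p.1 q.2 + B q.1 p.2
  have hFl : ∀ p p' q c, F (c • p + p') q = c * F p q + F p' q := by
    intro p p' q c
    have h1 := hSl _ p.2.2 _ p'.2.2 _ q.2.2 c
    have h2 := hBl _ p.1.2 _ p'.1.2 _ q.2.2 c
    have h3 := hBr _ p.2.2 _ p'.2.2 _ q.1.2 c
    change S (c • p.2.1 + p'.2.1) q.2 + B (c • p.1.1 + p'.1.1) q.2 + B q.1 (c • p.2.1 + p'.2.1) = _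
    rw [h1, h2, h3]
    simp only [F]
    ring
  have hFr : ∀ p p' q c, F q (c • p + p') = c * F q p + F q p' := by
    intro p p' q c
    have h1 := hSr _ p.2.2 _ p'.2.2 _ q.2.2 c
    have h2 := hBl _ p.1.2 _ p'.1.2 _ q.2.2 c
    have h3 := hBr _ p.2.2 _ p'.2.2 _ q.1.2 c
    change S q.2 (c • p.2.1 + p'.2.1) + B q.1 (c • p.2.1 + p'.2.1) + B (c • p.1.1 + p'.1.1) q.2 = _
    rw [h1, h2, h3]
    simp only [F]
    ring
  have hF0l : ∀ q, F 0 q = 0 := fun q => by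
    simp [F, S0l _ q.2.2, B0l _ q.2.2, B0r _ q.1.2]
  have hF0r : ∀ q, F q 0 = 0 := fun q => by
    simp [F, S0r _ q.2.2, B0l _ q.2.2, B0r _ q.1.2]
  let FF : (P × Q) →ₗ[ℝ] (P × Q) →ₗ[ℝ] ℝ := LinearMap.mk₂ ℝ F
    (fun p p' q => by simpa using hFl p p' q 1)
    (fun c p q => by simpa [hF0l] using hFl p 0 q c)
    (fun q p p' => by simpa using hFr p p' q 1)
    (fun c q p => by simpa [hF0r] using hFr p 0 q c)
  let L : (P × Q) →ₗ[ℝ] ℝ :=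
    { toFun := fun q => l q.2
      map_add' := fun q q' => by simpa using hl _ q.2.2 _ q'.2.2 1
      map_smul' := fun c q => by simpa [l0] using hl _ q.2.2 0 Q.zero_mem c }
  have hFF : ∀ v, (∀ w, FF v w = 0) → v = 0 := by
    intro v hv
    -- Testing with `(0, z)` and with `(u, 0)` separates the two equations.
    obtain ⟨h1, h2⟩ := hinj v.1 v.1.2 v.2 v.2.2
      (fun z hz => by simpa [FF, F, B0l _ v.2.2] using hv (0, ⟨z, hz⟩))
      (fun u hu => by simpa [FF, F, S0r _ v.2.2, B0r _ v.1.2] using hv (⟨u, hu⟩, 0))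
    exact Prod.ext (Subtype.ext h1) (Subtype.ext h2)
  obtain ⟨v, hv, huniq⟩ := existsUnique_of_nondegenerate FF hFF L
  refine ⟨(v.1, v.2), ⟨v.1.2, v.2.2, fun z hz => ?_, fun u hu => ?_⟩, ?_⟩
  · simpa [FF, F, L, B0l _ v.2.2] using hv (0, ⟨z, hz⟩)
  · simpa [FF, F, L, S0r _ v.2.2, B0r _ v.1.2, l0] using hv (⟨u, hu⟩, 0)
  · rintro ⟨u, y⟩ ⟨hu, hy, h1, h2⟩
    have := huniq (⟨u, hu⟩, ⟨y, hy⟩) fun w => by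
      have e1 := h1 w.2.1 w.2.2
      have e2 := h2 w.1.1 w.1.2
      simp only at e1 e2
      simp [FF, F, L, e1, e2]
    rw [← this]

variable {d : ℕ}

lemma fg_polyOn (r : ℕ) (S : Set (Eu d)) : (polyOn r S).FG := by
  let φ : (Eu d → ℝ) →ₗ[ℝ] Eu d → ℝ :=
    { toFun := fun f => S.indicator f
      map_add' := fun f g => indicator_add' S f g
      map_smul' := fun c f => by ext x; by_cases h : x ∈ S <;> simp [h] }
  have : polyOn r S = (polyFun d r).map φ := by
    ext f
    constructor
    · rintro ⟨p, hp, rfl⟩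
      exact ⟨p, hp, rfl⟩
    · rintro ⟨p, hp, rfl⟩
      exact ⟨p, hp, rfl⟩
  rw [this]
  exact (Module.Finite.iff_fg.1 inferInstance).map _

namespace PolyMesh

variable {Ω : Set (Eu d)} (M : PolyMesh Ω)

instance (s : ℕ) : FiniteDimensional ℝ (M.Mh s) :=
  Module.Finite.iff_fg.2 (Submodule.fg_pi fun _ => Module.Finite.iff_fg.1 inferInstance)

instance (ΓD ΓN : Set (Eu d)) (k : ℕ) : FiniteDimensional ℝ (M.Wh0 ΓD ΓN k) := by
  have hfg : ((Submodule.pi univ fun _ : M.Cell => polyFun d k).prod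
      ((Submodule.pi univ fun e => polyOn k (M.face e)).prod
        (Submodule.pi univ fun _ : M.Cell =>
          Submodule.pi univ fun e => polyOn (k - 1) (M.face e)))).FG :=
    (Submodule.fg_pi fun _ => Module.Finite.iff_fg.1 inferInstance).prod
      ((Submodule.fg_pi fun _ => fg_polyOn _ _).prod
        (Submodule.fg_pi fun _ => Submodule.fg_pi fun _ => fg_polyOn _ _))
  have := Module.Finite.iff_fg.2 hfg
  refine Submodule.finiteDimensional_of_le (S₂ := (Submodule.pi univ fun _ : M.Cell =>
    polyFun d k).prod ((Submodule.pi univ fun e => polyOn k (M.face e)).prod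
      (Submodule.pi univ fun _ : M.Cell =>
        Submodule.pi univ fun e => polyOn (k - 1) (M.face e)))) fun w hw => ?_
  obtain ⟨⟨h1, h2, h3, h4, -⟩, -, -⟩ := hw
  refine ⟨fun T _ => h1 T, fun e _ => h2 e, fun T _ e _ => ?_⟩
  by_cases h : M.Inc T e
  · exact h3 T e h
  · rw [h4 T e h]; exact Submodule.zero_mem _

/-! ### Linearity -/

variable {k r : ℕ} {T : M.Cell}

lemma dualForm_lin_left (A : Matrix (Fin d) (Fin d) ℝ) (β : Eu d) {w : M.WeakFn}
    (hw : w ∈ M.Wh k) {u v : Eu d → ℝ} (hu : u ∈ polyFun d r) (hv : v ∈ polyFun d r) (c : ℝ) :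
    M.dualForm A β T (c • u + v) w = c * M.dualForm A β T u w + M.dualForm A β T v w := by
  have hwc := M.continuous_wh_cell hw T
  have i1 : ∀ u ∈ polyFun d r, IntegrableOn (fun x => w.1 T x * dvg (adjFlux A β u) x) (M.cell T) :=
    fun u hu => M.integrableOn_cell
      (hwc.mul (continuous_of_mem_polyFun (isPolyVec_adjFlux A β hu).dvg)) T
  have f1 : ∀ u ∈ polyFun d r, ∀ e, M.FaceCont e (fun x => w.2.2 T e x * u x -
      w.2.1 e x * inner ℝ (adjFlux A β u x) (M.normal T e)) := fun u hu e =>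
    ((faceCont_wn hw T e).mul (.of_continuous (continuous_of_mem_polyFun hu))).sub
      ((faceCont_wb hw e).mul (.of_continuous
        ((isPolyVec_adjFlux A β hu).continuous.inner continuous_const)))
  have b1 := M.bdryInt_lin (T := T) (fun e _ => f1 u hu e) (fun e _ => f1 v hv e) c
  have e1 : ∫ x in M.cell T, w.1 T x * dvg (adjFlux A β (c • u + v)) x =
      c * (∫ x in M.cell T, w.1 T x * dvg (adjFlux A β u) x) +
        ∫ x in M.cell T, w.1 T x * dvg (adjFlux A β v) x := by
    rw [← integral_const_mul, ← integral_add ((i1 u hu).const_mul c) (i1 v hv)]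
    congr 1; ext x
    rw [dvg_adjFlux_lin A β hu hv]; ring
  have e2 : M.bdryInt T (fun e x => w.2.2 T e x * (c • u + v) x -
      w.2.1 e x * inner ℝ (adjFlux A β (c • u + v) x) (M.normal T e)) =
      M.bdryInt T (fun e x => c * (w.2.2 T e x * u x -
        w.2.1 e x * inner ℝ (adjFlux A β u x) (M.normal T e)) +
        (w.2.2 T e x * v x - w.2.1 e x * inner ℝ (adjFlux A β v x) (M.normal T e))) := by
    congr 1; ext e x
    rw [adjFlux_lin A β hu hv, inner_add_left, real_inner_smul_left, Pi.add_apply, Pi.smul_apply,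
      smul_eq_mul]
    ring
  rw [dualForm, e1, e2, b1, dualForm, dualForm]
  ring

lemma dualForm_lin_right (A : Matrix (Fin d) (Fin d) ℝ) (β : Eu d) {w w' : M.WeakFn}
    (hw : w ∈ M.Wh k) (hw' : w' ∈ M.Wh k) {u : Eu d → ℝ} (hu : u ∈ polyFun d r) (c : ℝ) :
    M.dualForm A β T u (c • w + w') = c * M.dualForm A β T u w + M.dualForm A β T u w' := by
  have i1 : ∀ w ∈ M.Wh k, IntegrableOn (fun x => w.1 T x * dvg (adjFlux A β u) x) (M.cell T) :=
    fun w hw => M.integrableOn_cell ((M.continuous_wh_cell hw T).mul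
      (continuous_of_mem_polyFun (isPolyVec_adjFlux A β hu).dvg)) T
  have f1 : ∀ w ∈ M.Wh k, ∀ e, M.FaceCont e (fun x => w.2.2 T e x * u x -
      w.2.1 e x * inner ℝ (adjFlux A β u x) (M.normal T e)) := fun w hw e =>
    ((faceCont_wn hw T e).mul (.of_continuous (continuous_of_mem_polyFun hu))).sub
      ((faceCont_wb hw e).mul (.of_continuous
        ((isPolyVec_adjFlux A β hu).continuous.inner continuous_const)))
  have b1 := M.bdryInt_lin (T := T) (fun e _ => f1 w hw e) (fun e _ => f1 w' hw' e) c
  have e1 : ∫ x in M.cell T, (c • w + w').1 T x * dvg (adjFlux A β u) x =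
      c * (∫ x in M.cell T, w.1 T x * dvg (adjFlux A β u) x) +
        ∫ x in M.cell T, w'.1 T x * dvg (adjFlux A β u) x := by
    rw [← integral_const_mul, ← integral_add ((i1 w hw).const_mul c) (i1 w' hw')]
    congr 1; ext x
    change (c * w.1 T x + w'.1 T x) * _ = _
    ring
  have e2 : M.bdryInt T (fun e x => (c • w + w').2.2 T e x * u x -
      (c • w + w').2.1 e x * inner ℝ (adjFlux A β u x) (M.normal T e)) =
      M.bdryInt T (fun e x => c * (w.2.2 T e x * u x -
        w.2.1 e x * inner ℝ (adjFlux A β u x) (M.normal T e)) +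
        (w'.2.2 T e x * u x - w'.2.1 e x * inner ℝ (adjFlux A β u x) (M.normal T e))) := by
    congr 1; ext e x
    change (c * w.2.2 T e x + w'.2.2 T e x) * _ - (c * w.2.1 e x + w'.2.1 e x) * _ = _
    ring
  rw [dualForm, e1, e2, b1, dualForm, dualForm]
  ring

/-- `A ∇w₀ · n - w_n` for a constant coefficient `A`. -/
noncomputable def constDefect (A : Matrix (Fin d) (Fin d) ℝ) (T : M.Cell) (w : M.WeakFn)
    (e : M.Face) (x : Eu d) : ℝ :=
  inner ℝ (mv A (gradient (w.1 T) x)) (M.normal T e) - w.2.2 T e x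

/-- `∇ · (A ∇w) + β · ∇w` for constant coefficients. -/
noncomputable def constOp (A : Matrix (Fin d) (Fin d) ℝ) (β : Eu d) (w : Eu d → ℝ)
    (x : Eu d) : ℝ :=
  dvg (fun y => mv A (gradient w y)) x + inner ℝ β (gradient w x)

end PolyMesh

open PolyMesh

/-- The convective term makes the degree `r - 1` instead of `r - 2`. For `γ = 0` this is where `s =
k - 1` enters: the residual has to be an admissible test function. -/
lemma constOp_mem {A : Matrix (Fin d) (Fin d) ℝ} {β : Eu d} {r : ℕ} {w : Eu d → ℝ}
    (hw : w ∈ polyFun d r) : constOp A β w ∈ polyFun d (r - 1) := by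
  have h1 := ((isPolyVec_gradient hw).mv A).dvg
  have h2 := (isPolyVec_gradient hw).inner_const β
  have : constOp A β w = dvg (fun y => mv A (gradient w y)) + fun x => inner ℝ (gradient w x) β := by
    ext x; simp only [constOp, Pi.add_apply, real_inner_comm]
  rw [this]
  exact Submodule.add_mem _ (polyFun_mono (Nat.sub_le _ 1) h1) h2

lemma constOp_lin (A : Matrix (Fin d) (Fin d) ℝ) (β : Eu d) {r : ℕ} {u v : Eu d → ℝ}
    (hu : u ∈ polyFun d r) (hv : v ∈ polyFun d r) (c : ℝ) (x : Eu d) :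
    constOp A β (c • u + v) x = c * constOp A β u x + constOp A β v x := by
  have g : ∀ x, gradient (c • u + v) x = c • gradient u x + gradient v x :=
    gradient_lin (differentiable_of_mem_polyFun hu) (differentiable_of_mem_polyFun hv) c
  simp only [constOp, g, mv_add, mv_smul]
  rw [dvg_lin ((isPolyVec_gradient hu).mv A).differentiable
    ((isPolyVec_gradient hv).mv A).differentiable, inner_add_right, real_inner_smul_right]
  ring

namespace PolyMesh

variable {Ω : Set (Eu d)} (M : PolyMesh Ω) {k : ℕ} {T : M.Cell}

lemma constDefect_lin (A : Matrix (Fin d) (Fin d) ℝ) {w w' : M.WeakFn}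
    (hw : w ∈ M.Wh k) (hw' : w' ∈ M.Wh k) (c : ℝ) (e : M.Face) (x : Eu d) :
    M.constDefect A T (c • w + w') e x = c * M.constDefect A T w e x + M.constDefect A T w' e x := by
  have h1 : gradient ((c • w + w').1 T) x = c • gradient (w.1 T) x + gradient (w'.1 T) x :=
    gradient_lin (differentiable_of_mem_polyFun (hw.1 T))
      (differentiable_of_mem_polyFun (hw'.1 T)) c x
  rw [constDefect, h1, mv_add, mv_smul, inner_add_left, real_inner_smul_left]
  change _ - (c * w.2.2 T e x + w'.2.2 T e x) = _
  rw [constDefect, constDefect]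
  ring

lemma faceCont_constDefect (A : Matrix (Fin d) (Fin d) ℝ) {w : M.WeakFn} (hw : w ∈ M.Wh k)
    (e : M.Face) : M.FaceCont e (M.constDefect A T w e) :=
  (FaceCont.of_continuous (((isPolyVec_gradient (hw.1 T)).mv A).continuous.inner
    continuous_const)).sub (faceCont_wn hw T e)

/-- The local stabilizer for coefficients that are constant on `T`. -/
noncomputable def constStab (A : Matrix (Fin d) (Fin d) ℝ) (β : Eu d) (m γ : ℝ) (T : M.Cell)
    (v w : M.WeakFn) : ℝ :=
  (M.meshSize T ^ 3)⁻¹ * M.bdryInt T (fun e x =>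
      (m + |inner ℝ β (M.normal T e)|) * (v.1 T x - v.2.1 e x) * (w.1 T x - w.2.1 e x))
  + (M.meshSize T)⁻¹ * M.bdryInt T (fun e x => M.constDefect A T v e x * M.constDefect A T w e x)
  + γ * ∫ x in M.cell T, constOp A β (v.1 T) x * constOp A β (w.1 T) x

lemma constStab_comm (A : Matrix (Fin d) (Fin d) ℝ) (β : Eu d) (m γ : ℝ) (v w : M.WeakFn) :
    M.constStab A β m γ T v w = M.constStab A β m γ T w v := by
  simp only [constStab, mul_comm (M.constDefect A T v _ _), mul_comm (constOp A β (v.1 T) _),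
    mul_right_comm _ (v.1 T _ - v.2.1 _ _)]

lemma constStab_lin (A : Matrix (Fin d) (Fin d) ℝ) (β : Eu d) (m γ : ℝ) {v v' w : M.WeakFn}
    (hv : v ∈ M.Wh k) (hv' : v' ∈ M.Wh k) (hw : w ∈ M.Wh k) (c : ℝ) :
    M.constStab A β m γ T (c • v + v') w =
      c * M.constStab A β m γ T v w + M.constStab A β m γ T v' w := by
  have j : ∀ v ∈ M.Wh k, ∀ e, M.FaceCont e (fun x => v.1 T x - v.2.1 e x) := fun v hv e =>
    (FaceCont.of_continuous (M.continuous_wh_cell hv T)).sub (faceCont_wb hv e)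
  have f1 : ∀ v ∈ M.Wh k, ∀ e, M.FaceCont e (fun x =>
      (m + |inner ℝ β (M.normal T e)|) * (v.1 T x - v.2.1 e x) * (w.1 T x - w.2.1 e x)) :=
    fun v hv e => ((FaceCont.of_continuous continuous_const).mul (j v hv e)).mul (j w hw e)
  have f2 : ∀ v ∈ M.Wh k, ∀ e, M.FaceCont e (fun x =>
      M.constDefect A T v e x * M.constDefect A T w e x) :=
    fun v hv e => (M.faceCont_constDefect A hv e).mul (M.faceCont_constDefect A hw e)
  have i1 : ∀ v ∈ M.Wh k, IntegrableOn (fun x => constOp A β (v.1 T) x * constOp A β (w.1 T) x)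
      (M.cell T) := fun v hv => M.integrableOn_cell
    ((continuous_of_mem_polyFun (constOp_mem (hv.1 T))).mul
      (continuous_of_mem_polyFun (constOp_mem (hw.1 T)))) T
  have b1 := M.bdryInt_lin (T := T) (fun e _ => f1 v hv e) (fun e _ => f1 v' hv' e) c
  have b2 := M.bdryInt_lin (T := T) (fun e _ => f2 v hv e) (fun e _ => f2 v' hv' e) c
  have e1 : M.bdryInt T (fun e x => (m + |inner ℝ β (M.normal T e)|) *
      ((c • v + v').1 T x - (c • v + v').2.1 e x) * (w.1 T x - w.2.1 e x)) =
      c * M.bdryInt T (fun e x => (m + |inner ℝ β (M.normal T e)|) *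
        (v.1 T x - v.2.1 e x) * (w.1 T x - w.2.1 e x)) +
      M.bdryInt T (fun e x => (m + |inner ℝ β (M.normal T e)|) *
        (v'.1 T x - v'.2.1 e x) * (w.1 T x - w.2.1 e x)) := by
    refine Eq.trans ?_ b1
    congr 1; ext e x
    change _ * (c * v.1 T x + v'.1 T x - (c * v.2.1 e x + v'.2.1 e x)) * _ = _
    ring
  have e2 : M.bdryInt T (fun e x => M.constDefect A T (c • v + v') e x *
      M.constDefect A T w e x) =
      c * M.bdryInt T (fun e x => M.constDefect A T v e x * M.constDefect A T w e x) +
        M.bdryInt T (fun e x => M.constDefect A T v' e x * M.constDefect A T w e x) := by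
    refine Eq.trans ?_ b2
    congr 1; ext e x
    rw [M.constDefect_lin A hv hv']; ring
  have e3 : ∫ x in M.cell T, constOp A β ((c • v + v').1 T) x * constOp A β (w.1 T) x =
      c * (∫ x in M.cell T, constOp A β (v.1 T) x * constOp A β (w.1 T) x) +
        ∫ x in M.cell T, constOp A β (v'.1 T) x * constOp A β (w.1 T) x := by
    rw [← integral_const_mul, ← integral_add ((i1 v hv).const_mul c) (i1 v' hv')]
    congr 1; ext x
    have := constOp_lin A β (hv.1 T) (hv'.1 T) c x
    change constOp A β (c • v.1 T + v'.1 T) x * _ = _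
    rw [this]; ring
  rw [constStab, e1, e2, e3, constStab, constStab]
  ring

/-- The trace from inside a cell of a constant coefficient is that constant, so the coefficients may
be frozen on each cell. -/
lemma stab_eq {a : Eu d → Matrix (Fin d) (Fin d) ℝ} {b : Eu d → Eu d}
    {A : M.Cell → Matrix (Fin d) (Fin d) ℝ} {β : M.Cell → Eu d}
    (ha : ∀ T, ∀ x ∈ M.cell T, a x = A T) (hb : ∀ T, ∀ x ∈ M.cell T, b x = β T)
    (γ : ℝ) (v w : M.WeakFn) :
    M.stab a b γ v w = ∑ T, M.constStab (A T) (β T) (M.supNorm a T) γ T v w := by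
  refine Finset.sum_congr rfl fun T _ => ?_
  have tra : ∀ e, M.Inc T e → ∀ x ∈ M.face e, M.tr T a x = A T := fun e he x hx =>
    M.tr_eq (ha T) (M.face_subset_closure he hx)
  have trb : ∀ e, M.Inc T e → ∀ x ∈ M.face e, M.tr T b x = β T := fun e he x hx =>
    M.tr_eq (hb T) (M.face_subset_closure he hx)
  have hres : ∀ w : M.WeakFn, ∀ x ∈ M.cell T, M.residual a b T w x =
      constOp (A T) (β T) (w.1 T) x := fun w x hx => by
    rw [residual, M.diffOp_eq (ha T) _ hx, hb T x hx, constOp]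
  rw [stabT, constStab]
  congr 1
  · congr 1
    · congr 1
      exact M.bdryInt_congr fun e he x hx => by rw [trb e he x hx]
    · congr 1
      exact M.bdryInt_congr fun e he x hx => by
        rw [fluxDefect, fluxDefect, tra e he x hx, constDefect, constDefect]
  · congr 1
    exact setIntegral_congr_fun (M.measurableSet_cell T) fun x hx => by
      simp only [hres _ x hx]

/-- The components of a weak function are continuous on cells and faces, hence bounded there, and
their products with integrable data are integrable. -/
lemma load_lin {ΓD ΓN : Set (Eu d)} {f g₁ g₂ : Eu d → ℝ} (hf : IntegrableOn f Ω)
    (hg₁ : IntegrableOn g₁ ΓD (surf d)) (hg₂ : IntegrableOn g₂ ΓN (surf d)) {w w' : M.WeakFn}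
    (hw : w ∈ M.Wh k) (hw' : w' ∈ M.Wh k) (c : ℝ) :
    M.load ΓD ΓN f g₁ g₂ (c • w + w') = c * M.load ΓD ΓN f g₁ g₂ w + M.load ΓD ΓN f g₁ g₂ w' := by
  classical
  have i0 : ∀ w ∈ M.Wh k, ∀ T, IntegrableOn (fun x => f x * w.1 T x) (M.cell T) := fun w hw T =>
    M.integrableOn_cell_mul (M.continuous_wh_cell hw T) (hf.mono_set (M.cell_subset T))
  have e1 : (∑ T, ∫ x in M.cell T, f x * (c • w + w').1 T x) =
      c * (∑ T, ∫ x in M.cell T, f x * w.1 T x) + ∑ T, ∫ x in M.cell T, f x * w'.1 T x := by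
    rw [Finset.mul_sum, ← Finset.sum_add_distrib]
    refine Finset.sum_congr rfl fun T _ => ?_
    rw [← integral_const_mul, ← integral_add ((i0 w hw T).const_mul c) (i0 w' hw' T)]
    congr 1; ext x
    change _ * (c * w.1 T x + w'.1 T x) = _
    ring
  have e2 : (∑ e, if M.face e ⊆ ΓN then
        ∫ x in M.face e, g₂ x * (c • w + w').2.1 e x ∂(surf d) else 0) =
      c * (∑ e, if M.face e ⊆ ΓN then ∫ x in M.face e, g₂ x * w.2.1 e x ∂(surf d) else 0) +
      ∑ e, if M.face e ⊆ ΓN then ∫ x in M.face e, g₂ x * w'.2.1 e x ∂(surf d) else 0 := by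
    rw [Finset.mul_sum, ← Finset.sum_add_distrib]
    refine Finset.sum_congr rfl fun e _ => ?_
    split_ifs with h
    · rw [← integral_const_mul, ← integral_add
        (((faceCont_wb hw e).integrableOn_mul (hg₂.mono_set h)).const_mul c)
        ((faceCont_wb hw' e).integrableOn_mul (hg₂.mono_set h))]
      congr 1; ext x
      change _ * (c * w.2.1 e x + w'.2.1 e x) = _
      ring
    · ring
  have e3 : (∑ T, ∑ e, if M.Inc T e ∧ M.face e ⊆ ΓD then
        ∫ x in M.face e, g₁ x * (c • w + w').2.2 T e x ∂(surf d) else 0) =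
      c * (∑ T, ∑ e, if M.Inc T e ∧ M.face e ⊆ ΓD then
        ∫ x in M.face e, g₁ x * w.2.2 T e x ∂(surf d) else 0) +
      ∑ T, ∑ e, if M.Inc T e ∧ M.face e ⊆ ΓD then
        ∫ x in M.face e, g₁ x * w'.2.2 T e x ∂(surf d) else 0 := by
    simp only [Finset.mul_sum]
    rw [← Finset.sum_add_distrib]
    refine Finset.sum_congr rfl fun T _ => ?_
    rw [← Finset.sum_add_distrib]
    refine Finset.sum_congr rfl fun e _ => ?_
    split_ifs with h
    · rw [← integral_const_mul, ← integral_add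
        (((faceCont_wn hw T e).integrableOn_mul (hg₁.mono_set h.2)).const_mul c)
        ((faceCont_wn hw' T e).integrableOn_mul (hg₁.mono_set h.2))]
      congr 1; ext x
      change _ * (c * w.2.2 T e x + w'.2.2 T e x) = _
      ring
    · ring
  rw [load, e1, e2, e3, load, load]
  ring

/-- The scheme is a square linear system, so it is uniquely solvable if the homogeneous problem has
only the trivial solution. -/
theorem existsUnique_isSolution {a : Eu d → Matrix (Fin d) (Fin d) ℝ} {b : Eu d → Eu d}
    {A : M.Cell → Matrix (Fin d) (Fin d) ℝ} {β : M.Cell → Eu d}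
    (ha : ∀ T, ∀ x ∈ M.cell T, a x = A T) (hb : ∀ T, ∀ x ∈ M.cell T, b x = β T)
    {ΓD ΓN : Set (Eu d)} {f g₁ g₂ : Eu d → ℝ} (hf : IntegrableOn f Ω)
    (hg₁ : IntegrableOn g₁ ΓD (surf d)) (hg₂ : IntegrableOn g₂ ΓN (surf d)) (γ : ℝ) {s : ℕ}
    (hs : s ≤ k - 1)
    (hinj : ∀ u ∈ M.Mh s, ∀ v ∈ M.Wh0 ΓD ΓN k,
      (∀ w ∈ M.Wh0 ΓD ΓN k, ∑ T, M.constStab (A T) (β T) (M.supNorm a T) γ T v w +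
        ∑ T, M.dualForm (A T) (β T) T (u T) w = 0) →
      (∀ u' ∈ M.Mh s, ∑ T, M.dualForm (A T) (β T) T (u' T) v = 0) → u = 0 ∧ v = 0) :
    ∃! p : (M.Cell → Eu d → ℝ) × M.WeakFn, M.IsSolution ΓD ΓN a b γ k s f g₁ g₂ p := by
  refine existsUnique_saddle (M.Mh s) (M.Wh0 ΓD ΓN k) (M.stab a b γ) (M.bForm a b k s)
    (M.load ΓD ΓN f g₁ g₂) ?_ ?_ ?_ ?_ (fun y hy y' hy' c => M.load_lin hf hg₁ hg₂ hy.1 hy'.1 c) ?_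
  · intro y hy y' hy' z hz c
    simp only [M.stab_eq ha hb]
    rw [Finset.mul_sum, ← Finset.sum_add_distrib]
    exact Finset.sum_congr rfl fun T _ => M.constStab_lin _ _ _ _ hy.1 hy'.1 hz.1 c
  · intro y hy y' hy' z hz c
    simp only [M.stab_eq ha hb]
    rw [Finset.mul_sum, ← Finset.sum_add_distrib]
    refine Finset.sum_congr rfl fun T _ => ?_
    simp only [M.constStab_comm _ _ _ _ z]
    exact M.constStab_lin _ _ _ _ hy.1 hy'.1 hz.1 c
  · intro u hu u' hu' z hz c
    rw [M.bForm_eq hz.1 ha hb hs hu, M.bForm_eq hz.1 ha hb hs hu',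
      M.bForm_eq hz.1 ha hb hs (Submodule.add_mem _ (Submodule.smul_mem _ c hu) hu'),
      Finset.mul_sum, ← Finset.sum_add_distrib]
    exact Finset.sum_congr rfl fun T _ =>
      M.dualForm_lin_left _ _ hz.1 (hu T (mem_univ T)) (hu' T (mem_univ T)) c
  · intro y hy y' hy' u hu c
    rw [M.bForm_eq hy.1 ha hb hs hu, M.bForm_eq hy'.1 ha hb hs hu,
      M.bForm_eq (Submodule.add_mem _ (Submodule.smul_mem _ c hy.1) hy'.1) ha hb hs hu,
      Finset.mul_sum, ← Finset.sum_add_distrib]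
    exact Finset.sum_congr rfl fun T _ =>
      M.dualForm_lin_right _ _ hy.1 hy'.1 (hu T (mem_univ T)) c
  · intro u hu y hy h1 h2
    refine hinj u hu y hy (fun w hw => ?_) (fun u' hu' => ?_)
    · rw [← h1 w hw, M.stab_eq ha hb, M.bForm_eq hw.1 ha hb hs hu]
    · rw [← h2 u' hu', M.bForm_eq hy.1 ha hb hs hu']

end PolyMesh
end PDWG

/-! ### Definiteness of the stabilizer and uniqueness for the dual problem -/

namespace PDWG

variable {d : ℕ}

namespace PolyMesh

variable {Ω : Set (Eu d)} (M : PolyMesh Ω) {k r : ℕ} {T : M.Cell}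

lemma bdryInt_nonneg {F : M.Face → Eu d → ℝ} (hF : ∀ e, M.Inc T e → ∀ x, 0 ≤ F e x) :
    0 ≤ M.bdryInt T F := by
  classical
  refine Finset.sum_nonneg fun e _ => ?_
  split_ifs with h
  · exact integral_nonneg (hF e h)
  · exact le_rfl

lemma integral_eq_zero_of_bdryInt_eq_zero {F : M.Face → Eu d → ℝ}
    (hF : ∀ e, M.Inc T e → ∀ x, 0 ≤ F e x) (h0 : M.bdryInt T F = 0) {e : M.Face}
    (he : M.Inc T e) : ∫ x in M.face e, F e x ∂(surf d) = 0 := by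
  classical
  have := (Finset.sum_eq_zero_iff_of_nonneg (fun e _ => ?_)).1 h0 e (Finset.mem_univ e)
  · rwa [if_pos he] at this
  · split_ifs with h
    · exact integral_nonneg (hF e h)
    · exact le_rfl

variable {M} in
lemma FaceCont.eq_zero {e : M.Face} {g : Eu d → ℝ} (hg : M.FaceCont e g)
    (h : ∫ x in M.face e, g x ^ 2 ∂(surf d) = 0) : ∀ x ∈ M.face e, g x = 0 := by
  obtain ⟨p, hp, hgp⟩ := hg
  intro x hx
  rw [hgp x hx]
  refine M.eq_zero_on_face hp ?_ x hx
  rw [← h]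
  exact setIntegral_congr_fun (M.measurableSet_face e) fun y hy => by simp only [hgp y hy]

lemma meshSize_pos [NeZero d] (T : M.Cell) : 0 < M.meshSize T := by
  have : Nonempty (Fin d) := ⟨0⟩
  have : Nontrivial (Eu d) := inferInstance
  obtain ⟨x, hx⟩ := M.cell_nonempty T
  exact Metric.diam_pos
    (infinite_of_mem_nhds x ((M.cell_polyhedral T).isOpen.mem_nhds hx)).nontrivial
    (M.cell_polyhedral T).isBounded

/-- Coercivity at a unit coordinate vector excludes `A = 0`. The weight of `v_0 - v_b` in the
stabilizer is therefore positive even on faces parallel to the convection. -/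
lemma supNorm_pos [NeZero d] {a : Eu d → Matrix (Fin d) (Fin d) ℝ} {A : Matrix (Fin d) (Fin d) ℝ}
    (ha : ∀ x ∈ M.cell T, a x = A) {α : ℝ} (hα : 0 < α)
    (hA : ∀ ξ : Eu d, α * ‖ξ‖ ^ 2 ≤ inner ℝ ξ (mv A ξ)) : 0 < M.supNorm a T := by
  have : Nonempty (M.cell T) := (M.cell_nonempty T).to_subtype
  have h1 : M.supNorm a T = Real.sqrt (∑ i, ∑ j, A i j ^ 2) := by
    rw [supNorm, ← ciSup_const (ι := M.cell T) (a := Real.sqrt (∑ i, ∑ j, A i j ^ 2))]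
    congr 1; ext x
    rw [ha x x.2]
  rw [h1, Real.sqrt_pos]
  refine lt_of_le_of_ne (Finset.sum_nonneg fun i _ => Finset.sum_nonneg fun j _ => sq_nonneg _) ?_
  intro h0
  have hz : A = 0 := by
    ext i j
    have h2 := (Finset.sum_eq_zero_iff_of_nonneg
      (fun i _ => Finset.sum_nonneg fun j _ => sq_nonneg (A i j))).1 h0.symm i (Finset.mem_univ i)
    have h3 := (Finset.sum_eq_zero_iff_of_nonneg (fun j _ => sq_nonneg (A i j))).1 h2 j
      (Finset.mem_univ j)
    simpa using h3
  have h4 := hA (EuclideanSpace.single 0 1)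
  have h5 : mv A (EuclideanSpace.single 0 1) = 0 := by
    rw [hz]; ext i; simp [mv]
  rw [h5, inner_zero_right] at h4
  simp only [PiLp.norm_single, norm_one, one_pow, mul_one] at h4
  linarith

lemma faceCont_sub {v : M.WeakFn} (hv : v ∈ M.Wh k) (e : M.Face) :
    M.FaceCont e fun x => v.1 T x - v.2.1 e x :=
  (FaceCont.of_continuous (M.continuous_wh_cell hv T)).sub (faceCont_wb hv e)

lemma constStab_self_nonneg [NeZero d] (A : Matrix (Fin d) (Fin d) ℝ) (β : Eu d) {m γ : ℝ}
    (hm : 0 < m) (hγ : 0 ≤ γ) (v : M.WeakFn) : 0 ≤ M.constStab A β m γ T v v := by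
  have hh := M.meshSize_pos T
  refine add_nonneg (add_nonneg (mul_nonneg (by positivity) (M.bdryInt_nonneg fun e _ x => ?_))
    (mul_nonneg (by positivity) (M.bdryInt_nonneg fun e _ x => mul_self_nonneg _)))
    (mul_nonneg hγ (integral_nonneg fun x => mul_self_nonneg _))
  rw [mul_assoc]
  exact mul_nonneg (by positivity) (mul_self_nonneg _)

/-- A sum of nonnegative terms vanishes, so each term and each face integral does. The face
integrands are squares, with positive weights, of functions continuous on the face, so they vanish
at every point and not just almost everywhere. -/
lemma of_constStab_self_eq_zero [NeZero d] {A : Matrix (Fin d) (Fin d) ℝ} {β : Eu d} {m γ : ℝ}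
    (hm : 0 < m) (hγ : 0 ≤ γ) {v : M.WeakFn} (hv : v ∈ M.Wh k)
    (h : M.constStab A β m γ T v v = 0) :
    (∀ e, M.Inc T e → ∀ x ∈ M.face e, v.1 T x = v.2.1 e x) ∧
    (∀ e, M.Inc T e → ∀ x ∈ M.face e, inner ℝ (mv A (gradient (v.1 T) x)) (M.normal T e) =
      v.2.2 T e x) ∧
    (0 < γ → ∀ x ∈ M.cell T, constOp A β (v.1 T) x = 0) := by
  have hh := M.meshSize_pos T
  have p1 : ∀ e, M.Inc T e → ∀ x, 0 ≤ (m + |inner ℝ β (M.normal T e)|) *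
      (v.1 T x - v.2.1 e x) * (v.1 T x - v.2.1 e x) := fun e _ x => by
    rw [mul_assoc]
    exact mul_nonneg (by positivity) (mul_self_nonneg _)
  have p2 : ∀ e, M.Inc T e → ∀ x, 0 ≤ M.constDefect A T v e x * M.constDefect A T v e x :=
    fun e _ x => mul_self_nonneg _
  have q1 := mul_nonneg (show 0 ≤ (M.meshSize T ^ 3)⁻¹ by positivity) (M.bdryInt_nonneg p1)
  have q2 := mul_nonneg (show 0 ≤ (M.meshSize T)⁻¹ by positivity) (M.bdryInt_nonneg p2)
  have q3 : 0 ≤ γ * ∫ x in M.cell T, constOp A β (v.1 T) x * constOp A β (v.1 T) x :=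
    mul_nonneg hγ (integral_nonneg fun x => mul_self_nonneg _)
  rw [constStab] at h
  have key : ∀ x y z : ℝ, 0 ≤ x → 0 ≤ y → 0 ≤ z → x + y + z = 0 → x = 0 ∧ y = 0 ∧ z = 0 :=
    fun x y z _ _ _ _ => ⟨by linarith, by linarith, by linarith⟩
  obtain ⟨y1, y2, y3⟩ := key _ _ _ q1 q2 q3 h
  have z1 := (mul_eq_zero.1 y1).resolve_left (by positivity)
  have z2 := (mul_eq_zero.1 y2).resolve_left (by positivity)
  refine ⟨fun e he x hx => ?_, fun e he x hx => ?_, fun hγ' => ?_⟩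
  · have := M.integral_eq_zero_of_bdryInt_eq_zero p1 z1 he
    simp only [mul_assoc] at this
    rw [integral_const_mul, mul_eq_zero] at this
    have h2 := this.resolve_left (by positivity)
    simp only [← pow_two] at h2
    exact sub_eq_zero.1 ((M.faceCont_sub hv e).eq_zero h2 x hx)
  · have h2 := M.integral_eq_zero_of_bdryInt_eq_zero p2 z2 he
    simp only [← pow_two] at h2
    exact sub_eq_zero.1 ((M.faceCont_constDefect A hv e).eq_zero h2 x hx)
  · have z3 := (mul_eq_zero.1 y3).resolve_left hγ'.ne'
    simp only [← pow_two] at z3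
    exact M.eq_zero_on_cell (continuous_of_mem_polyFun (constOp_mem (hv.1 T))) z3

/-- On conforming weak functions, the discrete form is the exact one. -/
lemma dualForm_of_conforming {A : Matrix (Fin d) (Fin d) ℝ} (hA : A.IsSymm) (β : Eu d)
    {v : M.WeakFn} (hv : v ∈ M.Wh k) {u : Eu d → ℝ} (hu : u ∈ polyFun d r)
    (hb : ∀ e, M.Inc T e → ∀ x ∈ M.face e, v.1 T x = v.2.1 e x)
    (hn : ∀ e, M.Inc T e → ∀ x ∈ M.face e, inner ℝ (mv A (gradient (v.1 T) x)) (M.normal T e) =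
      v.2.2 T e x) :
    M.dualForm A β T u v = ∫ x in M.cell T, u x * constOp A β (v.1 T) x := by
  have hgv : IsPolyVec (k - 1) fun x => mv A (gradient (v.1 T) x) :=
    (isPolyVec_gradient (hv.1 T)).mv A
  have hfl := isPolyVec_adjFlux A β hu
  have vc : ContDiff ℝ 1 (v.1 T) := contDiff_of_mem_polyFun (hv.1 T)
  have uc : ContDiff ℝ 1 u := contDiff_of_mem_polyFun hu
  -- Gauss' theorem for `u A∇v` and for `v (A∇u - u β)`. On a conforming function the difference of
  -- the two boundary terms is exactly the boundary term of the discrete form.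
  have g1 := M.integral_dvg_cell T (F := fun y => u y • mv A (gradient (v.1 T) y))
    (uc.smul hgv.contDiff)
  have g2 := M.integral_dvg_cell T (F := fun y => v.1 T y • adjFlux A β u y)
    (vc.smul hfl.contDiff)
  have f1 : ∀ e, M.FaceCont e
      (fun x => inner ℝ (u x • mv A (gradient (v.1 T) x)) (M.normal T e)) := fun e =>
    .of_continuous ((uc.continuous.smul hgv.continuous).inner continuous_const)
  have f2 : ∀ e, M.FaceCont e
      (fun x => inner ℝ (v.1 T x • adjFlux A β u x) (M.normal T e)) := fun e =>
    .of_continuous ((vc.continuous.smul hfl.continuous).inner continuous_const)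
  have b1 := M.bdryInt_lin (T := T) (fun e _ => f2 e) (fun e _ => f1 e) (-1)
  have e1 : M.bdryInt T (fun e x => v.2.2 T e x * u x -
      v.2.1 e x * inner ℝ (adjFlux A β u x) (M.normal T e)) =
      - (∫ x in M.cell T, dvg (fun y => v.1 T y • adjFlux A β u y) x) +
      ∫ x in M.cell T, dvg (fun y => u y • mv A (gradient (v.1 T) y)) x := by
    rw [g1, g2, ← neg_one_mul, ← b1]
    refine M.bdryInt_congr fun e he x hx => ?_
    rw [← hb e he x hx, ← hn e he x hx, real_inner_smul_left, real_inner_smul_left]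
    ring
  have i1 : IntegrableOn (fun x => v.1 T x * dvg (adjFlux A β u) x) (M.cell T) :=
    M.integrableOn_cell (vc.continuous.mul (continuous_of_mem_polyFun hfl.dvg)) T
  have i2 : IntegrableOn (fun x => dvg (fun y => v.1 T y • adjFlux A β u y) x) (M.cell T) :=
    M.integrableOn_cell (continuous_dvg (vc.smul hfl.contDiff)) T
  have i3 : IntegrableOn (fun x => dvg (fun y => u y • mv A (gradient (v.1 T) y)) x)
      (M.cell T) := M.integrableOn_cell (continuous_dvg (uc.smul hgv.contDiff)) T
  have i4 : IntegrableOn (fun x => dvg (fun y => u y • mv A (gradient (v.1 T) y)) x -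
      dvg (fun y => v.1 T y • adjFlux A β u y) x) (M.cell T) := i3.sub i2
  rw [dualForm, e1, neg_add_eq_sub, ← integral_sub i3 i2, ← integral_add i1 i4]
  congr 1; ext x
  -- By symmetry of `A` the products of the two gradients cancel.
  rw [dvg_mul (vc.differentiable one_ne_zero) hfl.differentiable,
    dvg_mul (uc.differentiable one_ne_zero) hgv.differentiable, constOp, adjFlux, inner_sub_left,
    real_inner_smul_left, inner_mv_comm hA, real_inner_comm (mv A _)]
  ring

lemma eq_zero_of_ae {p : M.Cell → Eu d → ℝ}
    (hae : ∀ᵐ x ∂(volume.restrict Ω), M.pw p x = 0) (hp : p T ∈ polyFun d r) : p T = 0 := by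
  have h1 : ∀ᵐ x ∂(volume.restrict (M.cell T)), p T x ^ 2 = 0 := by
    filter_upwards [ae_restrict_of_ae_restrict_of_subset (M.cell_subset T) hae,
      ae_restrict_mem (M.measurableSet_cell T)] with x hx hxT
    rw [M.pw_eq p hxT] at hx
    rw [hx, zero_pow two_ne_zero]
  exact polyFun_eq_zero hp (M.cell_polyhedral T).isOpen (M.cell_nonempty T)
    (M.eq_zero_on_cell (continuous_of_mem_polyFun hp) (by rw [integral_congr_ae h1]; simp))

/-- The two normal fluxes are the two values of `v_n`, which add up to zero in `W_h`. -/
lemma jump_flux_eq_zero_interior (hΩ : IsOpen Ω) {A : M.Cell → Matrix (Fin d) (Fin d) ℝ}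
    {v : M.WeakFn} (hv : v ∈ M.Wh k) (hn : ∀ T e, M.Inc T e → ∀ x ∈ M.face e,
      inner ℝ (mv (A T) (gradient (v.1 T) x)) (M.normal T e) = v.2.2 T e x) {e : M.Face}
    (he : M.face e ⊆ Ω) {x : Eu d} (hx : x ∈ M.face e) :
    M.jump (fun T y => mv (A T) (gradient (v.1 T) y)) e x = 0 := by
  obtain ⟨T, hT⟩ := M.face_mem e
  obtain ⟨T', hne, hT'⟩ := M.exists_neighbour hΩ hT he
  rw [jump, M.sum_inc_interior hne hT hT', hn T e hT x hx, hn T' e hT' x hx]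
  exact congrFun (hv.2.2.2.2 T T' e hne hT hT') x

/-- A conforming weak function with zero residual vanishes, by uniqueness for the dual problem. -/
lemma eq_zero_of_conforming (hΩ : IsPolyhedralDomain Ω) (hLip : HasLipschitzBoundary Ω)
    {ΓD ΓN : Set (Eu d)} (hΓ : M.IsBoundaryPartition ΓD ΓN)
    {a : Eu d → Matrix (Fin d) (Fin d) ℝ} {b : Eu d → Eu d}
    {A : M.Cell → Matrix (Fin d) (Fin d) ℝ} {β : M.Cell → Eu d}
    (ha : ∀ T, ∀ x ∈ M.cell T, a x = A T) (hb : ∀ T, ∀ x ∈ M.cell T, b x = β T) {ε : ℝ}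
    (hreg : DualRegular Ω ΓD a b ε) {v : M.WeakFn} (hv : v ∈ M.Wh0 ΓD ΓN k)
    (hc : ∀ T e, M.Inc T e → ∀ x ∈ M.face e, v.1 T x = v.2.1 e x)
    (hn : ∀ T e, M.Inc T e → ∀ x ∈ M.face e,
      inner ℝ (mv (A T) (gradient (v.1 T) x)) (M.normal T e) = v.2.2 T e x)
    (hres : ∀ T, ∀ x ∈ M.cell T, constOp (A T) (β T) (v.1 T) x = 0) : v = 0 := by
  have vc : ∀ T, ContDiff ℝ 1 (v.1 T) := fun T => contDiff_of_mem_polyFun (hv.1.1 T)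
  have hgv : ∀ T, ContDiff ℝ 1 fun x => mv (A T) (gradient (v.1 T) x) := fun T =>
    ((isPolyVec_gradient (hv.1.1 T)).mv (A T)).contDiff
  have hcont : ∀ e, M.face e ⊆ Ω → ∀ T T', M.Inc T e → M.Inc T' e → ∀ x ∈ M.face e,
      v.1 T x = v.1 T' x := fun e _ T T' h h' x hx => by
    rw [hc T e h x hx, hc T' e h' x hx]
  have hAx : ∀ T, ∀ x ∈ M.cell T, mv (a x) (M.pw (fun T => gradient (v.1 T)) x) =
      mv (A T) (gradient (v.1 T) x) := fun T x hx => by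
    rw [ha T x hx, M.pw_eq _ hx]
  have hgx : ∀ T, ∀ x ∈ M.cell T,
      M.pw (fun T => dvg fun x => mv (A T) (gradient (v.1 T) x)) x =
      dvg (fun x => mv (A T) (gradient (v.1 T) x)) x := fun T x hx => M.pw_eq _ hx
  -- Each part of the definition comes from a property of `v`: `v_b` is single-valued and zero on
  -- `Γ_D`, the values of `v_n` on the two sides cancel and are zero on `Γ_N`, and the equation
  -- holds on each cell by `hres`.
  have hsol : IsDualSolution Ω ΓD a b ε 0 (M.pw v.1) := by
    refine ⟨M.pw fun T => gradient (v.1 T),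
      M.pw fun T => dvg fun x => mv (A T) (gradient (v.1 T) x),
      M.hasWeakGrad_of_continuous hΩ.isOpen hΩ.isBounded vc hcont,
      M.hasWeakDiv_of_jump hΩ.isOpen hΩ.isBounded hgv
        (fun e he x hx => M.jump_flux_eq_zero_interior hΩ.isOpen hv.1 hn he hx) hAx hgx,
      M.traceZeroOn_of_continuous hΩ.isOpen hΩ.isBounded hLip hΓ vc hcont
        (fun e he T hT x hx => by rw [hc T e hT x hx, hv.2.1 e he]; rfl),
      fun z Gz hz hz0 => M.integral_flux_eq_zero hΩ.isOpen hΩ.isBounded hgv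
        (fun e he x hx => ?_) (hΓ.union ▸ subset_union_left) hAx hgx hz hz0, fun z _ => ?_⟩
    · rcases M.face_position e with hi | hbd
      · exact M.jump_flux_eq_zero_interior hΩ.isOpen hv.1 hn hi hx
      · have hN := (hΓ.resolved e hbd).resolve_left he
        obtain ⟨T, hT⟩ := M.face_mem e
        rw [jump, M.sum_inc_boundary hΩ.interior_closure hbd hT, hn T e hT x hx, hv.2.2 T e hN]
        rfl
    · have h1 : ∀ᵐ x ∂(volume.restrict Ω), z x *
          (M.pw (fun T => dvg fun x => mv (A T) (gradient (v.1 T) x)) x +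
            inner ℝ (b x) (M.pw (fun T => gradient (v.1 T)) x)) = 0 :=
        M.ae_restrict_of_cells fun T x hx => by
          have := hres T x hx
          rw [constOp] at this
          rw [hgx T x hx, hb T x hx, M.pw_eq _ hx, this, mul_zero]
      rw [integral_congr_ae h1]
      simp
  have hae := hreg.ae_eq_zero hsol
  have h0 : ∀ T, v.1 T = 0 := fun T => M.eq_zero_of_ae hae (hv.1.1 T)
  -- On a face, `v_b` and `v_n` are determined by `v_0 = 0`; off the face they are zero as members
  -- of `polyOn`.
  refine Prod.ext (funext h0) (Prod.ext (funext fun e => ?_) (funext fun T => funext fun e => ?_))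
  · obtain ⟨T, hT⟩ := M.face_mem e
    obtain ⟨p, -, hp⟩ := hv.1.2.1 e
    ext x
    by_cases hx : x ∈ M.face e
    · rw [← hc T e hT x hx, h0 T]; rfl
    · rw [hp, indicator_of_notMem hx]; rfl
  · by_cases hT : M.Inc T e
    · obtain ⟨p, -, hp⟩ := hv.1.2.2.1 T e hT
      ext x
      by_cases hx : x ∈ M.face e
      · rw [← hn T e hT x hx, h0 T]
        have : gradient (0 : Eu d → ℝ) x = 0 := by simp [gradient]
        rw [this]
        simp [mv]
      · rw [hp, indicator_of_notMem hx]; rfl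
    · rw [hv.1.2.2.2.1 T e hT]; rfl

end PolyMesh
end PDWG

/-! ### The adjoint problem for `u` -/

namespace PDWG

variable {d : ℕ}

namespace PolyMesh

variable {Ω : Set (Eu d)} (M : PolyMesh Ω) {k s : ℕ} {T : M.Cell}

open Classical in
/-- On an interior face, the jump of `u` seen from `T`; on a boundary face, the value of `u`. -/
noncomputable def valueDefect (u : M.Cell → Eu d → ℝ) (T : M.Cell) (e : M.Face) (x : Eu d) : ℝ :=
  2 * u T x - ∑ S, if M.Inc S e then u S x else 0

/-- The adjoint fluxes of a piecewise function. -/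
noncomputable def adjFluxes (A : M.Cell → Matrix (Fin d) (Fin d) ℝ) (β : M.Cell → Eu d)
    (u : M.Cell → Eu d → ℝ) (T : M.Cell) : Eu d → Eu d := adjFlux (A T) (β T) (u T)

open Classical in
/-- The weak function that tests the adjoint residual of `u` and its jumps against themselves. -/
noncomputable def testFn (ΓD ΓN : Set (Eu d)) (A : M.Cell → Matrix (Fin d) (Fin d) ℝ)
    (β : M.Cell → Eu d) (u : M.Cell → Eu d → ℝ) : M.WeakFn :=
  (fun T => dvg (M.adjFluxes A β u T),
    fun e => if M.face e ⊆ ΓD then 0 else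
      (M.face e).indicator fun x => - M.jump (M.adjFluxes A β u) e x,
    fun T e => if M.Inc T e ∧ ¬ M.face e ⊆ ΓN then (M.face e).indicator (M.valueDefect u T e)
      else 0)

variable {M} {A : M.Cell → Matrix (Fin d) (Fin d) ℝ} {β : M.Cell → Eu d} {u : M.Cell → Eu d → ℝ}

lemma valueDefect_mem (hu : u ∈ M.Mh s) (T : M.Cell) (e : M.Face) :
    M.valueDefect u T e ∈ polyFun d s := by
  classical
  have h : M.valueDefect u T e = (2 : ℝ) • u T - ∑ S, if M.Inc S e then u S else 0 := by
    ext x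
    simp only [valueDefect, Pi.sub_apply, Pi.smul_apply, smul_eq_mul, Finset.sum_apply]
    congr 1
    refine Finset.sum_congr rfl fun S _ => ?_
    split_ifs <;> rfl
  rw [h]
  refine Submodule.sub_mem _ (Submodule.smul_mem _ _ (hu T (mem_univ T)))
    (Submodule.sum_mem _ fun S _ => ?_)
  split_ifs
  · exact hu S (mem_univ S)
  · exact Submodule.zero_mem _

lemma isPolyVec_adjFluxes (hu : u ∈ M.Mh s) (T : M.Cell) : IsPolyVec s (M.adjFluxes A β u T) :=
  isPolyVec_adjFlux _ _ (hu T (mem_univ T))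

lemma jump_mem {F : M.Cell → Eu d → Eu d} (hF : ∀ T, IsPolyVec s (F T)) (e : M.Face) :
    M.jump F e ∈ polyFun d s := by
  classical
  have h : M.jump F e = ∑ T, if M.Inc T e then fun x => inner ℝ (F T x) (M.normal T e) else 0 := by
    ext x
    simp only [jump, Finset.sum_apply]
    refine Finset.sum_congr rfl fun S _ => ?_
    split_ifs <;> rfl
  rw [h]
  refine Submodule.sum_mem _ fun T _ => ?_
  split_ifs
  · exact (hF T).inner_const _
  · exact Submodule.zero_mem _

lemma valueDefect_interior {T' : M.Cell} {e : M.Face} (hne : T ≠ T') (h : M.Inc T e)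
    (h' : M.Inc T' e) (x : Eu d) : M.valueDefect u T e x = u T x - u T' x := by
  rw [valueDefect, M.sum_inc_interior hne h h']; ring

lemma valueDefect_boundary (hΩ : interior (closure Ω) = Ω) {e : M.Face}
    (he : M.face e ⊆ frontier Ω) (h : M.Inc T e) (x : Eu d) : M.valueDefect u T e x = u T x := by
  rw [valueDefect, M.sum_inc_boundary hΩ he h]; ring

/-- The degrees fit: the divergence and the jumps of the adjoint fluxes have degree at most `s ≤ k`,
and the jumps of `u`, which serve as `w_n`, have degree at most `s ≤ k - 1`. The jump of `u` changes
sign with the side, as `w_n` must. -/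
lemma testFn_mem (hs : s ≤ k - 1) (ΓD ΓN : Set (Eu d)) (hu : u ∈ M.Mh s) :
    M.testFn ΓD ΓN A β u ∈ M.Wh0 ΓD ΓN k := by
  classical
  have hk : s ≤ k := hs.trans (Nat.sub_le k 1)
  refine ⟨⟨fun T => ?_, fun e => ?_, fun T e h => ?_, fun T e h => ?_, fun T T' e hne h h' => ?_⟩,
    fun e he => if_pos he, fun T e he => if_neg fun h => h.2 he⟩
  · exact polyFun_mono ((Nat.sub_le s 1).trans hk) (isPolyVec_adjFluxes hu T).dvg
  · change (if _ then _ else _) ∈ _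
    split_ifs
    · exact Submodule.zero_mem _
    · exact ⟨_, polyFun_mono hk (Submodule.neg_mem _ (jump_mem (isPolyVec_adjFluxes hu) e)), rfl⟩
  · change (if _ then _ else _) ∈ _
    split_ifs
    · exact ⟨_, polyFun_mono hs (valueDefect_mem hu T e), rfl⟩
    · exact Submodule.zero_mem _
  · exact if_neg fun h' => h h'.1
  · change (if _ then _ else _) + (if _ then _ else _) = _
    by_cases hN : M.face e ⊆ ΓN
    · rw [if_neg fun h => h.2 hN, if_neg fun h => h.2 hN, add_zero]
    · rw [if_pos ⟨h, hN⟩, if_pos ⟨h', hN⟩, ← indicator_add']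
      refine indicator_eq_zero'.2 ?_
      rw [disjoint_left]
      intro x hx _
      refine hx ?_
      rw [Pi.add_apply, valueDefect_interior hne h h', valueDefect_interior hne.symm h' h]
      ring

open Classical in
-- With `[u] = u_T - u_T'` on an interior face, the two cells contribute `[u] u_T - [u] u_T' =
-- [u]²`; on a boundary face the defect is `u_T` itself.
lemma sum_valueDefect_mul (hΩ : IsPolyhedralDomain Ω) {e : M.Face} (h : M.Inc T e) (x : Eu d) :
    (∑ S, if M.Inc S e then M.valueDefect u S e x * u S x else 0) = M.valueDefect u T e x ^ 2 := by
  rcases M.face_position e with hi | hb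
  · obtain ⟨T', hne, h'⟩ := M.exists_neighbour hΩ.isOpen h hi
    rw [M.sum_inc_interior hne h h', valueDefect_interior hne h h',
      valueDefect_interior hne.symm h' h]
    ring
  · rw [M.sum_inc_boundary hΩ.interior_closure hb h, valueDefect_boundary hΩ.interior_closure hb h]
    ring

open Classical in
-- The sum is reordered by faces. At each face the terms `w_n u` add up to the squared jump of `u`,
-- and the terms `-w_b` times normal flux to the squared jump of the flux. The choice `τ` only fixes
-- the side from which the jump of `u` is written.
lemma sum_dualForm_testFn (hΩ : IsPolyhedralDomain Ω) (ΓD ΓN : Set (Eu d)) (hu : u ∈ M.Mh s)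
    {τ : M.Face → M.Cell} (hτ : ∀ e, M.Inc (τ e) e) :
    ∑ T, M.dualForm (A T) (β T) T (u T) (M.testFn ΓD ΓN A β u) =
      (∑ T, ∫ x in M.cell T, dvg (M.adjFluxes A β u T) x ^ 2) +
      ∑ e, ∫ x in M.face e, ((if M.face e ⊆ ΓD then 0 else M.jump (M.adjFluxes A β u) e x ^ 2) +
        if M.face e ⊆ ΓN then 0 else M.valueDefect u (τ e) e x ^ 2) ∂(surf d) := by
  -- `testFn` does not depend on `k`; the value `s + 1` serves only to obtain integrability on the
  -- faces.
  have hw : M.testFn ΓD ΓN A β u ∈ M.Wh (s + 1) := (testFn_mem (k := s + 1) le_rfl ΓD ΓN hu).1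
  simp only [dualForm]
  rw [Finset.sum_add_distrib]
  congr 1
  · refine Finset.sum_congr rfl fun T _ => ?_
    congr 1; ext x
    change dvg _ x * dvg _ x = _
    rw [pow_two, adjFluxes]
  · unfold bdryInt
    rw [Finset.sum_comm]
    refine Finset.sum_congr rfl fun e _ => ?_
    have h1 : ∀ T, (if M.Inc T e then ∫ x in M.face e, ((M.testFn ΓD ΓN A β u).2.2 T e x * u T x -
        (M.testFn ΓD ΓN A β u).2.1 e x *
          inner ℝ (adjFlux (A T) (β T) (u T) x) (M.normal T e)) ∂(surf d) else 0) =
        ∫ x in M.face e, (if M.Inc T e then ((M.testFn ΓD ΓN A β u).2.2 T e x * u T x -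
        (M.testFn ΓD ΓN A β u).2.1 e x *
          inner ℝ (adjFlux (A T) (β T) (u T) x) (M.normal T e)) else 0) ∂(surf d) := by
      intro T
      split_ifs <;> simp
    rw [Finset.sum_congr rfl fun T _ => h1 T, ← integral_finsetSum]
    · refine setIntegral_congr_fun (M.measurableSet_face e) fun x hx => ?_
      have h2 : ∀ T, (if M.Inc T e then ((M.testFn ΓD ΓN A β u).2.2 T e x * u T x -
          (M.testFn ΓD ΓN A β u).2.1 e x *
            inner ℝ (adjFlux (A T) (β T) (u T) x) (M.normal T e)) else 0) =
          (if M.face e ⊆ ΓN then 0 else 1) *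
            (if M.Inc T e then M.valueDefect u T e x * u T x else 0) +
          (if M.face e ⊆ ΓD then 0 else M.jump (M.adjFluxes A β u) e x) *
            (if M.Inc T e then inner ℝ (M.adjFluxes A β u T x) (M.normal T e) else 0) := by
        intro T
        by_cases hT : M.Inc T e <;> by_cases hD : M.face e ⊆ ΓD <;> by_cases hN : M.face e ⊆ ΓN <;>
          simp [testFn, hT, hD, hN, hx, adjFluxes]
      simp only [h2]
      rw [Finset.sum_add_distrib, ← Finset.mul_sum, ← Finset.mul_sum,
        sum_valueDefect_mul hΩ (hτ e)]
      change _ + _ * M.jump (M.adjFluxes A β u) e x = _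
      split_ifs <;> ring
    · intro T _
      split_ifs
      · exact (((faceCont_wn hw T e).mul
          (.of_continuous (continuous_of_mem_polyFun (hu T (mem_univ T))))).sub
          ((faceCont_wb hw e).mul (.of_continuous
            ((isPolyVec_adjFluxes hu T).continuous.inner continuous_const)))).integrableOn
      · exact integrable_zero _ _ _

/-- A piecewise polynomial orthogonal to all test functions solves the adjoint problem strongly. -/
lemma strong_adjoint (hΩ : IsPolyhedralDomain Ω) {ΓD ΓN : Set (Eu d)} (hs : s ≤ k - 1)
    (hu : u ∈ M.Mh s)
    (h : ∀ w ∈ M.Wh0 ΓD ΓN k, ∑ T, M.dualForm (A T) (β T) T (u T) w = 0) :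
    (∀ T, ∀ x ∈ M.cell T, dvg (M.adjFluxes A β u T) x = 0) ∧
    (∀ e, ¬ M.face e ⊆ ΓD → ∀ x ∈ M.face e, M.jump (M.adjFluxes A β u) e x = 0) ∧
    ∀ T e, M.Inc T e → ¬ M.face e ⊆ ΓN → ∀ x ∈ M.face e, M.valueDefect u T e x = 0 := by
  classical
  have jc := fun e => continuous_of_mem_polyFun (jump_mem (isPolyVec_adjFluxes (A := A) (β := β) hu) e)
  have dc := fun T e => continuous_of_mem_polyFun (valueDefect_mem hu T e)
  have main : ∀ τ : M.Face → M.Cell, (∀ e, M.Inc (τ e) e) →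
      (∀ T, ∫ x in M.cell T, dvg (M.adjFluxes A β u T) x ^ 2 = 0) ∧
      ∀ e, ∫ x in M.face e, ((if M.face e ⊆ ΓD then 0 else M.jump (M.adjFluxes A β u) e x ^ 2) +
        if M.face e ⊆ ΓN then 0 else M.valueDefect u (τ e) e x ^ 2) ∂(surf d) = 0 := by
    intro τ hτ
    have h0 := h _ (testFn_mem (A := A) (β := β) hs ΓD ΓN hu)
    rw [sum_dualForm_testFn hΩ ΓD ΓN hu hτ] at h0
    have p1 : ∀ T, 0 ≤ ∫ x in M.cell T, dvg (M.adjFluxes A β u T) x ^ 2 := fun T =>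
      integral_nonneg fun x => sq_nonneg _
    have p2 : ∀ e, 0 ≤ ∫ x in M.face e, ((if M.face e ⊆ ΓD then 0 else
        M.jump (M.adjFluxes A β u) e x ^ 2) +
        if M.face e ⊆ ΓN then 0 else M.valueDefect u (τ e) e x ^ 2) ∂(surf d) := fun e =>
      integral_nonneg fun x => by
        refine add_nonneg ?_ ?_ <;> split_ifs <;> positivity
    have q1 := Finset.sum_nonneg fun T (_ : T ∈ Finset.univ) => p1 T
    have q2 := Finset.sum_nonneg fun e (_ : e ∈ Finset.univ) => p2 e
    exact ⟨fun T => (Finset.sum_eq_zero_iff_of_nonneg fun T _ => p1 T).1 (by linarith) T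
      (Finset.mem_univ T), fun e => (Finset.sum_eq_zero_iff_of_nonneg fun e _ => p2 e).1
      (by linarith) e (Finset.mem_univ e)⟩
  choose τ hτ using M.face_mem
  have key : ∀ (τ : M.Face → M.Cell), (∀ e, M.Inc (τ e) e) → ∀ e,
      (¬ M.face e ⊆ ΓD → ∀ x ∈ M.face e, M.jump (M.adjFluxes A β u) e x = 0) ∧
      (¬ M.face e ⊆ ΓN → ∀ x ∈ M.face e, M.valueDefect u (τ e) e x = 0) := by
    intro τ hτ e
    have i1 : IntegrableOn (fun x => if M.face e ⊆ ΓD then (0 : ℝ) else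
        M.jump (M.adjFluxes A β u) e x ^ 2) (M.face e) (surf d) := by
      split_ifs
      · exact integrable_zero _ _ _
      · exact M.integrableOn_face ((jc e).pow 2) e
    have i2 : IntegrableOn (fun x => if M.face e ⊆ ΓN then (0 : ℝ) else
        M.valueDefect u (τ e) e x ^ 2) (M.face e) (surf d) := by
      split_ifs
      · exact integrable_zero _ _ _
      · exact M.integrableOn_face ((dc _ e).pow 2) e
    have h1 := (main τ hτ).2 e
    rw [integral_add i1 i2] at h1
    have n1 : 0 ≤ ∫ x in M.face e, (if M.face e ⊆ ΓD then (0 : ℝ) else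
        M.jump (M.adjFluxes A β u) e x ^ 2) ∂(surf d) :=
      integral_nonneg fun x => by dsimp only; split_ifs <;> positivity
    have n2 : 0 ≤ ∫ x in M.face e, (if M.face e ⊆ ΓN then (0 : ℝ) else
        M.valueDefect u (τ e) e x ^ 2) ∂(surf d) :=
      integral_nonneg fun x => by dsimp only; split_ifs <;> positivity
    refine ⟨fun hD => M.eq_zero_on_face (jc e) ?_, fun hN => M.eq_zero_on_face (dc _ e) ?_⟩
    · simp only [if_neg hD] at n1 h1
      linarith
    · simp only [if_neg hN] at n2 h1
      linarith
  refine ⟨fun T => M.eq_zero_on_cell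
    (continuous_of_mem_polyFun (isPolyVec_adjFluxes hu T).dvg) ((main τ hτ).1 T),
    fun e => (key τ hτ e).1, fun T e hT hN => ?_⟩
  -- The choice of side is redirected to `T` at the face `e`, which gives the conclusion for every
  -- cell at `e`.
  have := (key (Function.update τ e T) (fun e' => ?_) e).2 hN
  · simpa using this
  · by_cases he : e' = e
    · subst he; simpa using hT
    · rw [Function.update_of_ne he]; exact hτ e'

/-- A strong solution of the homogeneous adjoint problem vanishes, by solvability of the dual
problem. -/
lemma eq_zero_of_strong_adjoint [NeZero d] (hΩ : IsPolyhedralDomain Ω)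
    (hLip : HasLipschitzBoundary Ω) {ΓD ΓN : Set (Eu d)} (hΓ : M.IsBoundaryPartition ΓD ΓN)
    {a : Eu d → Matrix (Fin d) (Fin d) ℝ} {b : Eu d → Eu d}
    (ha : ∀ T, ∀ x ∈ M.cell T, a x = A T) (hb : ∀ T, ∀ x ∈ M.cell T, b x = β T)
    (hA : ∀ T, (A T).IsSymm) {ε : ℝ} (hε₀ : 0 ≤ ε) (hε₁ : ε < 1)
    (hreg : DualRegular Ω ΓD a b ε) (hu : u ∈ M.Mh s)
    (hdiv : ∀ T, ∀ x ∈ M.cell T, dvg (M.adjFluxes A β u T) x = 0)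
    (hjump : ∀ e, ¬ M.face e ⊆ ΓD → ∀ x ∈ M.face e, M.jump (M.adjFluxes A β u) e x = 0)
    (hval : ∀ T e, M.Inc T e → ¬ M.face e ⊆ ΓN → ∀ x ∈ M.face e, M.valueDefect u T e x = 0) :
    u = 0 := by
  have uc : ∀ T, ContDiff ℝ 1 (u T) := fun T => contDiff_of_mem_polyFun (hu T (mem_univ T))
  have hΓD : ΓD ⊆ frontier Ω := hΓ.union ▸ subset_union_left
  have hΓN : ΓN ⊆ frontier Ω := hΓ.union ▸ subset_union_right
  have hcont : ∀ e, M.face e ⊆ Ω → ∀ T T', M.Inc T e → M.Inc T' e → ∀ x ∈ M.face e,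
      u T x = u T' x := by
    intro e he T T' h h' x hx
    rcases eq_or_ne T T' with rfl | hne
    · rfl
    have := hval T e h (fun hN => M.not_subset_frontier hΩ.isOpen he (hN.trans hΓN)) x hx
    rw [valueDefect_interior hne h h'] at this
    exact sub_eq_zero.1 this
  have hzero : ∀ e, M.face e ⊆ ΓD → ∀ T, M.Inc T e → ∀ x ∈ M.face e, u T x = 0 := by
    intro e he T h x hx
    -- A face contained in both `ΓD` and `ΓN` would be null, but faces have positive surface
    -- measure.
    have hN : ¬ M.face e ⊆ ΓN := fun hN => by
      have h1 := M.surf_inter_face_pos e isOpen_univ ⟨x, mem_univ x, hx⟩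
      rw [univ_inter] at h1
      exact h1.ne' (measure_mono_null (subset_inter he hN) hΓ.inter)
    rw [← valueDefect_boundary (u := u) hΩ.interior_closure (he.trans hΓD) h]
    exact hval T e h hN x hx
  have hU := M.memLp_pw (fun T => (uc T).continuous) hΩ.isBounded
  obtain ⟨C, hC⟩ := hreg
  -- `lam` is the dual solution with right-hand side `u`. In `h1` its flux is tested with `u`, which
  -- vanishes on `Γ_D`; in `h2` the adjoint flux of `u` is tested with `lam`.
  obtain ⟨lam, G, g, hG, hg, hl0, hln, heq⟩ := (hC (M.pw u) hU).1
  have hae := ae_eq_of_forall_integral_eq hΩ.isOpen hΩ.isBounded hε₀ hε₁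
    (hg.memLp_div.add (M.memLp_inner_pw hΩ.isBounded (fun T => ⟨β T, hb T⟩) hG.memLp_grad)) hU heq
  have h1 := hln (M.pw u) _ (M.hasWeakGrad_of_continuous hΩ.isOpen hΩ.isBounded uc hcont)
    (M.traceZeroOn_of_continuous hΩ.isOpen hΩ.isBounded hLip hΓ uc hcont hzero)
  have hF := M.memLp_pw (fun T => (isPolyVec_adjFluxes (A := A) (β := β) hu T).continuous)
    hΩ.isBounded
  have h2 := M.integral_flux_eq_zero hΩ.isOpen hΩ.isBounded
    (fun T => (isPolyVec_adjFluxes (A := A) (β := β) hu T).contDiff) hjump hΓD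
    (A := M.pw (M.adjFluxes A β u)) (g := fun _ => 0) (fun T x hx => M.pw_eq _ hx)
    (fun T x hx => (hdiv T x hx).symm) hG hl0
  simp only [zero_mul, add_zero] at h2
  have i1 : Integrable (fun x => (inner ℝ (M.pw (M.adjFluxes A β u) x) (G x) : ℝ))
      (volume.restrict Ω) := integrable_inner_of_memLp hF hG.memLp_grad
  have i2 : Integrable (fun x => M.pw u x ^ 2) (volume.restrict Ω) := hU.integrable_sq
  -- By symmetry of `a` and the dual equation, the integrands of `h1` and `h2` differ by `u²`; both
  -- integrals are zero, so `∫ u² = 0`.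
  have h3 : ∀ᵐ x ∂(volume.restrict Ω), inner ℝ (mv (a x) (G x))
      (M.pw (fun T => gradient (u T)) x) + g x * M.pw u x =
      inner ℝ (M.pw (M.adjFluxes A β u) x) (G x) + M.pw u x ^ 2 := by
    have hcell : ∀ᵐ x ∂(volume.restrict Ω), inner ℝ (mv (a x) (G x))
        (M.pw (fun T => gradient (u T)) x) =
        inner ℝ (M.pw (M.adjFluxes A β u) x) (G x) + M.pw u x * inner ℝ (b x) (G x) :=
      M.ae_restrict_of_cells fun T x hx => by
        rw [M.pw_eq _ hx, M.pw_eq _ hx, M.pw_eq _ hx, ha T x hx, hb T x hx, adjFluxes, adjFlux,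
          inner_sub_left, real_inner_smul_left, inner_mv_comm (hA T), real_inner_comm (G x)]
        ring
    filter_upwards [hcell, hae] with x hx hx'
    have : g x + inner ℝ (b x) (G x) = M.pw u x := hx'
    rw [hx, pow_two]
    nth_rw 4 [← this]
    ring
  rw [integral_congr_ae h3, integral_add i1 i2, h2, zero_add,
    integral_eq_zero_iff_of_nonneg (fun x => sq_nonneg _) i2] at h1
  have h4 : ∀ᵐ x ∂(volume.restrict Ω), M.pw u x = 0 := by
    filter_upwards [h1] with x hx
    exact pow_eq_zero_iff two_ne_zero |>.1 hx
  exact funext fun T => M.eq_zero_of_ae h4 (hu T (mem_univ T))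

end PolyMesh
end PDWG

/-! ### Unique solvability of the scheme -/

theorem theorem4p1 {d : ℕ} (hd : d = 2 ∨ d = 3) {Ω : Set (PDWG.Eu d)}
    (hΩ : PDWG.IsPolyhedralDomain Ω) (hLip : PDWG.HasLipschitzBoundary Ω)
    (M : PDWG.PolyMesh Ω) (ΓD ΓN : Set (PDWG.Eu d)) (hΓ : M.IsBoundaryPartition ΓD ΓN)
    (a : PDWG.Eu d → Matrix (Fin d) (Fin d) ℝ) (b : PDWG.Eu d → PDWG.Eu d)
    (ha_symm : ∀ x ∈ Ω, (a x).IsSymm)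
    (ha_pos : ∃ α : ℝ, 0 < α ∧ ∀ x ∈ Ω, ∀ ξ : PDWG.Eu d,
      α * ‖ξ‖ ^ 2 ≤ inner ℝ ξ (PDWG.mv (a x) ξ))
    (ha : M.IsPiecewiseConstant a) (hb : M.IsPiecewiseConstant b)
    (ε : ℝ) (hε₀ : 0 ≤ ε) (hε₁ : ε < 1 / 2) (hreg : PDWG.DualRegular Ω ΓD a b ε)
    (f g₁ g₂ : PDWG.Eu d → ℝ) (hf : MeasureTheory.IntegrableOn f Ω)
    (hg₁ : MeasureTheory.IntegrableOn g₁ ΓD (PDWG.surf d))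
    (hg₂ : MeasureTheory.IntegrableOn g₂ ΓN (PDWG.surf d))
    (k : ℕ) (hk : 2 ≤ k) :
    (∀ γ : ℝ, 0 < γ → ∀ s : ℕ, s = k - 2 ∨ s = k - 1 →
      ∃! p : (M.Cell → PDWG.Eu d → ℝ) × M.WeakFn,
        M.IsSolution ΓD ΓN a b γ k s f g₁ g₂ p) ∧
    (∃! p : (M.Cell → PDWG.Eu d → ℝ) × M.WeakFn,
      M.IsSolution ΓD ΓN a b 0 k (k - 1) f g₁ g₂ p) := by
  have : NeZero d := ⟨by omega⟩
  choose A hA using ha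
  choose β hβ using hb
  obtain ⟨α, hα, hpos⟩ := ha_pos
  have hsymm : ∀ T, (A T).IsSymm := fun T => by
    obtain ⟨x, hx⟩ := M.cell_nonempty T
    exact hA T x hx ▸ ha_symm x (M.cell_subset T hx)
  have hm : ∀ T, 0 < M.supNorm a T := fun T => by
    obtain ⟨x, hx⟩ := M.cell_nonempty T
    exact M.supNorm_pos (hA T) hα fun ξ => hA T x hx ▸ hpos x (M.cell_subset T hx) ξ
  -- All cases at once: `s ≤ k - 1` is enough for the adjoint argument, and equality is used only
  -- when the stabilizer does not control the residual.
  suffices H : ∀ γ : ℝ, 0 ≤ γ → ∀ s : ℕ, s ≤ k - 1 → (γ = 0 → s = k - 1) →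
      ∃! p : (M.Cell → PDWG.Eu d → ℝ) × M.WeakFn, M.IsSolution ΓD ΓN a b γ k s f g₁ g₂ p from
    ⟨fun γ hγ s hs => H γ hγ.le s (by omega) fun h => absurd h hγ.ne',
      H 0 le_rfl (k - 1) le_rfl fun _ => rfl⟩
  intro γ hγ s hs hγs
  refine M.existsUnique_isSolution hA hβ hf hg₁ hg₂ γ hs fun u hu v hv h1 h2 => ?_
  -- Testing with `v` itself; the coupling term disappears by the second equation.
  have hself := h1 v hv
  rw [h2 u hu, add_zero] at hself
  have hzero := fun T => (Finset.sum_eq_zero_iff_of_nonneg fun T _ =>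
    M.constStab_self_nonneg (T := T) (A T) (β T) (hm T) hγ v).1 hself T (Finset.mem_univ T)
  have hstab := fun T => M.of_constStab_self_eq_zero (hm T) hγ hv.1 (hzero T)
  have hres : ∀ T, ∀ x ∈ M.cell T, PDWG.PolyMesh.constOp (A T) (β T) (v.1 T) x = 0 := by
    rcases hγ.eq_or_lt' with h0 | hlt
    -- The residual has degree `k - 1 = s`, so it may be inserted as test function in the second
    -- equation, which then says that its `L²` norm is zero.
    · have hmem : (fun T => PDWG.PolyMesh.constOp (A T) (β T) (v.1 T)) ∈ M.Mh s := fun T _ =>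
        hγs h0 ▸ PDWG.constOp_mem (hv.1.1 T)
      have h3 := h2 _ hmem
      rw [Finset.sum_congr rfl fun T _ => M.dualForm_of_conforming (hsymm T) (β T) hv.1
        (hmem T (Set.mem_univ T)) (hstab T).1 (hstab T).2.1] at h3
      intro T
      have h4 := (Finset.sum_eq_zero_iff_of_nonneg fun T _ =>
        MeasureTheory.integral_nonneg fun x => mul_self_nonneg _).1 h3 T (Finset.mem_univ T)
      simp only [← pow_two] at h4
      exact M.eq_zero_on_cell (PDWG.continuous_of_mem_polyFun (hmem T (Set.mem_univ T))) h4
    · exact fun T => (hstab T).2.2 hlt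
  have hv0 : v = 0 := M.eq_zero_of_conforming hΩ hLip hΓ hA hβ hreg hv (fun T => (hstab T).1)
    (fun T => (hstab T).2.1) hres
  refine ⟨?_, hv0⟩
  -- With `v = 0` the stabilizer drops out of the first equation, and `u` is annihilated by all of
  -- `W_h^0`.
  have h5 : ∀ w ∈ M.Wh0 ΓD ΓN k, ∑ T, M.dualForm (A T) (β T) T (u T) w = 0 := fun w hw => by
    have h6 := h1 w hw
    have h7 : ∀ T, M.constStab (A T) (β T) (M.supNorm a T) γ T v w = 0 := fun T => by
      have := M.constStab_lin (T := T) (A T) (β T) (M.supNorm a T) γ (Submodule.zero_mem _)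
        (Submodule.zero_mem _) hw.1 1
      rw [smul_zero, add_zero] at this
      rw [hv0]
      linarith
    rwa [Finset.sum_congr rfl fun T _ => h7 T, Finset.sum_const_zero, zero_add] at h6
  obtain ⟨s1, s2, s3⟩ := PDWG.PolyMesh.strong_adjoint hΩ hs hu h5
  exact PDWG.PolyMesh.eq_zero_of_strong_adjoint hΩ hLip hΓ hA hβ hsymm hε₀ (by linarith) hreg hu
    s1 s2 s3
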